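/- **Setting.** For each density $\lambda>0$ let the base stations (BSs) form a homogeneous Poisson point process of intensity $\lambda$ in $\mathbb{R}^2$, with distances $r_0\le r_1\le\dots$ to a user at the origin, which is served by the closest BS. Each BS has one antenna and unit transmit power; the user has $N_r(\lambda)\ge 1$ antennas, where $N_r$ is non-decreasing and $N_r(\lambda)\to\infty$ as $\lambda\to\infty$. The channel $\boldsymbol h_i\in\mathbb{C}^{N_r(\lambda)}$ from the $i$-th closest BS to the user has i.i.d. $\mathcal{CN}(0,1)$ entries, and the $\boldsymbol h_i$ are independent of each other and of the BS locations. The noise power is $\sigma^2\ge 0$. The path loss $L:[0,\infty)\to[0,\infty)$ is measurable, bounded by $L_0=L(0)<\infty$, continuous at $0$, and $\gamma=\int_0^\infty rL(r)\,dr\in(0,\infty)$. With maximum ratio combining $\boldsymbol u=\boldsymbol h_0$, put $$\mathrm{SINR}(\lambda)=\frac{L(r_0)\|\boldsymbol h_0\|^4}{\sum_{i\ge1}L(r_i)|\boldsymbol h_0^*\boldsymbol h_i|^2+\|\boldsymbol h_0\|^2\sigma^2},\qquad \mathcal E(\lambda)=\lambda\log_2(1+\mathrm{SINR}(\lambda)),\qquad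 a=\frac{L_0}{2\pi\gamma}.$$ **Form of the SINR.** For every $\lambda>0$, $$\mathrm{SINR}(\lambda)=\frac{L(r_0)\tilde g}{\sum_{i\ge1}L(r_i)g_i+\sigma^2},\qquad \tilde g=\|\boldsymbol h_0\|^2,\quad g_i=\frac{|\boldsymbol h_0^*\boldsymbol h_i|^2}{\|\boldsymbol h_0\|^2},$$ where the sum is a.s. finite, $\tilde g\sim\Gamma(N_r(\lambda),1)$, the $g_i$ ($i\ge1$) are exponential with mean one, and $\tilde g,g_1,g_2,\dots$ are mutually independent and jointly independent of the BS locations. **Scaling laws.** Say that $S(\lambda)$ obeys the *SINR laws* if $\frac{\lambda}{N_r(\lambda)}S(\lambda)\to a$ and 1. if $\lambda/N_r(\lambda)\to\infty$ then $S(\lambda)\to0$; 2. if $\lambda/N_r(\lambda)\to c\in(0,\infty)$ then $S(\lambda)\to a/c$; 3. if $\lambda/N_r(\lambda)\to0$ then $S(\lambda)\to\infty$. Say that $A(\lambda)$ obeys the *ASE laws* if $A(\lambda)\to\infty$, $A(\lambda)=\Theta\big(\lambda\log(1+N_r(\lambda)/\lambda)\big)$, and 1. if $\lambda/N_r(\lambda)\to\infty$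 then $A(\lambda)/N_r(\lambda)\to a/\ln2$; 2. if $\lambda/N_r(\lambda)\to c\in(0,\infty)$ then $A(\lambda)/\lambda\to\log_2(1+a/c)$; 3. if $\lambda/N_r(\lambda)\to0$ then $A(\lambda)\big/\big(\lambda\log_2(1+N_r(\lambda)/\lambda)\big)\to1$. **(a) Conditional SINR and ASE.** Let the models for all $\lambda$ live on one probability space, such that the channel $\boldsymbol h_0$ of the serving link at density $\lambda$ consists of the first $N_r(\lambda)$ terms of one random sequence. Then almost surely $\mathrm{SINR}$ obeys the SINR laws and $\mathcal E$ the ASE laws, as $\lambda\to\infty$ along any given sequence $(\lambda_k)_{k\ge0}$ with $\lambda_k\ge\delta (k+1)$ for some $\delta>0$ (for example $\lambda_k=(k+1)\lambda_0$), however the models for different $\lambda$ are otherwise coupled. The same holds as $\lambda\to\infty$ through the reals if, almost surely, for all $\lambda\le\lambda'$ every BS present at density $\lambda$ is also present at density $\lambda'$, and the gain $g_i$ of each BS interfering at density $\lambda$ is the same at density $\lambda'$ (and, for almost every outcome, the BSs are ordered by distance at all $\lambda$ simultaneously). **(b) Mean SINR and ASE.** Suppose in addition that there are $\rho\ge0$,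 $\zeta>0$, $\mu_c\ge0$ and a differentiable decreasing $\tilde L:[\rho,\infty)\to(0,\infty)$ with $\tilde L\le L$ and $r\tilde L(r)\ge-\zeta\tilde L'(r)$ on $[\rho,\infty)$, and $\int_\rho^\infty \frac{r}{\tilde L(r)^2}e^{-\pi\mu r^2}\,dr<\infty$ for all $\mu>\mu_c$. Then $\mathrm{SINR}(\lambda)$ and $\mathcal E(\lambda)$ are integrable for all large $\lambda$, and as $\lambda\to\infty$ through the reals $\mathbb E[\mathrm{SINR}(\lambda)]$ obeys the SINR laws and $\mathbb E[\mathcal E(\lambda)]$ the ASE laws. -/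

import Mathlib

open MeasureTheory ProbabilityTheory Filter Topology

noncomputable section

namespace Downlink

/-- The plane in which the base stations (BSs) are located. -/
abbrev Plane : Type := EuclideanSpace ℝ (Fin 2)

/-! ### Path loss -/

/-- The constant `γ = ∫₀^∞ r L(r) dr`. -/
def pathGamma (L : ℝ → ℝ) : ℝ := ∫ r in Set.Ioi (0 : ℝ), r * L r

/-- Physically feasible path loss `L : [0,∞) → [0,∞)`, bounded by the finite value `L 0`, with
`γ` finite and nonzero. Values of `L` at negative arguments are never used. -/
structure PhysicallyFeasible (L : ℝ → ℝ) : Prop where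
  measurable : Measurable L
  nonneg : ∀ r, 0 ≤ r → 0 ≤ L r
  le_zero : ∀ r, 0 ≤ r → L r ≤ L 0
  integrable : IntegrableOn (fun r => r * L r) (Set.Ioi 0)
  gamma_pos : 0 < pathGamma L

/-- The additional tail condition on the path loss: from some `ρ ≥ 0` on, `L` is bounded below by a
differentiable decreasing `M` with `r M(r) / (-M'(r)) ≥ ζ > 0` (written without the division, so
that it holds where `M'(r) = 0`) and such that `∫_ρ^∞ r / M(r)² e^{-π μ r²} dr` is finite for all
`μ > μc`. Finiteness of the integral forces `M > 0`, which is recorded since `x / 0 = 0` here. -/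
def TailCondition (L : ℝ → ℝ) : Prop :=
  ∃ (ρ ζ μc : ℝ) (M : ℝ → ℝ), 0 ≤ ρ ∧ 0 < ζ ∧ 0 ≤ μc ∧
    DifferentiableOn ℝ M (Set.Ici ρ) ∧ AntitoneOn M (Set.Ici ρ) ∧
    (∀ r, ρ ≤ r → 0 < M r) ∧
    (∀ r, ρ ≤ r → M r ≤ L r) ∧
    (∀ r, ρ ≤ r → ζ * (-derivWithin M (Set.Ici ρ) r) ≤ r * M r) ∧
    (∀ μ, μc < μ →
      IntegrableOn (fun r => r / M r ^ 2 * Real.exp (-Real.pi * μ * r ^ 2)) (Set.Ici ρ))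

/-! ### Poisson point processes -/

section

variable {Ω E : Type*} [MeasurableSpace Ω] [MeasurableSpace E]

/-- The number of points of the enumerated configuration `X` that fall into `A`. -/
def pointCount (X : ℕ → Ω → E) (A : Set E) (ω : Ω) : ℕ∞ := {i | X i ω ∈ A}.encard

/-- The random points `X 0, X 1, …` form a Poisson point process with intensity measure `ν`:
counts are Poisson, and counts in disjoint sets are independent. -/
structure IsPoissonProcess (X : ℕ → Ω → E) (ν : Measure E) (P : Measure Ω) : Prop where
  measurable : ∀ i, Measurable (X i)
  count_law : ∀ A : Set E, MeasurableSet A → ν A ≠ ⊤ →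
    HasLaw (pointCount X A) ((poissonMeasure (ν A).toNNReal).map (fun k : ℕ => (k : ℕ∞))) P
  count_indep : ∀ (m : ℕ) (A : Fin m → Set E), (∀ j, MeasurableSet (A j)) →
    (∀ j, ν (A j) ≠ ⊤) → Pairwise (fun j k => Disjoint (A j) (A k)) →
    iIndepFun (fun j => pointCount X (A j)) P

/-- Homogeneous Poisson point process of intensity `lam` in the plane, enumerated by increasing
distance to the origin. So `X 0` is the BS that serves the user at the origin, and
`X 1, X 2, …` are the interfering BSs. -/
structure IsOrderedHPPP (X : ℕ → Ω → Plane) (lam : ℝ) (P : Measure Ω) : Prop where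
  poisson : IsPoissonProcess X (ENNReal.ofReal lam • (volume : Measure Plane)) P
  ordered : ∀ᵐ ω ∂P, Monotone fun i => ‖X i ω‖

end

/-! ### Fading and SINR -/

/-- The circularly symmetric complex Gaussian law with zero mean and unit variance. -/
def stdComplexGaussian : Measure ℂ :=
  ((gaussianReal 0 (1 / 2)).prod (gaussianReal 0 (1 / 2))).map
    (fun p : ℝ × ℝ => (⟨p.1, p.2⟩ : ℂ))

/-- The network seen by a typical user with `n` antennas when the BSs have one antenna and density
`lam`: BSs at `X i`, channel vector `h i ∈ ℂⁿ` from the `i`-th closest BS to the user. The channel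
coefficients are i.i.d. `CN(0,1)` and independent of the locations. -/
structure IsSIMONetwork {Ω : Type*} [MeasurableSpace Ω] (P : Measure Ω) (lam : ℝ) {n : ℕ}
    (X : ℕ → Ω → Plane) (h : ℕ → Ω → Fin n → ℂ) : Prop where
  locations : IsOrderedHPPP X lam P
  fading_measurable : ∀ i, Measurable (h i)
  fading_law : ∀ i k, HasLaw (fun ω => h i ω k) stdComplexGaussian P
  fading_indep : iIndepFun (fun (q : ℕ × Fin n) ω => h q.1 ω q.2) P
  fading_indep_locations : IndepFun (fun ω i => h i ω) (fun ω i => X i ω) P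

/-- The SINR at the user for general precoders `p i` and combiner `u`, given the distances `r i`
(`r 0` to the serving BS) and the channel matrices `H i`:
`L(r₀)|u* H₀ p₀|² / (∑_{i ≥ 1} L(rᵢ)|u* Hᵢ pᵢ|² + ‖u‖² σ²)`. -/
def sinr {n m : ℕ} (L : ℝ → ℝ) (σ2 : ℝ) (r : ℕ → ℝ) (H : ℕ → Matrix (Fin n) (Fin m) ℂ)
    (p : ℕ → Fin m → ℂ) (u : Fin n → ℂ) : ℝ :=
  L (r 0) * ‖star u ⬝ᵥ (H 0).mulVec (p 0)‖ ^ 2 /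
    ((∑' i, L (r (i + 1)) * ‖star u ⬝ᵥ (H (i + 1)).mulVec (p (i + 1))‖ ^ 2) +
      (∑ k, ‖u k‖ ^ 2) * σ2)

/-- SINR with single-antenna BSs of unit power and maximum ratio combining `u = h 0`. -/
def simoSINR {n : ℕ} (L : ℝ → ℝ) (σ2 : ℝ) (x : ℕ → Plane) (h : ℕ → Fin n → ℂ) : ℝ :=
  sinr L σ2 (fun i => ‖x i‖) (fun i => Matrix.replicateCol (Fin 1) (h i)) (fun _ _ => 1) (h 0)

/-- The effective gain `|h₀* hᵢ|² / ‖h₀‖²` of the `i`-th link after maximum ratio combining; for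
`i = 0` it is `‖h₀‖²`. -/
def mrcGain {n : ℕ} (h : ℕ → Fin n → ℂ) (i : ℕ) : ℝ :=
  ‖star (h 0) ⬝ᵥ h i‖ ^ 2 / ∑ k, ‖h 0 k‖ ^ 2

/-- Conditional area spectral efficiency at density `lam` and SINR `s`. -/
def ase (lam s : ℝ) : ℝ := lam * Real.logb 2 (1 + s)

/-! ### Scaling laws -/

/-- `S` obeys the SINR scaling laws with constant `a` along the filter `l`, where `lam` is the BS
density and `n` the number of antennas. -/
structure SINRScaling {ι : Type*} (a : ℝ) (l : Filter ι) (lam n S : ι → ℝ) : Prop where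
  ratio : Tendsto (fun i => lam i / n i * S i) l (𝓝 a)
  sublinear : Tendsto (fun i => lam i / n i) l atTop → Tendsto S l (𝓝 0)
  linear : ∀ c : ℝ, 0 < c → Tendsto (fun i => lam i / n i) l (𝓝 c) → Tendsto S l (𝓝 (a / c))
  superlinear : Tendsto (fun i => lam i / n i) l (𝓝 0) → Tendsto S l atTop

/-- `A` obeys the area spectral efficiency scaling laws along the filter `l`: it tends to infinity
with order `lam log(1 + n / lam)`, and with the sharper asymptotics below in each regime. -/
structure ASEScaling {ι : Type*} (a : ℝ) (l : Filter ι) (lam n A : ι → ℝ) : Prop where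
  order : A =Θ[l] fun i => lam i * Real.log (1 + n i / lam i)
  tendsto_atTop : Tendsto A l atTop
  sublinear : Tendsto (fun i => lam i / n i) l atTop →
    Tendsto (fun i => A i / n i) l (𝓝 (a / Real.log 2))
  linear : ∀ c : ℝ, 0 < c → Tendsto (fun i => lam i / n i) l (𝓝 c) →
    Tendsto (fun i => A i / lam i) l (𝓝 (Real.logb 2 (1 + a / c)))
  superlinear : Tendsto (fun i => lam i / n i) l (𝓝 0) →
    Tendsto (fun i => A i / (lam i * Real.logb 2 (1 + n i / lam i))) l (𝓝 1)

/-- Densification: almost surely, the BSs are ordered by distance at all densities simultaneously,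
and passing from density `lam` to a larger density `lam'` only adds BSs, while the effective gain
of a BS that already interferes stays the same. Here `φ` sends the rank of a BS at density `lam` to
its rank at density `lam'`. -/
def Densification {Ω : Type*} [MeasurableSpace Ω] (P : Measure Ω) {N : ℝ → ℕ}
    (X : ℝ → ℕ → Ω → Plane) (h : (lam : ℝ) → ℕ → Ω → Fin (N lam) → ℂ) : Prop :=
  ∀ᵐ ω ∂P,
    (∀ lam : ℝ, 0 < lam → Monotone fun i => ‖X lam i ω‖) ∧
    ∀ lam lam' : ℝ, 0 < lam → lam ≤ lam' → ∃ φ : ℕ → ℕ, Function.Injective φ ∧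
      (∀ i, X lam' (φ i) ω = X lam i ω) ∧
      ∀ i, i ≠ 0 → φ i ≠ 0 ∧
        mrcGain (fun j => h lam' j ω) (φ i) = mrcGain (fun j => h lam j ω) i

end Downlink

end

set_option linter.unusedSectionVars false

noncomputable section

namespace Downlink

open scoped NNReal ENNReal

/-! ### Logarithm estimates -/

/-! Write λ/N · SINR = L(r₀) · (g̃/N) / (I/λ + σ²/λ) with I = Σ_{i≥1} L(rᵢ) gᵢ. Each ingredient has
a deterministic limit: the nearest point tends to the origin, so L(r₀) → L 0; g̃ is a sum of N
independent exponentials of mean one, so g̃/N → 1; and I/λ concentrates at ∫ L(‖x‖) dx = 2πγ. Hence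
the quotient tends to a = L 0 / (2πγ).

All scaling laws follow from this limit. For the SINR it is a division by λ/N
(`sinrScaling_of_ratio`). For the ASE, Bernoulli's inequality bounds the relative error between
log(1 + vx) and log(1 + ax) by |v − a|/a, uniformly in x (`abs_log_one_add_mul_sub_le`), so that
log(1 + SINR) may be compared with log(1 + aN/λ) in every regime of N/λ at once
(`aseScaling_of_tendsto`).

Joint independence of the gains rests on rotation invariance: in whatever direction h₀ points, the
component of an independent hᵢ along it is CN(0,1). As this conditional law is constant, gᵢ is
independent of all earlier channels, including the h₀ that enters it
(`hasLaw_and_indepFun_of_map_eq`, `iIndepFun_nat_of_indepFun_past`).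

The concentration of I is a Chernoff bound. Averaging the gains with the locations frozen, and the
locations through the Laplace functional of the Poisson process, bounds E exp(±sI) by exponentials
whose exponent is ±2πγλs to first order in s, up to a bounded factor
(`exists_interference_concentration`). The deviations are exponentially small in λ, so
Borel–Cantelli applies along densities of at least linear growth; it sees only the law at each
density, never the coupling. Under densification r₀ decreases and I increases with λ, so the integer
densities control all real ones.

The means need convergence in L¹. Here λ/N · SINR = (g̃/N) · W, where W = L(r₀)λ/(I + σ²) is
independent of g̃. Outside an event of exponentially small probability W is close to a, and on that
event a polynomial bound on E[W²] suffices. It comes from a bound on E[I⁻²]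
(`exists_bound_lintegral_inv_sq`): four points in an annulus leave three interferers, a sum of three
exponentials has a finite inverse second moment, and the tail integral pays for the configurations
in which four points are found only far out. -/

lemma log_one_add_mul_le_mul {c x : ℝ} (hc : 1 ≤ c) (hx : 0 ≤ x) :
    Real.log (1 + c * x) ≤ c * Real.log (1 + x) := by
  have h := one_add_mul_self_le_rpow_one_add (s := x) (by linarith) hc
  have h2 := Real.log_le_log (by positivity) h
  rwa [Real.log_rpow (by linarith)] at h2

lemma mul_log_le_log_one_add_mul {c x : ℝ} (hc : 0 ≤ c) (hc1 : c ≤ 1) (hx : 0 ≤ x) :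
    c * Real.log (1 + x) ≤ Real.log (1 + c * x) := by
  have h := rpow_one_add_le_one_add_mul_self (s := x) (by linarith) hc hc1
  have h2 := Real.log_le_log (Real.rpow_pos_of_pos (by linarith) _) h
  rwa [Real.log_rpow (by linarith)] at h2

/-- Bernoulli with exponent v/a, which lies on either side of 1. The factor |v − a|/a does not
involve x, so the estimate serves all regimes at once, and it is linear in |v − a|, so it can be
integrated over the outcomes. -/
lemma abs_log_one_add_mul_sub_le {a v x : ℝ} (ha : 0 < a) (hv : 0 ≤ v) (hx : 0 ≤ x) :
    |Real.log (1 + v * x) - Real.log (1 + a * x)| ≤ |v - a| / a * Real.log (1 + a * x) := by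
  have hax : 0 ≤ a * x := by positivity
  have he : v * x = v / a * (a * x) := by field_simp
  rcases le_total a v with h | h
  · have h1 : 1 ≤ v / a := by rwa [one_le_div ha]
    have h2 := log_one_add_mul_le_mul h1 hax
    have h3 : Real.log (1 + a * x) ≤ Real.log (1 + v * x) :=
      Real.log_le_log (by positivity) (by gcongr)
    rw [abs_of_nonneg (by linarith), abs_of_nonneg (by linarith), sub_div, div_self ha.ne', he]
    linarith
  · have h1 : v / a ≤ 1 := by rwa [div_le_one ha]
    have h2 := mul_log_le_log_one_add_mul (by positivity) h1 hax
    have h3 : Real.log (1 + v * x) ≤ Real.log (1 + a * x) :=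
      Real.log_le_log (by positivity) (by gcongr)
    rw [abs_of_nonpos (by linarith), abs_of_nonpos (by linarith), neg_div, sub_div,
      div_self ha.ne', he]
    linarith

lemma tendsto_log_one_add_mul_div {a : ℝ} :
    Tendsto (fun x => Real.log (1 + a * x) / x) (𝓝[≠] 0) (𝓝 a) := by
  have h : HasDerivAt (fun x : ℝ => Real.log (1 + a * x)) a 0 := by
    have h1 : HasDerivAt (fun x : ℝ => 1 + a * x) a 0 := by
      simpa using ((hasDerivAt_id (0 : ℝ)).const_mul a).const_add 1
    simpa using h1.log (by simp)
  have := h.tendsto_slope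
  refine this.congr fun x => ?_
  simp [slope_def_field]

lemma tendsto_log_one_add_mul_div_log {a : ℝ} (ha : 0 < a) :
    Tendsto (fun x => Real.log (1 + a * x) / Real.log (1 + x)) atTop (𝓝 1) := by
  have h1 : Tendsto (fun x : ℝ => Real.log (1 + x)) atTop atTop :=
    Real.tendsto_log_atTop.comp (tendsto_atTop_add_const_left _ _ tendsto_id)
  have h2 : Tendsto (fun x : ℝ => (1 + a * x) / (1 + x)) atTop (𝓝 a) := by
    have h3 : Tendsto (fun x : ℝ => a + (1 - a) / (1 + x)) atTop (𝓝 (a + 0)) :=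
      tendsto_const_nhds.add (tendsto_const_nhds.div_atTop
        (tendsto_atTop_add_const_left _ _ tendsto_id))
    rw [add_zero] at h3
    refine h3.congr' ?_
    filter_upwards [eventually_gt_atTop 0] with x hx
    field_simp
    ring
  have h4 := (h2.log ha.ne').div_atTop h1
  have h5 := h4.const_add 1
  rw [add_zero] at h5
  refine h5.congr' ?_
  filter_upwards [eventually_gt_atTop 0] with x hx
  have h6 : 0 < Real.log (1 + x) := Real.log_pos (by linarith)
  rw [Real.log_div (by positivity) (by positivity)]
  field_simp
  ring

/-! ### Scaling laws from a single limit -/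

variable {ι : Type*} {l : Filter ι} {a : ℝ} {lam n : ι → ℝ}

theorem sinrScaling_of_ratio (ha : 0 < a) {S : ι → ℝ} (hlam : Tendsto lam l atTop)
    (hn : Tendsto n l atTop) (h : Tendsto (fun i => lam i / n i * S i) l (𝓝 a)) :
    SINRScaling a l lam n S := by
  have hpos : ∀ᶠ i in l, 0 < lam i / n i := by
    filter_upwards [hlam.eventually_gt_atTop 0, hn.eventually_gt_atTop 0] with i h1 h2
    positivity
  have hS : (fun i => lam i / n i * S i / (lam i / n i)) =ᶠ[l] S := by
    filter_upwards [hpos] with i hi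
    rw [mul_div_cancel_left₀ _ hi.ne']
  refine ⟨h, fun h1 => ?_, fun c hc h1 => ?_, fun h1 => ?_⟩
  · exact (h.div_atTop h1).congr' hS
  · exact (h.div h1 hc.ne').congr' hS
  · have h2 : Tendsto (fun i => (lam i / n i)⁻¹) l atTop :=
      Tendsto.inv_tendsto_nhdsGT_zero (tendsto_nhdsWithin_iff.2 ⟨h1, hpos⟩)
    refine (h.pos_mul_atTop ha h2).congr' ?_
    simpa only [div_eq_mul_inv] using hS

/-- The expression is at least min(λ, n) · log 2: for n ≥ λ the logarithm exceeds log 2, and for n ≤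
λ one has log(1 + t) ≥ t log 2 with t = n/λ ∈ [0, 1]. -/
lemma tendsto_mul_log_one_add_div (hlam : Tendsto lam l atTop) (hn : Tendsto n l atTop) :
    Tendsto (fun i => lam i * Real.log (1 + n i / lam i)) l atTop := by
  have h2 : 0 < Real.log 2 := Real.log_pos (by norm_num)
  have hm : Tendsto (fun i => min (lam i) (n i) * Real.log 2) l atTop :=
    (tendsto_atTop.2 fun b => by
      filter_upwards [hlam.eventually_ge_atTop b, hn.eventually_ge_atTop b] with i h1 h2
      exact le_min h1 h2 : Tendsto (fun i => min (lam i) (n i)) l atTop).atTop_mul_const h2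
  refine tendsto_atTop_mono' l ?_ hm
  filter_upwards [hlam.eventually_gt_atTop 0, hn.eventually_gt_atTop 0] with i h3 h4
  rcases le_total (lam i) (n i) with h | h
  · rw [min_eq_left h]
    have : (1 : ℝ) ≤ n i / lam i := by rwa [one_le_div h3]
    gcongr
    linarith
  · rw [min_eq_right h]
    have := mul_log_le_log_one_add_mul (c := n i / lam i) (x := 1) (by positivity)
      (by rwa [div_le_one h3]) zero_le_one
    rw [mul_one, one_add_one_eq_two] at this
    calc n i * Real.log 2 = lam i * (n i / lam i * Real.log 2) := by field_simp
      _ ≤ _ := by gcongr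

/-- With x = n/λ and log(1 + ax) as reference, one limit covers all regimes: it is multiplied by the
limit of log(1 + ax)/x at 0, of log(1 + ax) at 1/c, or of log(1 + ax)/log(1 + x) at infinity. `A` is
arbitrary because the mean ASE is not a function of the mean SINR. -/
theorem aseScaling_of_tendsto (ha : 0 < a) {A : ι → ℝ} (hlam : Tendsto lam l atTop)
    (hn : Tendsto n l atTop)
    (h : Tendsto (fun i => A i / (lam i * Real.log (1 + a * (n i / lam i)))) l
      (𝓝 (1 / Real.log 2))) :
    ASEScaling a l lam n A := by
  have h2 : 0 < Real.log 2 := Real.log_pos (by norm_num)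
  have hpos : ∀ᶠ i in l, 0 < lam i ∧ 0 < n i :=
    (hlam.eventually_gt_atTop 0).and (hn.eventually_gt_atTop 0)
  have hord : A =Θ[l] fun i => lam i * Real.log (1 + n i / lam i) := by
    have e1 : A =Θ[l] fun i => lam i * Real.log (1 + a * (n i / lam i)) := by
      exact (Asymptotics.isTheta_of_div_tendsto_nhds_ne_zero h (by positivity)).symm
    refine e1.trans ⟨?_, ?_⟩
    · refine Asymptotics.IsBigO.of_bound (max 1 a) ?_
      filter_upwards [hpos] with i ⟨h3, h4⟩
      have h5 : 0 < n i / lam i := by positivity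
      have h6 : 0 ≤ Real.log (1 + n i / lam i) := Real.log_nonneg (by linarith)
      have h7 : 0 ≤ Real.log (1 + a * (n i / lam i)) := Real.log_nonneg (by nlinarith)
      rw [Real.norm_of_nonneg (by positivity), Real.norm_of_nonneg (by positivity)]
      have h8 : Real.log (1 + a * (n i / lam i)) ≤ max 1 a * Real.log (1 + n i / lam i) :=
        (Real.log_le_log (by positivity) (by gcongr; exact le_max_right _ _)).trans
          (log_one_add_mul_le_mul (le_max_left 1 a) h5.le)
      nlinarith
    · refine Asymptotics.IsBigO.of_bound (max 1 a⁻¹) ?_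
      filter_upwards [hpos] with i ⟨h3, h4⟩
      have h5 : 0 < n i / lam i := by positivity
      have h6 : 0 ≤ Real.log (1 + n i / lam i) := Real.log_nonneg (by linarith)
      have h7 : 0 ≤ Real.log (1 + a * (n i / lam i)) := Real.log_nonneg (by nlinarith)
      rw [Real.norm_of_nonneg (by positivity), Real.norm_of_nonneg (by positivity)]
      have h9 : n i / lam i ≤ max 1 a⁻¹ * (a * (n i / lam i)) :=
        calc n i / lam i = a⁻¹ * (a * (n i / lam i)) := by field_simp
          _ ≤ _ := by gcongr; exact le_max_right _ _
      have h8 : Real.log (1 + n i / lam i) ≤ max 1 a⁻¹ * Real.log (1 + a * (n i / lam i)) :=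
        (Real.log_le_log (by positivity) (by gcongr)).trans
          (log_one_add_mul_le_mul (le_max_left 1 a⁻¹) (by positivity))
      nlinarith
  have hx0 : ∀ᶠ i in l, 0 < n i / lam i := by
    filter_upwards [hpos] with i ⟨h3, h4⟩
    positivity
  have hinv : ∀ i, (lam i / n i)⁻¹ = n i / lam i := fun i => inv_div _ _
  refine ⟨hord, ?_, fun h1 => ?_, fun c hc h1 => ?_, fun h1 => ?_⟩
  · have hA : ∀ᶠ i in l, 0 ≤ A i := by
      filter_upwards [h.eventually_const_lt (show (0 : ℝ) < 1 / Real.log 2 by positivity), hpos]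
        with i h5 ⟨h3, h4⟩
      have h7 : 0 < Real.log (1 + a * (n i / lam i)) :=
        Real.log_pos (by have : 0 < a * (n i / lam i) := by positivity
                         linarith)
      have := (div_pos_iff_of_pos_right (by positivity)).1 h5
      exact this.le
    have h3 := hord.tendsto_norm_atTop_iff.2
      (tendsto_norm_atTop_atTop.comp (tendsto_mul_log_one_add_div hlam hn))
    refine h3.congr' ?_
    filter_upwards [hA] with i hi
    simp [abs_of_nonneg hi]
  · have hx : Tendsto (fun i => n i / lam i) l (𝓝[≠] 0) := by
      refine tendsto_nhdsWithin_iff.2 ⟨?_, hx0.mono fun i hi => hi.ne'⟩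
      exact h1.inv_tendsto_atTop.congr hinv
    have h3 := h.mul (tendsto_log_one_add_mul_div (a := a) |>.comp hx)
    rw [one_div_mul_eq_div] at h3
    refine h3.congr' ?_
    filter_upwards [hpos] with i ⟨h3, h4⟩
    have h7 : 0 < Real.log (1 + a * (n i / lam i)) :=
      Real.log_pos (by have : 0 < a * (n i / lam i) := by positivity
                       linarith)
    simp only [Function.comp]
    generalize Real.log (1 + a * (n i / lam i)) = y at h7 ⊢
    field_simp
  · have hx : Tendsto (fun i => n i / lam i) l (𝓝 c⁻¹) := by
      simpa only [hinv] using h1.inv₀ hc.ne'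
    have h3 : Tendsto (fun i => Real.log (1 + a * (n i / lam i))) l
        (𝓝 (Real.log (1 + a * c⁻¹))) :=
      ((hx.const_mul a).const_add 1).log (by positivity)
    have h4 := h.mul h3
    rw [one_div_mul_eq_div] at h4
    rw [Real.logb, div_eq_mul_inv a c]
    refine h4.congr' ?_
    filter_upwards [hpos] with i ⟨h3, h4⟩
    have h7 : 0 < Real.log (1 + a * (n i / lam i)) :=
      Real.log_pos (by have : 0 < a * (n i / lam i) := by positivity
                       linarith)
    generalize Real.log (1 + a * (n i / lam i)) = y at h7 ⊢
    field_simp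
  · have hx : Tendsto (fun i => n i / lam i) l atTop := by
      have := Tendsto.inv_tendsto_nhdsGT_zero (tendsto_nhdsWithin_iff.2 ⟨h1, (by
        filter_upwards [hpos] with i ⟨h3, h4⟩
        exact div_pos h3 h4 : ∀ᶠ i in l, lam i / n i ∈ Set.Ioi 0)⟩)
      refine this.congr fun i => ?_
      simp
    have h3 := (h.mul ((tendsto_log_one_add_mul_div_log ha).comp hx)).mul_const (Real.log 2)
    rw [mul_one, one_div_mul_cancel h2.ne'] at h3
    refine h3.congr' ?_
    filter_upwards [hpos, hx0] with i ⟨h3, h4⟩ hi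
    have h7 : 0 < Real.log (1 + a * (n i / lam i)) :=
      Real.log_pos (by have : 0 < a * (n i / lam i) := by positivity
                       linarith)
    have h8 : 0 < Real.log (1 + n i / lam i) := Real.log_pos (by linarith)
    simp only [Function.comp, Real.logb]
    generalize Real.log (1 + a * (n i / lam i)) = y at h7 ⊢
    generalize Real.log (1 + n i / lam i) = z at h8 ⊢
    field_simp

/-- Almost sure form: if the normalised SINR converges, the ASE obeys the scaling laws. -/
theorem aseScaling_of_ratio (ha : 0 < a) {S : ι → ℝ} (hS : ∀ᶠ i in l, 0 ≤ S i)
    (hlam : Tendsto lam l atTop)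
    (hn : Tendsto n l atTop) (h : Tendsto (fun i => lam i / n i * S i) l (𝓝 a)) :
    ASEScaling a l lam n (fun i => ase (lam i) (S i)) := by
  have h2 : 0 < Real.log 2 := Real.log_pos (by norm_num)
  refine aseScaling_of_tendsto ha hlam hn ?_
  have hd : Tendsto (fun i => |lam i / n i * S i - a| / a / Real.log 2) l (𝓝 0) := by
    have := (((h.sub_const a).abs).div_const a).div_const (Real.log 2)
    simpa using this
  rw [tendsto_iff_dist_tendsto_zero]
  refine squeeze_zero' (Eventually.of_forall fun _ => dist_nonneg) ?_ hd
  filter_upwards [hS, hlam.eventually_gt_atTop 0, hn.eventually_gt_atTop 0] with i h0 h3 h4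
  have h5 : 0 < n i / lam i := by positivity
  have h7 : 0 < Real.log (1 + a * (n i / lam i)) :=
    Real.log_pos (by have : 0 < a * (n i / lam i) := by positivity
                     linarith)
  have h8 := abs_log_one_add_mul_sub_le (v := lam i / n i * S i) ha (by positivity) h5.le
  have h9 : lam i / n i * S i * (n i / lam i) = S i := by field_simp
  rw [h9] at h8
  have e : ase (lam i) (S i) / (lam i * Real.log (1 + a * (n i / lam i))) - 1 / Real.log 2 =
      (Real.log (1 + S i) - Real.log (1 + a * (n i / lam i))) /
        Real.log (1 + a * (n i / lam i)) / Real.log 2 := by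
    simp only [ase, Real.logb]
    clear h8
    generalize Real.log (1 + a * (n i / lam i)) = y at h7 ⊢
    field_simp
  rw [Real.dist_eq, e, abs_div, abs_div, abs_of_pos h2, abs_of_pos h7]
  refine div_le_div_of_nonneg_right ?_ h2.le
  rwa [div_le_iff₀ h7]

/-! ### Exponential moments of Poisson point processes -/

lemma lintegral_exp_mul_poissonMeasure (m : ℝ≥0) (t : ℝ) :
    ∫⁻ k, ENNReal.ofReal (Real.exp (t * k)) ∂(poissonMeasure m) =
      ENNReal.ofReal (Real.exp (m * (Real.exp t - 1))) := by
  have hs : HasSum (fun n : ℕ => Real.exp (-m) * ((m * Real.exp t) ^ n / n.factorial))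
      (Real.exp (m * (Real.exp t - 1))) := by
    have h := (NormedSpace.expSeries_div_hasSum_exp (m * Real.exp t : ℝ)).mul_left (Real.exp (-m))
    rw [← Real.exp_eq_exp_ℝ, ← Real.exp_add] at h
    rw [show (m : ℝ) * (Real.exp t - 1) = -m + m * Real.exp t by ring]
    exact h
  rw [poissonMeasure, lintegral_sum_measure, ← hs.tsum_eq,
    ENNReal.ofReal_tsum_of_nonneg (fun n => by positivity) hs.summable]
  refine tsum_congr fun n => ?_
  rw [lintegral_smul_measure, lintegral_dirac, smul_eq_mul, ← ENNReal.ofReal_mul (by positivity)]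
  congr 1
  rw [mul_comm t n, Real.exp_nat_mul, mul_pow]
  ring

lemma coe_pointCount {Ω E : Type*} (X : ℕ → Ω → E) (A : Set E) (ω : Ω) :
    ((pointCount X A ω : ℕ∞) : ℝ≥0∞) = ∑' i, A.indicator (fun _ => (1 : ℝ≥0∞)) (X i ω) := by
  rw [pointCount, ← ENNReal.tsum_set_one, tsum_subtype {i | X i ω ∈ A} (fun _ => (1 : ℝ≥0∞))]
  rfl

variable {Ω E : Type*} [MeasurableSpace Ω] [MeasurableSpace E] {X : ℕ → Ω → E} {ν : Measure E}
  {P : Measure Ω}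

lemma measurable_pointCount (hX : ∀ i, Measurable (X i)) {A : Set E} (hA : MeasurableSet A) :
    Measurable (pointCount X A) := by
  have h1 : Measurable fun ω => ((pointCount X A ω : ℕ∞) : ℝ≥0∞) := by
    simp_rw [coe_pointCount]
    exact Measurable.tsum fun i => (measurable_const.indicator hA).comp (hX i)
  refine measurable_to_countable' fun k => ?_
  have : pointCount X A ⁻¹' {k} =
      (fun ω => ((pointCount X A ω : ℕ∞) : ℝ≥0∞)) ⁻¹' {(k : ℝ≥0∞)} := by
    ext ω
    simp
  rw [this]
  exact h1 (measurableSet_singleton _)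

lemma IsPoissonProcess.ae_pointCount_lt_top (h : IsPoissonProcess X ν P) {A : Set E}
    (hA : MeasurableSet A) (hν : ν A ≠ ⊤) : ∀ᵐ ω ∂P, pointCount X A ω ≠ ⊤ := by
  have h1 := (h.count_law A hA hν).ae_iff (p := fun k => k ≠ ⊤) (measurable_of_countable _)
  rw [h1, ae_map_iff (by fun_prop) (MeasurableSet.of_discrete)]
  simp

lemma IsPoissonProcess.lintegral_pointCount (h : IsPoissonProcess X ν P) {A : Set E}
    (hA : MeasurableSet A) (hν : ν A ≠ ⊤) (f : ℕ → ℝ≥0∞) :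
    ∫⁻ ω, f (pointCount X A ω).toNat ∂P = ∫⁻ k, f k ∂(poissonMeasure (ν A).toNNReal) := by
  rw [(h.count_law A hA hν).lintegral_comp (f := fun k => f k.toNat)
    (measurable_of_countable _).aemeasurable,
    lintegral_map (measurable_of_countable _) (measurable_of_countable _)]
  simp

/-- The Laplace functional of a simple function: `R` will be its set of nonzero values, `A` its
fibres and `t` the values up to sign. Independence of the counts factors the expectation. -/
lemma IsPoissonProcess.lintegral_prod_exp [IsProbabilityMeasure P] (h : IsPoissonProcess X ν P)
    (R : Finset ℝ≥0) (A : ℝ≥0 → Set E) (hA : ∀ y, MeasurableSet (A y)) (hν : ∀ y ∈ R, ν (A y) ≠ ⊤)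
    (hd : ∀ y z, y ≠ z → Disjoint (A y) (A z)) (t : ℝ≥0 → ℝ) :
    ∫⁻ ω, ∏ y ∈ R, ENNReal.ofReal (Real.exp (t y * (pointCount X (A y) ω).toNat)) ∂P =
      ENNReal.ofReal (Real.exp (∑ y ∈ R, (ν (A y)).toReal * (Real.exp (t y) - 1))) := by
  have hind : iIndepFun (fun j : Fin R.card => pointCount X (A (R.equivFin.symm j))) P :=
    h.count_indep _ _ (fun j => hA _) (fun j => hν _ (R.equivFin.symm j).2) fun j k hjk =>
      hd _ _ fun e => hjk (R.equivFin.symm.injective (Subtype.ext e))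
  have hm : ∀ j : Fin R.card, Measurable fun ω => ENNReal.ofReal
      (Real.exp (t (R.equivFin.symm j) * (pointCount X (A (R.equivFin.symm j)) ω).toNat)) :=
    fun j => (measurable_of_countable fun k : ℕ∞ => ENNReal.ofReal
      (Real.exp (t (R.equivFin.symm j) * k.toNat))).comp (measurable_pointCount h.measurable (hA _))
  have h2 := lintegral_prod_eq_prod_lintegral_of_indepFun Finset.univ _
    (hind.comp (fun j (k : ℕ∞) => ENNReal.ofReal (Real.exp (t (R.equivFin.symm j) * k.toNat)))
      fun j => measurable_of_countable _) hm
  have e1 : ∀ F : ℝ≥0 → ℝ≥0∞, ∏ j : Fin R.card, F (R.equivFin.symm j) = ∏ y ∈ R, F y := fun F => by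
    rw [← Finset.prod_coe_sort R F]
    exact R.equivFin.symm.prod_comp (fun y : R => F y)
  simp only [Function.comp] at h2
  rw [e1 (fun y => ∫⁻ ω, ENNReal.ofReal (Real.exp (t y * (pointCount X (A y) ω).toNat)) ∂P)] at h2
  simp_rw [fun ω => e1 (fun y => ENNReal.ofReal (Real.exp (t y * (pointCount X (A y) ω).toNat)))]
    at h2
  rw [h2, Real.exp_sum, ENNReal.ofReal_prod_of_nonneg fun _ _ => (Real.exp_pos _).le]
  refine Finset.prod_congr rfl fun y hy => ?_
  rw [h.lintegral_pointCount (hA y) (hν y hy) fun k => ENNReal.ofReal (Real.exp (t y * k)),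
    lintegral_exp_mul_poissonMeasure]
  rfl

/-- For a simple function supported on a set of finite measure, the sum over the point process is
a.s. a finite sum and a combination of counts. -/
lemma IsPoissonProcess.ae_exists_sum_simpleFunc (h : IsPoissonProcess X ν P)
    (φ : SimpleFunc E ℝ≥0) (hφ : ∀ y ≠ 0, ν (φ ⁻¹' {y}) ≠ ⊤) :
    ∀ᵐ ω ∂P, ∃ F : Finset ℕ, (∀ i ∉ F, φ (X i ω) = 0) ∧
      ∑ y ∈ φ.range with y ≠ 0, (y : ℝ) * (pointCount X (φ ⁻¹' {y}) ω).toNat =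
        ∑ i ∈ F, (φ (X i ω) : ℝ) := by
  have h1 : ∀ᵐ ω ∂P, ∀ y ∈ φ.range.filter (· ≠ 0), pointCount X (φ ⁻¹' {y}) ω ≠ ⊤ := by
    refine (Filter.eventually_all_finset _).2 fun y hy => ?_
    exact h.ae_pointCount_lt_top (φ.measurableSet_fiber y) (hφ y (Finset.mem_filter.1 hy).2)
  filter_upwards [h1] with ω hω
  have hfin : ∀ y ∈ φ.range.filter (· ≠ 0), {i | X i ω ∈ φ ⁻¹' {y}}.Finite := fun y hy =>
    Set.encard_ne_top_iff.1 (hω y hy)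
  have hFfin : {i | φ (X i ω) ≠ 0}.Finite := by
    refine ((Finset.finite_toSet _).biUnion hfin).subset fun i hi => ?_
    simp only [Set.mem_iUnion]
    exact ⟨φ (X i ω), by simpa using hi, rfl⟩
  refine ⟨hFfin.toFinset, fun i hi => by simpa using hi, ?_⟩
  have hmaps : ∀ i ∈ hFfin.toFinset, φ (X i ω) ∈ φ.range.filter (· ≠ 0) := fun i hi => by
    simpa using hi
  rw [← Finset.sum_fiberwise_of_maps_to hmaps]
  refine Finset.sum_congr rfl fun y hy => ?_
  have hcard : (pointCount X (φ ⁻¹' {y}) ω).toNat =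
      (hFfin.toFinset.filter fun i => φ (X i ω) = y).card := by
    have : {i | X i ω ∈ φ ⁻¹' {y}} = ↑(hFfin.toFinset.filter fun i => φ (X i ω) = y) := by
      ext i
      have := (Finset.mem_filter.1 hy).2
      simp only [Set.mem_preimage, Set.mem_singleton_iff, Set.mem_ofPred_eq, Finset.coe_filter,
        Set.Finite.mem_toFinset]
      constructor
      · rintro rfl
        exact ⟨this, rfl⟩
      · exact fun h => h.2
    rw [pointCount, this, Set.encard_coe_eq_coe_finsetCard, ENat.toNat_natCast]
  rw [hcard, Finset.sum_congr rfl (fun i hi => by rw [(Finset.mem_filter.1 hi).2]),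
    Finset.sum_const, nsmul_eq_mul, mul_comm]

/-- Approximation of a measurable function from below by simple functions. -/
def simpleApprox (ψ : E → ℝ≥0) (k : ℕ) : SimpleFunc E ℝ≥0 :=
  (SimpleFunc.eapprox (fun x => (ψ x : ℝ≥0∞)) k).map ENNReal.toNNReal

lemma coe_simpleApprox (ψ : E → ℝ≥0) (k : ℕ) (x : E) :
    (simpleApprox ψ k x : ℝ≥0∞) = SimpleFunc.eapprox (fun x => (ψ x : ℝ≥0∞)) k x := by
  rw [simpleApprox, SimpleFunc.map_apply, ENNReal.coe_toNNReal (SimpleFunc.eapprox_lt_top _ _ _).ne]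

lemma simpleApprox_le {ψ : E → ℝ≥0} (hψ : Measurable ψ) (k : ℕ) (x : E) :
    simpleApprox ψ k x ≤ ψ x := by
  rw [← ENNReal.coe_le_coe, coe_simpleApprox]
  have := SimpleFunc.iSup_eapprox_apply (f := fun x => (ψ x : ℝ≥0∞)) (by fun_prop) x
  rw [← this]
  exact le_iSup (fun k => SimpleFunc.eapprox (fun x => (ψ x : ℝ≥0∞)) k x) k

lemma simpleApprox_mono (ψ : E → ℝ≥0) (x : E) : Monotone fun k => simpleApprox ψ k x := by
  intro k l hkl
  rw [← ENNReal.coe_le_coe, coe_simpleApprox, coe_simpleApprox]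
  exact SimpleFunc.monotone_eapprox _ hkl x

lemma tendsto_simpleApprox {ψ : E → ℝ≥0} (hψ : Measurable ψ) (x : E) :
    Tendsto (fun k => simpleApprox ψ k x) atTop (𝓝 (ψ x)) := by
  rw [← ENNReal.tendsto_coe]
  simp_rw [coe_simpleApprox]
  exact SimpleFunc.tendsto_eapprox (by fun_prop) x

lemma iSup_lintegral_simpleApprox {ψ : E → ℝ≥0} (hψ : Measurable ψ) :
    ⨆ k, ∫⁻ x, simpleApprox ψ k x ∂ν = ∫⁻ x, ψ x ∂ν := by
  simp_rw [coe_simpleApprox]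
  rw [lintegral_eq_iSup_eapprox_lintegral (f := fun x => (ψ x : ℝ≥0∞)) (by fun_prop)]
  simp_rw [SimpleFunc.lintegral_eq_lintegral]

/-- Markov's inequality, since the fibre over y lies in {y ≤ ψ}. -/
lemma measure_simpleApprox_fiber_ne_top {ψ : E → ℝ≥0} (hψ : Measurable ψ)
    (hfin : ∫⁻ x, ψ x ∂ν ≠ ⊤) (k : ℕ) {y : ℝ≥0} (hy : y ≠ 0) :
    ν (simpleApprox ψ k ⁻¹' {y}) ≠ ⊤ := by
  have h1 : ν {x | (y : ℝ≥0∞) ≤ ψ x} ≤ (∫⁻ x, ψ x ∂ν) / y :=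
    meas_ge_le_lintegral_div (by fun_prop) (by simpa using hy) ENNReal.coe_ne_top
  refine ((measure_mono fun x hx => ?_).trans_lt
    (h1.trans_lt (ENNReal.div_lt_top hfin (by simpa using hy)))).ne
  have := simpleApprox_le hψ k x
  rw [show simpleApprox ψ k x = y from hx] at this
  simpa using this

lemma sum_measure_fiber_simpleFunc (φ : SimpleFunc E ℝ≥0) (hφ : ∀ y ≠ 0, ν (φ ⁻¹' {y}) ≠ ⊤) :
    ENNReal.ofReal (∑ y ∈ φ.range with y ≠ 0, (ν (φ ⁻¹' {y})).toReal * y) = ∫⁻ x, φ x ∂ν := by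
  have h1 : ∫⁻ x, φ x ∂ν = ∑ y ∈ φ.range, (y : ℝ≥0∞) * ν (φ ⁻¹' {y}) := by
    rw [← SimpleFunc.map_lintegral (fun y : ℝ≥0 => (y : ℝ≥0∞)) φ, ← SimpleFunc.lintegral_eq_lintegral]
    rfl
  rw [h1, ENNReal.ofReal_sum_of_nonneg (fun _ _ => by positivity), Finset.sum_filter]
  refine Finset.sum_congr rfl fun y hy => ?_
  split_ifs with h
  · rw [ENNReal.ofReal_mul ENNReal.toReal_nonneg, ENNReal.ofReal_toReal (hφ y h),
      ENNReal.ofReal_coe_nnreal, mul_comm]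
  · simp [not_ne_iff.1 h]

/-- The exponential moment of the full sum is exp ∫ (e^ψ − 1) dν; the cruder exponent e^B ∫ ψ is
enough, because B tends to 0 with the Chernoff parameter and nothing is lost to first order. Simple
functions increase to ψ and monotone convergence finishes. Partial sums are used because summability
is only deduced from this bound. -/
theorem IsPoissonProcess.lintegral_exp_sum_le [IsProbabilityMeasure P]
    (h : IsPoissonProcess X ν P) {ψ : E → ℝ≥0} (hψ : Measurable ψ) {B m : ℝ}
    (hB : ∀ x, ψ x ≤ B) (hm0 : 0 ≤ m) (hm : ∫⁻ x, ψ x ∂ν ≤ ENNReal.ofReal m) (n : ℕ) :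
    ∫⁻ ω, ENNReal.ofReal (Real.exp (∑ i ∈ Finset.range n, (ψ (X i ω) : ℝ))) ∂P ≤
      ENNReal.ofReal (Real.exp (Real.exp B * m)) := by
  have hfin : ∫⁻ x, ψ x ∂ν ≠ ⊤ := (hm.trans_lt ENNReal.ofReal_lt_top).ne
  have hk : ∀ k, ∫⁻ ω, ENNReal.ofReal (Real.exp (∑ i ∈ Finset.range n,
      (simpleApprox ψ k (X i ω) : ℝ))) ∂P ≤ ENNReal.ofReal (Real.exp (Real.exp B * m)) := by
    intro k
    set φ := simpleApprox ψ k with hφdef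
    have hφ : ∀ y ≠ 0, ν (φ ⁻¹' {y}) ≠ ⊤ := fun y hy =>
      measure_simpleApprox_fiber_ne_top hψ hfin k hy
    calc _ ≤ ∫⁻ ω, ∏ y ∈ φ.range with y ≠ 0, ENNReal.ofReal (Real.exp
          ((y : ℝ) * (pointCount X (φ ⁻¹' {y}) ω).toNat)) ∂P := by
          refine lintegral_mono_ae ?_
          filter_upwards [h.ae_exists_sum_simpleFunc φ hφ] with ω ⟨F, hF0, hF⟩
          rw [← ENNReal.ofReal_prod_of_nonneg (fun _ _ => (Real.exp_pos _).le), ← Real.exp_sum, hF]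
          refine ENNReal.ofReal_le_ofReal (Real.exp_le_exp.2 ?_)
          have : ∑ i ∈ Finset.range n, (φ (X i ω) : ℝ) =
              ∑ i ∈ Finset.range n with i ∈ F, (φ (X i ω) : ℝ) := by
            rw [Finset.sum_filter]
            refine Finset.sum_congr rfl fun i _ => ?_
            split_ifs with hi
            · rfl
            · rw [hF0 i hi, NNReal.coe_zero]
          rw [this]
          exact Finset.sum_le_sum_of_subset_of_nonneg
            (fun i hi => (Finset.mem_filter.1 hi).2) fun _ _ _ => NNReal.coe_nonneg _
      _ = ENNReal.ofReal (Real.exp (∑ y ∈ φ.range with y ≠ 0,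
            (ν (φ ⁻¹' {y})).toReal * (Real.exp y - 1))) :=
          h.lintegral_prod_exp _ (fun y => φ ⁻¹' {y}) φ.measurableSet_fiber
            (fun y hy => hφ y (Finset.mem_filter.1 hy).2)
            (fun y z hyz => Disjoint.preimage _ (by simpa using hyz)) _
      _ ≤ _ := by
          refine ENNReal.ofReal_le_ofReal (Real.exp_le_exp.2 ?_)
          have h2 : ∑ y ∈ φ.range with y ≠ 0, (ν (φ ⁻¹' {y})).toReal * (y : ℝ) ≤ m := by
            rw [← ENNReal.ofReal_le_ofReal_iff hm0, sum_measure_fiber_simpleFunc φ hφ]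
            refine le_trans (lintegral_mono fun x => ?_) hm
            exact ENNReal.coe_le_coe.2 (simpleApprox_le hψ k x)
          refine le_trans ?_ (mul_le_mul_of_nonneg_left h2 (Real.exp_pos B).le)
          rw [Finset.mul_sum]
          refine Finset.sum_le_sum fun y hy => ?_
          obtain ⟨x, rfl⟩ := SimpleFunc.mem_range.1 (Finset.mem_filter.1 hy).1
          have hyB : (φ x : ℝ) ≤ B := (NNReal.coe_le_coe.2 (simpleApprox_le hψ k x)).trans (hB x)
          -- With y the value of φ: e^y − 1 = e^y (1 − e^{−y}) ≤ e^B y.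
          have h3 : Real.exp (φ x) - 1 ≤ Real.exp B * φ x := by
            have h4 := Real.add_one_le_exp (-(φ x : ℝ))
            have h5 : Real.exp (φ x : ℝ) * Real.exp (-(φ x : ℝ)) = 1 := by
              rw [← Real.exp_add]; simp
            have h6 : Real.exp (φ x : ℝ) ≤ Real.exp B := Real.exp_le_exp.2 hyB
            have h7 : (0 : ℝ) ≤ φ x := NNReal.coe_nonneg _
            nlinarith [Real.exp_pos (φ x : ℝ)]
          calc _ ≤ (ν (φ ⁻¹' {φ x})).toReal * (Real.exp B * φ x) := by gcongr
            _ = _ := by ring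
  refine le_of_tendsto' (lintegral_tendsto_of_tendsto_of_monotone ?_ ?_ ?_) hk
  · intro k
    have : ∀ i, Measurable fun ω => simpleApprox ψ k (X i ω) := fun i =>
      (SimpleFunc.measurable _).comp (h.measurable i)
    exact Measurable.aemeasurable (by fun_prop)
  · refine ae_of_all _ fun ω k l hkl => ?_
    refine ENNReal.ofReal_le_ofReal (Real.exp_le_exp.2 (Finset.sum_le_sum fun i _ => ?_))
    exact NNReal.coe_le_coe.2 (simpleApprox_mono ψ _ hkl)
  · refine ae_of_all _ fun ω => ?_
    refine ENNReal.tendsto_ofReal ((Real.continuous_exp.tendsto _).comp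
      (tendsto_finsetSum _ fun i _ => ?_))
    exact (NNReal.tendsto_coe.2 (tendsto_simpleApprox hψ _))

/-- Approximation from below helps directly: φ ≤ ψ makes exp(−Σφ) the larger one, so every simple
function gives a bound on the same left side, and only ∫ φ → ∫ ψ has to be passed to the limit.
Summability matters because a divergent `tsum` is 0. -/
theorem IsPoissonProcess.lintegral_exp_neg_tsum_le [IsProbabilityMeasure P]
    (h : IsPoissonProcess X ν P) {ψ : E → ℝ≥0} (hψ : Measurable ψ) {B m : ℝ}
    (hB : ∀ x, ψ x ≤ B) (hm0 : 0 ≤ m) (hm : ∫⁻ x, ψ x ∂ν = ENNReal.ofReal m)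
    (hsum : ∀ᵐ ω ∂P, Summable fun i => (ψ (X i ω) : ℝ)) :
    ∫⁻ ω, ENNReal.ofReal (Real.exp (-∑' i, (ψ (X i ω) : ℝ))) ∂P ≤
      ENNReal.ofReal (Real.exp (-(Real.exp (-B) * m))) := by
  have hfin : ∫⁻ x, ψ x ∂ν ≠ ⊤ := hm ▸ ENNReal.ofReal_ne_top
  have hk : ∀ k, ∫⁻ ω, ENNReal.ofReal (Real.exp (-∑' i, (ψ (X i ω) : ℝ))) ∂P ≤
      ENNReal.ofReal (Real.exp (-(Real.exp (-B) * (∫⁻ x, simpleApprox ψ k x ∂ν).toReal))) := by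
    intro k
    set φ := simpleApprox ψ k with hφdef
    have hφ : ∀ y ≠ 0, ν (φ ⁻¹' {y}) ≠ ⊤ := fun y hy =>
      measure_simpleApprox_fiber_ne_top hψ hfin k hy
    calc _ ≤ ∫⁻ ω, ∏ y ∈ φ.range with y ≠ 0, ENNReal.ofReal (Real.exp
          (-(y : ℝ) * (pointCount X (φ ⁻¹' {y}) ω).toNat)) ∂P := by
          refine lintegral_mono_ae ?_
          filter_upwards [h.ae_exists_sum_simpleFunc φ hφ, hsum] with ω ⟨F, hF0, hF⟩ hs
          rw [← ENNReal.ofReal_prod_of_nonneg (fun _ _ => (Real.exp_pos _).le), ← Real.exp_sum]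
          simp_rw [neg_mul]
          rw [Finset.sum_neg_distrib, hF]
          refine ENNReal.ofReal_le_ofReal (Real.exp_le_exp.2 (neg_le_neg ?_))
          refine le_trans (Finset.sum_le_sum fun i _ => ?_)
            (hs.sum_le_tsum F fun i _ => NNReal.coe_nonneg _)
          exact NNReal.coe_le_coe.2 (simpleApprox_le hψ k _)
      _ = ENNReal.ofReal (Real.exp (∑ y ∈ φ.range with y ≠ 0,
            (ν (φ ⁻¹' {y})).toReal * (Real.exp (-(y : ℝ)) - 1))) :=
          h.lintegral_prod_exp _ (fun y => φ ⁻¹' {y}) φ.measurableSet_fiber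
            (fun y hy => hφ y (Finset.mem_filter.1 hy).2)
            (fun y z hyz => Disjoint.preimage _ (by simpa using hyz)) (fun y => -(y : ℝ))
      _ ≤ _ := by
          refine ENNReal.ofReal_le_ofReal (Real.exp_le_exp.2 ?_)
          rw [← sum_measure_fiber_simpleFunc φ hφ,
            ENNReal.toReal_ofReal (Finset.sum_nonneg fun _ _ => by positivity), Finset.mul_sum,
            ← Finset.sum_neg_distrib]
          refine Finset.sum_le_sum fun y hy => ?_
          obtain ⟨x, rfl⟩ := SimpleFunc.mem_range.1 (Finset.mem_filter.1 hy).1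
          have hyB : (φ x : ℝ) ≤ B := (NNReal.coe_le_coe.2 (simpleApprox_le hψ k x)).trans (hB x)
          -- With y the value of φ: 1 − e^{−y} = e^{−y} (e^y − 1) ≥ e^{−B} y.
          have h3 : Real.exp (-(φ x : ℝ)) - 1 ≤ -(Real.exp (-B) * φ x) := by
            have h4 := Real.add_one_le_exp (φ x : ℝ)
            have h5 : Real.exp (φ x : ℝ) * Real.exp (-(φ x : ℝ)) = 1 := by
              rw [← Real.exp_add]; simp
            have h6 : Real.exp (-B) ≤ Real.exp (-(φ x : ℝ)) := Real.exp_le_exp.2 (by linarith)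
            have h7 : (0 : ℝ) ≤ φ x := NNReal.coe_nonneg _
            nlinarith [Real.exp_pos (-(φ x : ℝ))]
          calc _ ≤ (ν (φ ⁻¹' {φ x})).toReal * (-(Real.exp (-B) * φ x)) := by gcongr
            _ = _ := by ring
  have hlim : Tendsto (fun k => ∫⁻ x, simpleApprox ψ k x ∂ν) atTop (𝓝 (∫⁻ x, ψ x ∂ν)) := by
    rw [← iSup_lintegral_simpleApprox hψ]
    refine tendsto_atTop_iSup fun k l hkl => lintegral_mono fun x => ?_
    exact ENNReal.coe_le_coe.2 (simpleApprox_mono ψ _ hkl)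
  have hlim2 := (ENNReal.tendsto_toReal hfin).comp hlim
  rw [hm, ENNReal.toReal_ofReal hm0] at hlim2
  refine ge_of_tendsto' (ENNReal.tendsto_ofReal ((Real.continuous_exp.tendsto _).comp
    ((hlim2.const_mul (Real.exp (-B))).neg))) hk

/-! ### Few points in a set, and the planar intensity -/

section

variable {Ω E : Type*} [MeasurableSpace Ω] [MeasurableSpace E] {X : ℕ → Ω → E} {ν : Measure E}
  {P : Measure Ω}

/-- Chernoff with exponent −1: the indicator of {count ≤ 3} is at most e^{3 − count}, and 1 − 1/e ≥
1/2. The threshold is three because four points leave three interferers once the serving one is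
removed. -/
lemma IsPoissonProcess.measure_pointCount_le_three (h : IsPoissonProcess X ν P) {A : Set E}
    (hA : MeasurableSet A) (hν : ν A ≠ ⊤) :
    P {ω | pointCount X A ω ≤ 3} ≤ ENNReal.ofReal (Real.exp (3 - (ν A).toReal / 2)) := by
  have h1 : P {ω | pointCount X A ω ≤ 3} ≤
      ∫⁻ ω, ENNReal.ofReal (Real.exp 3) *
        ENNReal.ofReal (Real.exp (-1 * ((pointCount X A ω).toNat : ℝ))) ∂P := by
    have hm : MeasurableSet {ω | pointCount X A ω ≤ 3} :=
      measurable_pointCount h.measurable hA (MeasurableSet.of_discrete (s := Set.Iic 3))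
    rw [← lintegral_indicator_one hm]
    refine lintegral_mono fun ω => ?_
    by_cases hω : pointCount X A ω ≤ 3
    swap
    · rw [Set.indicator_of_notMem (by exact hω)]
      exact zero_le
    rw [Set.indicator_of_mem (by exact hω), ← ENNReal.ofReal_mul (Real.exp_pos _).le, ← Real.exp_add, Pi.one_apply,
      ← ENNReal.ofReal_one]
    refine ENNReal.ofReal_le_ofReal (Real.one_le_exp ?_)
    have : (pointCount X A ω).toNat ≤ 3 := ENat.toNat_le_of_le_natCast hω
    have : ((pointCount X A ω).toNat : ℝ) ≤ 3 := by exact_mod_cast this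
    linarith
  refine h1.trans ?_
  rw [lintegral_const_mul' _ _ ENNReal.ofReal_ne_top,
    h.lintegral_pointCount hA hν (fun k => ENNReal.ofReal (Real.exp (-1 * (k : ℝ)))),
    lintegral_exp_mul_poissonMeasure, ← ENNReal.ofReal_mul (Real.exp_pos _).le, ← Real.exp_add]
  refine ENNReal.ofReal_le_ofReal (Real.exp_le_exp.2 ?_)
  have h2 : Real.exp (-1) ≤ 1 / 2 := by
    rw [Real.exp_neg, one_div]
    exact inv_anti₀ (by norm_num) (by linarith [Real.add_one_le_exp (1 : ℝ)])
  have h3 : (0 : ℝ) ≤ (ν A).toReal := ENNReal.toReal_nonneg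
  change 3 + (ν A).toReal * (Real.exp (-1) - 1) ≤ _
  nlinarith

end

/-- The closed annulus around the origin. -/
def annulus (ρ t : ℝ) : Set Plane := {x | ρ ≤ ‖x‖ ∧ ‖x‖ ≤ t}

lemma measurableSet_annulus (ρ t : ℝ) : MeasurableSet (annulus ρ t) :=
  (measurableSet_le measurable_const measurable_norm).inter
    (measurableSet_le measurable_norm measurable_const)

lemma volume_annulus {ρ t : ℝ} (hρ : 0 ≤ ρ) (ht : ρ ≤ t) :
    (volume (annulus ρ t)) = ENNReal.ofReal (Real.pi * (t ^ 2 - ρ ^ 2)) := by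
  have h1 : annulus ρ t = Metric.closedBall 0 t \ Metric.ball 0 ρ := by
    ext x
    simp [annulus, and_comm]
  rw [h1, measure_sdiff (Metric.ball_subset_closedBall.trans (Metric.closedBall_subset_closedBall ht))
    measurableSet_ball.nullMeasurableSet measure_ball_lt_top.ne,
    EuclideanSpace.volume_ball_fin_two, EuclideanSpace.volume_closedBall_fin_two,
    ← ENNReal.ofReal_pow hρ, ← ENNReal.ofReal_pow (hρ.trans ht),
    ← ENNReal.ofReal_mul (by positivity), ← ENNReal.ofReal_mul (by positivity),
    ← ENNReal.ofReal_sub _ (by positivity)]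
  congr 1
  ring

section

variable {Ω : Type*} [MeasurableSpace Ω] {X : ℕ → Ω → Plane} {lam : ℝ} {P : Measure Ω}

lemma IsOrderedHPPP.measure_annulus_le_three (h : IsOrderedHPPP X lam P) (hlam : 0 < lam)
    {ρ t : ℝ} (hρ : 0 ≤ ρ) (ht : ρ ≤ t) :
    P {ω | pointCount X (annulus ρ t) ω ≤ 3} ≤
      ENNReal.ofReal (Real.exp (3 - lam * (Real.pi * (t ^ 2 - ρ ^ 2)) / 2)) := by
  have hv : (ENNReal.ofReal lam • (volume : Measure Plane)) (annulus ρ t) =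
      ENNReal.ofReal (lam * (Real.pi * (t ^ 2 - ρ ^ 2))) := by
    rw [Measure.smul_apply, smul_eq_mul, volume_annulus hρ ht, ← ENNReal.ofReal_mul hlam.le]
  have h1 := h.poisson.measure_pointCount_le_three (measurableSet_annulus ρ t)
    (by rw [hv]; exact ENNReal.ofReal_ne_top)
  have : 0 ≤ t ^ 2 - ρ ^ 2 := by nlinarith
  rwa [hv, ENNReal.toReal_ofReal (by positivity)] at h1

/-- If the nearest point is beyond ε, the disc of radius ε is empty and so contains at most three
points. The factor e³ lost here is harmless. -/
lemma IsOrderedHPPP.measure_norm_gt (h : IsOrderedHPPP X lam P) (hlam : 0 < lam)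
    {ε : ℝ} (hε : 0 ≤ ε) :
    P {ω | ε < ‖X 0 ω‖} ≤ ENNReal.ofReal (Real.exp (3 - lam * (Real.pi * ε ^ 2) / 2)) := by
  have h1 := h.measure_annulus_le_three hlam le_rfl hε
  rw [zero_pow two_ne_zero, sub_zero] at h1
  refine (measure_mono_ae ?_).trans h1
  filter_upwards [h.ordered] with ω hω (hε : ε < ‖X 0 ω‖)
  have : {i | X i ω ∈ annulus 0 ε} = ∅ := by
    rw [Set.eq_empty_iff_forall_notMem]
    rintro i ⟨-, hi⟩
    exact absurd (hi.trans_lt hε) (not_lt.2 (hω (Nat.zero_le i)))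
  change pointCount X (annulus 0 ε) ω ≤ 3
  rw [pointCount, this]
  simp

end

/-! ### Positivity of the path loss at the origin and its integral over the plane -/

lemma PhysicallyFeasible.zero_pos {L : ℝ → ℝ} (hL : PhysicallyFeasible L) : 0 < L 0 := by
  refine (hL.nonneg 0 le_rfl).lt_of_ne' fun h0 => hL.gamma_pos.ne' ?_
  refine setIntegral_eq_zero_of_forall_eq_zero fun r (hr : 0 < r) => ?_
  rw [le_antisymm ((hL.le_zero r hr.le).trans h0.le) (hL.nonneg r hr.le), mul_zero]

/-- Polar coordinates; this is the origin of the constant 2πγ. -/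
lemma PhysicallyFeasible.lintegral_norm {L : ℝ → ℝ} (hL : PhysicallyFeasible L) :
    ∫⁻ x : Plane, ENNReal.ofReal (L ‖x‖) = ENNReal.ofReal (2 * Real.pi * pathGamma L) := by
  have hr : (volume : Measure Plane).real (Metric.ball 0 1) = Real.pi := by
    rw [Measure.real, EuclideanSpace.volume_ball_fin_two]
    simp [Real.pi_pos.le]
  have hd : Module.finrank ℝ Plane = 2 := by simp
  have hint : Integrable fun x : Plane => L ‖x‖ := by
    rw [integrable_fun_norm_addHaar (volume : Measure Plane) (f := L), hd]
    simpa using hL.integrable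
  rw [← ofReal_integral_eq_lintegral_ofReal hint (ae_of_all _ fun x => hL.nonneg _ (norm_nonneg _)),
    integral_fun_norm_addHaar, hd, hr]
  simp [pathGamma, mul_assoc]

/-! ### Laws of the fading gains -/

/-- Nonvanishing encodes integrability, since the mgf of a non-integrable exponential is 0 by
convention. Both complex mgfs are then analytic on Re z < b and agree at the reals near 0, hence on
the imaginary axis, where they are the characteristic functions. -/
lemma measure_ext_of_mgf_eq {μ μ' : Measure ℝ} [IsProbabilityMeasure μ] [IsProbabilityMeasure μ']
    {b : ℝ} (hb : 0 < b) (h0 : ∀ t < b, mgf id μ t ≠ 0) (h : ∀ t < b, mgf id μ t = mgf id μ' t) :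
    μ = μ' := by
  have hI : ∀ (ν : Measure ℝ), (∀ t < b, mgf id ν t ≠ 0) →
      Set.Iio b ⊆ interior (integrableExpSet id ν) := fun ν hν =>
    interior_maximal (fun t ht => by
      by_contra hc
      exact hν t ht (mgf_undef hc)) isOpen_Iio
  have hX := (analyticOnNhd_complexMGF (X := id) (μ := μ)).mono
    (fun (z : ℂ) (hz : z.re < b) => hI μ h0 hz)
  have hY := (analyticOnNhd_complexMGF (X := id) (μ := μ')).mono
    (fun (z : ℂ) (hz : z.re < b) => hI μ' (fun t ht => h t ht ▸ h0 t ht) hz)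
  have key : Set.EqOn (complexMGF id μ) (complexMGF id μ') {z | z.re < b} := by
    refine AnalyticOnNhd.eqOn_of_preconnected_of_frequently_eq hX hY
      ((convex_Iio b).linear_preimage Complex.reLm).isPreconnected (z₀ := ((0 : ℝ) : ℂ))
      (by simpa using hb) ?_
    have h1 : ∀ᶠ x : ℝ in 𝓝[≠] 0, complexMGF id μ x = complexMGF id μ' x := by
      filter_upwards [nhdsWithin_le_nhds (Iio_mem_nhds hb)] with x hx
      rw [complexMGF_ofReal, complexMGF_ofReal, h x hx]
    refine Filter.Tendsto.frequently (f := fun x : ℝ => (x : ℂ)) ?_ h1.frequently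
    refine tendsto_nhdsWithin_iff.2
      ⟨(Complex.continuous_ofReal.tendsto 0).mono_left nhdsWithin_le_nhds, ?_⟩
    filter_upwards [self_mem_nhdsWithin] with x hx
    simpa using hx
  refine Measure.ext_of_charFun (funext fun t => ?_)
  rw [← complexMGF_id_mul_I, ← complexMGF_id_mul_I]
  exact key (by simpa using hb)

lemma mgf_gammaMeasure {n : ℕ} (hn : 0 < n) {t : ℝ} (ht : t < 1) :
    mgf id (gammaMeasure n 1) t = (1 / (1 - t)) ^ n := by
  have hn' : (0 : ℝ) < n := by exact_mod_cast hn
  rw [mgf, gammaMeasure, integral_withDensity_eq_integral_toReal_smul]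
  · have h1 : ∀ x, (gammaPDF n 1 x).toReal • Real.exp (t * id x) =
        (Set.Ici (0 : ℝ)).indicator (fun x => (Real.Gamma n)⁻¹ *
          (x ^ ((n : ℝ) - 1) * Real.exp (-((1 - t) * x)))) x := by
      intro x
      rw [gammaPDF, ENNReal.toReal_ofReal (gammaPDFReal_nonneg hn' one_pos x), gammaPDFReal,
        Set.indicator_apply]
      simp only [Set.mem_Ici]
      split_ifs with hx
      · have : Real.exp (-((1 - t) * x)) = Real.exp (-(1 * x)) * Real.exp (t * x) := by
          rw [← Real.exp_add]; ring_nf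
        rw [this]
        simp only [Real.one_rpow, smul_eq_mul, id]
        ring
      · simp
    simp_rw [h1]
    rw [integral_indicator measurableSet_Ici, integral_Ici_eq_integral_Ioi, integral_const_mul,
      Real.integral_rpow_mul_exp_neg_mul_Ioi hn' (by linarith), Real.rpow_natCast]
    have := (Real.Gamma_pos_of_pos hn').ne'
    field_simp
  · exact (measurable_gammaPDFReal n 1).ennreal_ofReal
  · exact ae_of_all _ fun x => ENNReal.ofReal_lt_top

instance : IsProbabilityMeasure stdComplexGaussian :=
  Measure.isProbabilityMeasure_map (by
    refine Measurable.aemeasurable ?_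
    exact Complex.measurableEquivRealProd.symm.measurable)

lemma measurable_complex_mk : Measurable (fun p : ℝ × ℝ => (⟨p.1, p.2⟩ : ℂ)) :=
  Complex.measurableEquivRealProd.symm.measurable

lemma integral_exp_sq_gaussianReal {t : ℝ} (_ht : t < 1) :
    ∫ x, Real.exp (t * x ^ 2) ∂(gaussianReal 0 (1 / 2)) = Real.sqrt (1 / (1 - t)) := by
  rw [integral_gaussianReal_eq_integral_smul (by norm_num)]
  have h1 : ∀ x : ℝ, gaussianPDFReal 0 (1 / 2) x • Real.exp (t * x ^ 2) =
      (Real.sqrt Real.pi)⁻¹ * Real.exp (-(1 - t) * x ^ 2) := by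
    intro x
    have h2 : ((1 / 2 : ℝ≥0) : ℝ) = 1 / 2 := by norm_num
    have : Real.exp (-(1 - t) * x ^ 2) = Real.exp (-(x - 0) ^ 2 / (2 * (1 / 2))) *
        Real.exp (t * x ^ 2) := by
      rw [← Real.exp_add]; ring_nf
    rw [this, gaussianPDFReal, h2, smul_eq_mul, ← mul_assoc]
    congr 4
    ring
  simp_rw [h1]
  rw [integral_const_mul, integral_gaussian, ← Real.sqrt_inv,
    ← Real.sqrt_mul (by positivity [Real.pi_pos])]
  congr 1
  have := Real.pi_pos.ne'
  field_simp

/-- The real and imaginary parts have variance 1/2, and each contributes a factor (1 − t)^{−1/2}. -/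
lemma mgf_normSq_stdComplexGaussian {t : ℝ} (ht : t < 1) :
    mgf (fun z : ℂ => ‖z‖ ^ 2) stdComplexGaussian t = 1 / (1 - t) := by
  have hm : Measurable fun z : ℂ => Real.exp (t * ‖z‖ ^ 2) := by fun_prop
  rw [mgf, stdComplexGaussian, integral_map measurable_complex_mk.aemeasurable
    hm.aestronglyMeasurable]
  have h1 : ∀ p : ℝ × ℝ, Real.exp (t * ‖(⟨p.1, p.2⟩ : ℂ)‖ ^ 2) =
      Real.exp (t * p.1 ^ 2) * Real.exp (t * p.2 ^ 2) := by
    intro p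
    rw [← Real.exp_add, ← Complex.normSq_eq_norm_sq, Complex.normSq_mk]
    ring_nf
  simp_rw [h1]
  rw [integral_prod_mul (fun x => Real.exp (t * x ^ 2)) (fun y => Real.exp (t * y ^ 2)),
    integral_exp_sq_gaussianReal ht]
  exact Real.mul_self_sqrt (one_div_nonneg.2 (by linarith))

section

variable {Ω : Type*} [MeasurableSpace Ω] {P : Measure Ω} [IsProbabilityMeasure P]

theorem hasLaw_sum_normSq {n : ℕ} (hn : 0 < n) {Z : Fin n → Ω → ℂ}
    (hlaw : ∀ k, HasLaw (Z k) stdComplexGaussian P) (hind : iIndepFun Z P) :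
    HasLaw (fun ω => ∑ k, ‖Z k ω‖ ^ 2) (gammaMeasure n 1) P := by
  have hm : AEMeasurable (fun ω => ∑ k, ‖Z k ω‖ ^ 2) P :=
    Finset.aemeasurable_fun_sum _ fun k _ => (hlaw k).aemeasurable.norm.pow_const 2
  refine ⟨hm, ?_⟩
  have : IsProbabilityMeasure (P.map fun ω => ∑ k, ‖Z k ω‖ ^ 2) := Measure.isProbabilityMeasure_map hm
  have : IsProbabilityMeasure (gammaMeasure n 1) :=
    isProbabilityMeasure_gammaMeasure (by exact_mod_cast hn) one_pos
  symm
  refine measure_ext_of_mgf_eq one_pos (fun t ht => ?_) fun t ht => ?_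
  · rw [mgf_gammaMeasure hn ht]
    have : 0 < 1 - t := by linarith
    positivity
  · rw [mgf_gammaMeasure hn ht, mgf_id_map hm]
    have h1 := (hind.comp (fun _ (z : ℂ) => ‖z‖ ^ 2) (fun _ => by fun_prop)).mgf_sum₀
      (t := t) (fun k => (hlaw k).aemeasurable.norm.pow_const 2) Finset.univ
    have e : (∑ i, (fun (z : ℂ) => ‖z‖ ^ 2) ∘ Z i) = fun ω => ∑ k, ‖Z k ω‖ ^ 2 := by
      ext ω
      simp
    rw [e] at h1
    rw [h1]
    have h2 : ∀ k, mgf ((fun (z : ℂ) => ‖z‖ ^ 2) ∘ Z k) P t = 1 / (1 - t) := fun k => by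
      rw [← mgf_normSq_stdComplexGaussian ht, ← (hlaw k).map_eq]
      rw [mgf_map (hlaw k).aemeasurable (by fun_prop)]
    simp [h2]

lemma charFun_stdComplexGaussian (t : ℂ) :
    charFun stdComplexGaussian t = Complex.exp (-(‖t‖ ^ 2 / 4 : ℝ)) := by
  have hm : Measurable fun z : ℂ => Complex.exp (inner ℝ z t * Complex.I) := by fun_prop
  rw [charFun_apply, stdComplexGaussian, integral_map measurable_complex_mk.aemeasurable
    hm.aestronglyMeasurable]
  have h1 : ∀ p : ℝ × ℝ, Complex.exp (inner ℝ (⟨p.1, p.2⟩ : ℂ) t * Complex.I) =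
      Complex.exp (t.re * p.1 * Complex.I) * Complex.exp (t.im * p.2 * Complex.I) := by
    intro p
    rw [← Complex.exp_add, ← add_mul]
    congr 2
    rw [Complex.inner]
    simp
  simp_rw [h1]
  rw [integral_prod_mul (fun x : ℝ => Complex.exp (t.re * x * Complex.I))
    (fun y : ℝ => Complex.exp (t.im * y * Complex.I)), ← charFun_apply_real, ← charFun_apply_real,
    charFun_gaussianReal, charFun_gaussianReal, ← Complex.exp_add, ← Complex.normSq_eq_norm_sq,
    Complex.normSq_apply]
  congr 1
  push_cast
  ring

/-- The characteristic function exp(−|t|²/4) depends on t through |t|² alone, and the product over k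
adds up the |cₖ|²|t|². -/
theorem hasLaw_unit_combination {n : ℕ} {Z : Fin n → Ω → ℂ}
    (hlaw : ∀ k, HasLaw (Z k) stdComplexGaussian P) (hind : iIndepFun Z P)
    (c : Fin n → ℂ) (hc : ∑ k, ‖c k‖ ^ 2 = 1) :
    HasLaw (fun ω => ∑ k, c k * Z k ω) stdComplexGaussian P := by
  have hm1 : ∀ k, AEMeasurable (fun ω => c k * Z k ω) P := fun k =>
    (hlaw k).aemeasurable.const_mul _
  have hm : AEMeasurable (fun ω => ∑ k, c k * Z k ω) P :=
    Finset.aemeasurable_fun_sum _ fun k _ => hm1 k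
  refine ⟨hm, ?_⟩
  have : IsProbabilityMeasure (P.map fun ω => ∑ k, c k * Z k ω) := Measure.isProbabilityMeasure_map hm
  refine Measure.ext_of_charFun (funext fun t => ?_)
  have h1 := iIndepFun.charFun_map_fun_sum_eq_prod (P := P) (X := fun k ω => c k * Z k ω) hm1
    (hind.comp (fun k (z : ℂ) => c k * z) (fun k => by fun_prop))
  have h2 : ∀ k, charFun (P.map fun ω => c k * Z k ω) t =
      Complex.exp (-(‖c k‖ ^ 2 * ‖t‖ ^ 2 / 4 : ℝ)) := by
    intro k
    have h3 : charFun (P.map fun ω => c k * Z k ω) t =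
        charFun stdComplexGaussian ((starRingEnd ℂ) (c k) * t) := by
      rw [charFun_apply, charFun_apply, ← (hlaw k).map_eq,
        integral_map (hm1 k) (by fun_prop), integral_map (hlaw k).aemeasurable (by fun_prop)]
      refine integral_congr_ae (ae_of_all _ fun ω => ?_)
      simp only [Complex.inner, map_mul]
      congr 4
      ring
    rw [h3, charFun_stdComplexGaussian, norm_mul, RCLike.norm_conj, mul_pow]
  rw [h1, Finset.prod_apply, charFun_stdComplexGaussian]
  simp_rw [h2]
  rw [← Complex.exp_sum, Finset.sum_neg_distrib, ← Complex.ofReal_sum, ← Finset.sum_div,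
    ← Finset.sum_mul, hc, one_mul]

lemma hasLaw_normSq_exp {Z : Ω → ℂ} (hZ : HasLaw Z stdComplexGaussian P) :
    HasLaw (fun ω => ‖Z ω‖ ^ 2) (expMeasure 1) P := by
  have h := hasLaw_sum_normSq (n := 1) one_pos (Z := fun _ => Z) (fun _ => hZ)
    (iIndepFun.of_subsingleton)
  simpa [expMeasure] using h

end

/-! ### Independence of the gains -/

section

variable {Ω : Type*} [MeasurableSpace Ω] {P : Measure Ω} [IsProbabilityMeasure P]

/-- Fubini for the product law: the section over a ∈ s has measure ν t whatever a is. It is applied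
with `A` the earlier channels and `B` a fresh one, so the gain becomes independent even of the
combiner it is built from. -/
theorem hasLaw_and_indepFun_of_map_eq {α β γ : Type*} [MeasurableSpace α] [MeasurableSpace β]
    [MeasurableSpace γ] {A : Ω → α} {B : Ω → β} (hA : Measurable A) (hB : Measurable B)
    (hAB : IndepFun A B P) {f : α × β → γ} (hf : Measurable f) {ν : Measure γ}
    [IsProbabilityMeasure ν]
    (hν : ∀ᵐ a ∂(P.map A), (P.map B).map (fun b => f (a, b)) = ν) :
    HasLaw (fun ω => f (A ω, B ω)) ν P ∧ IndepFun A (fun ω => f (A ω, B ω)) P := by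
  have key : ∀ s t, MeasurableSet s → MeasurableSet t →
      P (A ⁻¹' s ∩ (fun ω => f (A ω, B ω)) ⁻¹' t) = P (A ⁻¹' s) * ν t := by
    intro s t hs ht
    have hprod := (indepFun_iff_map_prod_eq_prod_map_map hA.aemeasurable hB.aemeasurable).1 hAB
    have hms : MeasurableSet ((Prod.fst ⁻¹' s : Set (α × β)) ∩ f ⁻¹' t) :=
      (measurable_fst hs).inter (hf ht)
    have h1 : P (A ⁻¹' s ∩ (fun ω => f (A ω, B ω)) ⁻¹' t) =
        ((P.map A).prod (P.map B)) ((Prod.fst ⁻¹' s) ∩ f ⁻¹' t) := by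
      rw [← hprod, Measure.map_apply (hA.prodMk hB) hms]
      rfl
    have := Measure.isProbabilityMeasure_map (μ := P) hB.aemeasurable
    rw [h1, Measure.prod_apply hms]
    have h2 : ∀ᵐ a ∂(P.map A), (P.map B) (Prod.mk a ⁻¹' ((Prod.fst ⁻¹' s) ∩ f ⁻¹' t)) =
        s.indicator (fun _ => ν t) a := by
      filter_upwards [hν] with a ha
      by_cases has : a ∈ s
      · rw [Set.indicator_of_mem has, ← ha, Measure.map_apply (by fun_prop) ht]
        congr 1
        ext b
        simp [has]
      · rw [Set.indicator_of_notMem has]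
        convert measure_empty (μ := P.map B)
        ext b
        simp [has]
    rw [lintegral_congr_ae h2, lintegral_indicator_const hs, Measure.map_apply hA hs, mul_comm]
  have hm : Measurable fun ω => f (A ω, B ω) := hf.comp (hA.prodMk hB)
  have hlaw : HasLaw (fun ω => f (A ω, B ω)) ν P := by
    refine ⟨hm.aemeasurable, Measure.ext fun t ht => ?_⟩
    have := key Set.univ t MeasurableSet.univ ht
    simpa [Measure.map_apply hm ht] using this
  refine ⟨hlaw, indepFun_iff_measure_inter_preimage_eq_mul.2 fun s t hs ht => ?_⟩
  rw [key s t hs ht, ← hlaw.map_eq, Measure.map_apply hm ht]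

/-- Induction gives the product formula on initial segments; an arbitrary finite index set is
embedded in one, with `Set.univ` at the missing indices. -/
theorem iIndepFun_nat_of_indepFun_past {β : Type*} [MeasurableSpace β] {g : ℕ → Ω → β}
    (h : ∀ n, IndepFun (fun ω (i : Finset.range n) => g i ω) (g n) P) : iIndepFun g P := by
  have key : ∀ (n : ℕ) (B : ℕ → Set β), (∀ i, MeasurableSet (B i)) →
      P (⋂ i ∈ Finset.range n, g i ⁻¹' B i) = ∏ i ∈ Finset.range n, P (g i ⁻¹' B i) := by
    intro n B hB
    induction n with
    | zero => simp
    | succ n ih =>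
      rw [Finset.prod_range_succ, ← ih]
      have h1 := (h n).measure_inter_preimage_eq_mul
        (Set.univ.pi fun i : Finset.range n => B i) (B n)
        (MeasurableSet.univ_pi fun i => hB i) (hB n)
      have e : (fun ω (i : Finset.range n) => g i ω) ⁻¹' (Set.univ.pi fun i => B i) =
          ⋂ i ∈ Finset.range n, g i ⁻¹' B i := by
        ext ω
        simp [Set.mem_pi]
      rw [e] at h1
      rw [← h1, Finset.range_add_one, Finset.set_biInter_insert, Set.inter_comm]
  refine iIndepFun_iff_measure_inter_preimage_eq_mul.2 fun S B hB => ?_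
  obtain ⟨n, hn⟩ : ∃ n, S ⊆ Finset.range n := ⟨S.sup id + 1, fun i hi =>
    Finset.mem_range.2 (Nat.lt_succ_of_le (Finset.le_sup (f := id) hi))⟩
  have h1 := key n (fun i => if i ∈ S then B i else Set.univ) fun i => by
    split_ifs with hi
    exacts [hB i hi, MeasurableSet.univ]
  have h2 : ∏ i ∈ Finset.range n, P (g i ⁻¹' (if i ∈ S then B i else Set.univ)) =
      ∏ i ∈ S, P (g i ⁻¹' B i) := by
    rw [← Finset.prod_subset hn]
    · exact Finset.prod_congr rfl fun i hi => by rw [if_pos hi]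
    · intro i _ hi
      rw [if_neg hi, Set.preimage_univ, measure_univ]
  have h3 : ⋂ i ∈ Finset.range n, g i ⁻¹' (if i ∈ S then B i else Set.univ) =
      ⋂ i ∈ S, g i ⁻¹' B i := by
    ext ω
    simp only [Set.mem_iInter, Set.mem_preimage]
    constructor
    · intro hω i hi
      simpa [hi] using hω i (hn hi)
    · intro hω i _
      split_ifs with hi
      exacts [hω i hi, Set.mem_univ _]
  rw [h2, h3] at h1
  exact h1

end

/-- The effective gain of a channel `w` after combining with `v`. -/
def combineGain {n : ℕ} (v w : Fin n → ℂ) : ℝ := ‖star v ⬝ᵥ w‖ ^ 2 / ∑ k, ‖v k‖ ^ 2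

lemma measurable_combineGain {n : ℕ} {α : Type*} [MeasurableSpace α] {f g : α → Fin n → ℂ}
    (hf : Measurable f) (hg : Measurable g) : Measurable fun a => combineGain (f a) (g a) := by
  simp only [combineGain, dotProduct, Pi.star_apply]
  have hf' : ∀ k, Measurable fun a => f a k := fun k => (measurable_pi_apply k).comp hf
  have hg' : ∀ k, Measurable fun a => g a k := fun k => (measurable_pi_apply k).comp hg
  exact ((Finset.measurable_fun_sum _ fun k _ =>
    ((continuous_star.measurable.comp (hf' k)).mul (hg' k))).norm.pow_const 2).div
    (Finset.measurable_fun_sum _ fun k _ => (hf' k).norm.pow_const 2)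

lemma star_dotProduct_self_eq {n : ℕ} (v : Fin n → ℂ) :
    star v ⬝ᵥ v = ((∑ k, ‖v k‖ ^ 2 : ℝ) : ℂ) := by
  rw [dotProduct, Complex.ofReal_sum]
  refine Finset.sum_congr rfl fun k _ => ?_
  rw [Pi.star_apply, Complex.star_def, ← Complex.normSq_eq_conj_mul_self,
    Complex.normSq_eq_norm_sq]

lemma combineGain_self {n : ℕ} (v : Fin n → ℂ) : combineGain v v = ∑ k, ‖v k‖ ^ 2 := by
  have h : 0 ≤ ∑ k, ‖v k‖ ^ 2 := by positivity
  rw [combineGain, star_dotProduct_self_eq, Complex.norm_real, Real.norm_of_nonneg h, pow_two,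
    mul_self_div_self]

lemma combineGain_nonneg {n : ℕ} (v w : Fin n → ℂ) : 0 ≤ combineGain v w := by
  rw [combineGain]
  positivity

lemma mrcGain_eq_combineGain {n : ℕ} (h : ℕ → Fin n → ℂ) (i : ℕ) :
    mrcGain h i = combineGain (h 0) (h i) := rfl

lemma mrcGain_nonneg {n : ℕ} (h : ℕ → Fin n → ℂ) (i : ℕ) : 0 ≤ mrcGain h i :=
  mrcGain_eq_combineGain h i ▸ combineGain_nonneg _ _

lemma mrcGain_zero {n : ℕ} (h : ℕ → Fin n → ℂ) : mrcGain h 0 = ∑ k, ‖h 0 k‖ ^ 2 := by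
  rw [mrcGain_eq_combineGain, combineGain_self]

/-- The interference seen by the user. -/
def interference {n : ℕ} (L : ℝ → ℝ) (x : ℕ → Plane) (h : ℕ → Fin n → ℂ) : ℝ :=
  ∑' i, L ‖x (i + 1)‖ * mrcGain h (i + 1)

/-- Numerator and denominator share the factor ‖h₀‖². Where it vanishes both sides are 0, by x / 0 =
0 on the left and by a zero gain on the right, so the identity holds for every outcome. -/
lemma simoSINR_eq {n : ℕ} (L : ℝ → ℝ) (σ2 : ℝ) (x : ℕ → Plane) (h : ℕ → Fin n → ℂ) :
    simoSINR L σ2 x h = L ‖x 0‖ * mrcGain h 0 / (interference L x h + σ2) := by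
  have hmv : ∀ i, (Matrix.replicateCol (Fin 1) (h i)).mulVec (fun _ => 1) = h i := by
    intro i
    ext k
    simp [Matrix.mulVec, dotProduct]
  simp only [simoSINR, sinr, hmv, interference]
  set S := ∑ k, ‖h 0 k‖ ^ 2 with hS
  have hS0 : 0 ≤ S := by positivity
  have e : ∀ i, ‖star (h 0) ⬝ᵥ h i‖ ^ 2 = mrcGain h i * S := by
    intro i
    by_cases h0 : S = 0
    · have hz : h 0 = 0 := by
        ext k
        have := (Finset.sum_eq_zero_iff_of_nonneg (fun k _ => by positivity)).1 (hS ▸ h0) k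
          (Finset.mem_univ k)
        simpa using this
      rw [h0, mul_zero, hz]
      simp
    · rw [mrcGain, ← hS, div_mul_cancel₀ _ h0]
  simp_rw [e, ← mul_assoc]
  rw [tsum_mul_right, mul_comm S σ2, ← add_mul]
  by_cases h0 : S = 0
  · rw [h0, mrcGain_zero, ← hS, h0]
    simp
  · rw [mul_div_mul_right _ _ h0]

lemma measurable_mrcGain {n : ℕ} (i : ℕ) :
    Measurable fun h : ℕ → Fin n → ℂ => mrcGain h i := by
  simp_rw [mrcGain_eq_combineGain]
  exact measurable_combineGain (measurable_pi_apply 0) (measurable_pi_apply i)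

attribute [irreducible] combineGain

theorem IsSIMONetwork.measurable_gain {Ω : Type*} [MeasurableSpace Ω] {P : Measure Ω} {lam : ℝ} {n : ℕ}
    {X : ℕ → Ω → Plane} {h : ℕ → Ω → Fin n → ℂ} (hnet : IsSIMONetwork P lam X h) (i : ℕ) :
    Measurable fun ω => mrcGain (fun j => h j ω) i := by
  have h1 : Measurable fun ω j => h j ω := measurable_pi_lambda _ hnet.fading_measurable
  have h2 := (measurable_mrcGain i).comp h1
  simp only [Function.comp_def] at h2
  exact h2

theorem IsSIMONetwork.indepFun_gain_locations {Ω : Type*} [MeasurableSpace Ω] {P : Measure Ω}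
    {lam : ℝ} {n : ℕ} {X : ℕ → Ω → Plane} {h : ℕ → Ω → Fin n → ℂ} (hnet : IsSIMONetwork P lam X h) :
    IndepFun (fun ω i => mrcGain (fun j => h j ω) i) (fun ω i => X i ω) P := by
  have h1 : Measurable fun (h : ℕ → Fin n → ℂ) i => mrcGain h i :=
    measurable_pi_lambda _ fun i => measurable_mrcGain i
  exact hnet.fading_indep_locations.comp h1 measurable_id

section

variable {Ω : Type*} [MeasurableSpace Ω] {P : Measure Ω} [IsProbabilityMeasure P] {lam : ℝ} {n : ℕ}
  {X : ℕ → Ω → Plane} {h : ℕ → Ω → Fin n → ℂ}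

/-- The channel vectors recovered from the coefficients with index in `S`, others being zero. -/
def extendChannel {n : ℕ} (S : Finset (ℕ × Fin n)) (a : S → ℂ) (i : ℕ) (k : Fin n) : ℂ :=
  if hq : (i, k) ∈ S then a ⟨(i, k), hq⟩ else 0

lemma measurable_extendChannel {n : ℕ} (S : Finset (ℕ × Fin n)) (i : ℕ) :
    Measurable fun a : S → ℂ => extendChannel S a i := by
  refine measurable_pi_lambda _ fun k => ?_
  simp only [extendChannel]
  split_ifs <;> fun_prop

lemma IsSIMONetwork.hasLaw_gain_zero (hnet : IsSIMONetwork P lam X h) (hn : 1 ≤ n) :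
    HasLaw (fun ω => mrcGain (fun i => h i ω) 0) (gammaMeasure n 1) P := by
  simp_rw [mrcGain_zero]
  exact hasLaw_sum_normSq hn (fun k => hnet.fading_law 0 k)
    (hnet.fading_indep.precomp (g := fun k : Fin n => ((0 : ℕ), k)) (Prod.mk_right_injective 0))

lemma IsSIMONetwork.ae_sum_ne_zero (hnet : IsSIMONetwork P lam X h) (hn : 1 ≤ n) :
    ∀ᵐ ω ∂P, ∑ k, ‖h 0 ω k‖ ^ 2 ≠ 0 := by
  have h1 := (hnet.hasLaw_gain_zero hn).ae_iff (p := fun x => x ≠ 0)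
    (measurableSet_singleton (0 : ℝ)).compl.mem
  simp_rw [mrcGain_zero] at h1
  rw [h1]
  have : gammaMeasure n 1 ≪ volume := withDensity_absolutelyContinuous _ _
  refine this.ae_le ?_
  exact compl_mem_ae_iff.2 (measure_singleton 0)

/-- For fixed v ≠ 0 the gain is |Σ cₖ hₖ|² with cₖ = conj(vₖ)/‖v‖, a unit vector, so its law does
not depend on v. This constancy is what produces independence. -/
lemma IsSIMONetwork.map_combineGain (hnet : IsSIMONetwork P lam X h) (i : ℕ) {v : Fin n → ℂ}
    (ha : ∑ k, ‖v k‖ ^ 2 ≠ 0) :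
    (P.map (h (i + 1))).map (fun b => combineGain v b) = expMeasure 1 := by
  set s := ∑ k, ‖v k‖ ^ 2 with hs
  have hs0 : 0 < s := lt_of_le_of_ne (by positivity) (Ne.symm ha)
  have hcomb := hasLaw_unit_combination (Z := fun k ω => h (i + 1) ω k)
    (fun k => hnet.fading_law (i + 1) k)
    (hnet.fading_indep.precomp (g := fun k : Fin n => (i + 1, k))
      (Prod.mk_right_injective (i + 1)))
    (fun k => star (v k) / (Real.sqrt s : ℂ)) (by
      simp_rw [norm_div, norm_star, Complex.norm_real, div_pow, Real.norm_eq_abs, sq_abs,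
        Real.sq_sqrt hs0.le]
      rw [← Finset.sum_div, ← hs, div_self ha])
  have hexp := hasLaw_normSq_exp hcomb
  have e : ∀ ω, ‖∑ k, star (v k) / (Real.sqrt s : ℂ) * h (i + 1) ω k‖ ^ 2 =
      combineGain v (h (i + 1) ω) := by
    intro ω
    have : ∑ k, star (v k) / (Real.sqrt s : ℂ) * h (i + 1) ω k =
        (star v ⬝ᵥ h (i + 1) ω) / (Real.sqrt s : ℂ) := by
      rw [dotProduct, Finset.sum_div]
      exact Finset.sum_congr rfl fun k _ => by rw [Pi.star_apply]; ring
    rw [this, norm_div, Complex.norm_real, div_pow, Real.norm_eq_abs, sq_abs,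
      Real.sq_sqrt hs0.le, combineGain]
  simp_rw [e] at hexp
  have hmv : Measurable fun b : Fin n → ℂ => combineGain v b :=
    measurable_combineGain measurable_const measurable_id
  rw [Measure.map_map hmv (hnet.fading_measurable _), Function.comp_def]
  exact hexp.map_eq

/-- Freezing the coefficients of the links 0, …, i (the index set `S`) fixes the combiner and all
earlier gains, while the coefficients of link i + 1 (the index set `T`) stay fresh. -/
lemma IsSIMONetwork.hasLaw_gain_and_indepFun (hnet : IsSIMONetwork P lam X h) (hn : 1 ≤ n) (i : ℕ) :
    HasLaw (fun ω => mrcGain (fun j => h j ω) (i + 1)) (expMeasure 1) P ∧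
    IndepFun (fun ω (j : Finset.range (i + 1)) => mrcGain (fun j => h j ω) j)
      (fun ω => mrcGain (fun j => h j ω) (i + 1)) P := by
  set S : Finset (ℕ × Fin n) := Finset.range (i + 1) ×ˢ Finset.univ with hS
  set T : Finset (ℕ × Fin n) := {i + 1} ×ˢ Finset.univ with hT
  have hmq : ∀ q : ℕ × Fin n, Measurable fun ω => h q.1 ω q.2 := fun q =>
    (measurable_pi_apply q.2).comp (hnet.fading_measurable q.1)
  have hdis : Disjoint S T := by
    rw [Finset.disjoint_left]
    rintro ⟨j, k⟩ h1 h2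
    simp only [hS, hT, Finset.mem_product, Finset.mem_range, Finset.mem_singleton] at h1 h2
    omega
  set A : Ω → S → ℂ := fun ω q => h q.1.1 ω q.1.2 with hAdef
  have hAm : Measurable A := measurable_pi_lambda _ fun q => hmq q
  have hA : ∀ j ≤ i, ∀ ω, extendChannel S (A ω) j = h j ω := by
    intro j hj ω
    ext k
    have : (j, k) ∈ S := by simp [hS]; omega
    simp [extendChannel, this, hAdef]
  have hB : ∀ ω, extendChannel T (fun q => h q.1.1 ω q.1.2) (i + 1) = h (i + 1) ω := by
    intro ω
    ext k
    have : (i + 1, k) ∈ T := by simp [hT]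
    simp [extendChannel, this]
  have hind : IndepFun A (h (i + 1)) P := by
    have h1 := (hnet.fading_indep.indepFun_finset S T hdis hmq).comp
      (φ := id) (ψ := fun b => extendChannel T b (i + 1)) measurable_id
      (measurable_extendChannel T (i + 1))
    have e : (fun b => extendChannel T b (i + 1)) ∘ (fun ω (q : T) => h q.1.1 ω q.1.2) =
        h (i + 1) := funext hB
    rw [e] at h1
    exact h1
  have : IsProbabilityMeasure (expMeasure 1) := isProbabilityMeasure_expMeasure one_pos
  have hfm : Measurable fun p : (S → ℂ) × (Fin n → ℂ) =>
      combineGain (extendChannel S p.1 0) p.2 :=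
    measurable_combineGain ((measurable_extendChannel S 0).comp measurable_fst) measurable_snd
  have hlaw : ∀ᵐ a ∂(P.map A), (P.map (h (i + 1))).map
      (fun b => combineGain (extendChannel S a 0) b) = expMeasure 1 := by
    have hne : ∀ᵐ a ∂(P.map A), ∑ k, ‖extendChannel S a 0 k‖ ^ 2 ≠ 0 := by
      rw [ae_map_iff hAm.aemeasurable]
      · filter_upwards [hnet.ae_sum_ne_zero hn] with ω hω
        rwa [hA 0 (Nat.zero_le _)]
      · have hmm : Measurable fun a : S → ℂ => ∑ k, ‖extendChannel S a 0 k‖ ^ 2 := by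
          refine Finset.measurable_fun_sum _ fun k _ => ?_
          exact ((measurable_pi_apply k).comp (measurable_extendChannel S 0)).norm.pow_const 2
        exact hmm (measurableSet_singleton 0).compl
    filter_upwards [hne] with a ha
    exact hnet.map_combineGain i ha
  obtain ⟨h1, h2⟩ := hasLaw_and_indepFun_of_map_eq hAm (hnet.fading_measurable (i + 1)) hind hfm hlaw
  have e : ∀ ω, combineGain (extendChannel S (A ω) 0) (h (i + 1) ω) =
      mrcGain (fun j => h j ω) (i + 1) := by
    intro ω
    rw [hA 0 (Nat.zero_le _), mrcGain_eq_combineGain]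
  simp only [e] at h1 h2
  refine ⟨h1, ?_⟩
  have hφ : Measurable fun (a : S → ℂ) (j : Finset.range (i + 1)) =>
      mrcGain (extendChannel S a) j := by
    have h3 : Measurable fun a : S → ℂ => extendChannel S a :=
      measurable_pi_lambda _ fun j => measurable_extendChannel S j
    refine measurable_pi_lambda _ fun j => ?_
    have h4 := (measurable_mrcGain (n := n) (j : ℕ)).comp h3
    simp only [Function.comp_def] at h4
    exact h4
  have h3 := h2.comp hφ measurable_id
  have e2 : ∀ ω (j : Finset.range (i + 1)), mrcGain (extendChannel S (A ω)) j =
      mrcGain (fun j => h j ω) j := by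
    intro ω j
    rw [mrcGain_eq_combineGain, mrcGain_eq_combineGain, hA 0 (Nat.zero_le _),
      hA j (Nat.lt_succ_iff.1 (Finset.mem_range.1 j.2))]
  simp only [Function.comp_def, e2, id] at h3
  exact h3

theorem IsSIMONetwork.iIndepFun_gain (hnet : IsSIMONetwork P lam X h) (hn : 1 ≤ n) :
    iIndepFun (fun i ω => mrcGain (fun j => h j ω) i) P := by
  refine iIndepFun_nat_of_indepFun_past fun m => ?_
  cases m with
  | zero =>
    have : (fun ω (i : Finset.range 0) => mrcGain (fun j => h j ω) i) =
        fun _ => fun i : Finset.range 0 => 0 := by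
      ext ω i
      exact absurd i.2 (by simp)
    rw [this]
    exact indepFun_const_left _ _
  | succ i => exact (hnet.hasLaw_gain_and_indepFun hn i).2

end

/-! ### Concentration of the interference -/

/-- The effective scalar model: gains `G i` that are independent, independent of the ordered Poisson
points `X`, and exponential for the interferers `i ≥ 1`. -/
structure IsGainModel {Ω : Type*} [MeasurableSpace Ω] (P : Measure Ω) (lam : ℝ)
    (X : ℕ → Ω → Plane) (G : ℕ → Ω → ℝ) : Prop where
  locations : IsOrderedHPPP X lam P
  measurable : ∀ i, Measurable (G i)
  nonneg : ∀ i ω, 0 ≤ G i ω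
  law : ∀ i, HasLaw (G (i + 1)) (expMeasure 1) P
  indep : iIndepFun G P
  indep_locations : IndepFun (fun ω i => G i ω) (fun ω i => X i ω) P

theorem IsSIMONetwork.isGainModel {Ω : Type*} [MeasurableSpace Ω] {P : Measure Ω}
    [IsProbabilityMeasure P] {lam : ℝ} {n : ℕ}
    {X : ℕ → Ω → Plane} {h : ℕ → Ω → Fin n → ℂ} (hnet : IsSIMONetwork P lam X h) (hn : 1 ≤ n) :
    IsGainModel P lam X (fun i ω => mrcGain (fun j => h j ω) i) where
  locations := hnet.locations
  measurable := hnet.measurable_gain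
  nonneg i _ := mrcGain_nonneg _ i
  law i := (hnet.hasLaw_gain_and_indepFun hn i).1
  indep := hnet.iIndepFun_gain hn
  indep_locations := hnet.indepFun_gain_locations

section

variable {Ω : Type*} [MeasurableSpace Ω] {P : Measure Ω} [IsProbabilityMeasure P]

/-- Fubini with `B` frozen at ω' while `A` is averaged. It is used with `A` the gains and `B` the
locations, in place of a conditional expectation given the locations. -/
theorem lintegral_indepFun_eq {α β : Type*} [MeasurableSpace α] [MeasurableSpace β]
    {A : Ω → α} {B : Ω → β} (hA : Measurable A) (hB : Measurable B) (hAB : IndepFun A B P)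
    {F : α → β → ℝ≥0∞} (hF : Measurable (Function.uncurry F)) :
    ∫⁻ ω, F (A ω) (B ω) ∂P = ∫⁻ ω', ∫⁻ ω, F (A ω) (B ω') ∂P ∂P := by
  have hprod := (indepFun_iff_map_prod_eq_prod_map_map hA.aemeasurable hB.aemeasurable).1 hAB
  have := Measure.isProbabilityMeasure_map (μ := P) hB.aemeasurable
  have := Measure.isProbabilityMeasure_map (μ := P) hA.aemeasurable
  have h1 : ∫⁻ ω, F (A ω) (B ω) ∂P = ∫⁻ p, Function.uncurry F p ∂((P.map A).prod (P.map B)) := by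
    rw [← hprod, lintegral_map hF (hA.prodMk hB)]
    rfl
  rw [h1, lintegral_prod_symm' _ hF, lintegral_map (hF.lintegral_prod_left') hB]
  refine lintegral_congr fun ω' => ?_
  rw [lintegral_map (by fun_prop) hA]
  rfl

lemma lintegral_exp_mul_of_hasLaw_exp {G : Ω → ℝ} (hG : HasLaw G (expMeasure 1) P) {t : ℝ}
    (ht : t < 1) :
    ∫⁻ ω, ENNReal.ofReal (Real.exp (t * G ω)) ∂P = ENNReal.ofReal (1 / (1 - t)) := by
  have h1 := mgf_gammaMeasure one_pos ht
  rw [pow_one, Nat.cast_one, show gammaMeasure 1 1 = expMeasure 1 from rfl, ← hG.map_eq,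
    mgf_id_map hG.aemeasurable] at h1
  -- Otherwise the Bochner integral would be 0 and not 1/(1 − t).
  have hint : Integrable (fun ω => Real.exp (t * G ω)) P := by
    by_contra hc
    rw [mgf_undef hc] at h1
    have : 0 < 1 / (1 - t) := one_div_pos.2 (by linarith)
    exact this.ne h1
  rw [← ofReal_integral_eq_lintegral_ofReal hint (ae_of_all _ fun ω => (Real.exp_pos _).le)]
  exact congrArg ENNReal.ofReal h1

variable {lam : ℝ} {X : ℕ → Ω → Plane} {G : ℕ → Ω → ℝ} {L : ℝ → ℝ}

lemma IsGainModel.measurable_gains (hm : IsGainModel P lam X G) : Measurable fun ω i => G i ω :=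
  measurable_pi_lambda _ hm.measurable

lemma IsGainModel.measurable_locations (hm : IsGainModel P lam X G) :
    Measurable fun ω i => X i ω :=
  measurable_pi_lambda _ hm.locations.poisson.measurable

lemma IsGainModel.lintegral_exp_sum_gain (hm : IsGainModel P lam X G) (n : ℕ) (t : ℕ → ℝ)
    (ht : ∀ i, t i < 1) :
    ∫⁻ ω, ENNReal.ofReal (Real.exp (∑ i ∈ Finset.range n, t i * G (i + 1) ω)) ∂P =
      ENNReal.ofReal (∏ i ∈ Finset.range n, 1 / (1 - t i)) := by
  have h1 : ∀ ω, ENNReal.ofReal (Real.exp (∑ i ∈ Finset.range n, t i * G (i + 1) ω)) =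
      ∏ i ∈ Finset.range n, ENNReal.ofReal (Real.exp (t i * G (i + 1) ω)) := fun ω => by
    rw [Real.exp_sum, ENNReal.ofReal_prod_of_nonneg fun _ _ => (Real.exp_pos _).le]
  simp_rw [h1]
  have hind : iIndepFun (fun i => G (i + 1)) P := hm.indep.precomp (Nat.succ_injective)
  have h2 := lintegral_prod_eq_prod_lintegral_of_indepFun (Finset.range n)
    (fun i ω => ENNReal.ofReal (Real.exp (t i * G (i + 1) ω)))
    (hind.comp (fun i x => ENNReal.ofReal (Real.exp (t i * x))) fun i => by fun_prop)
    (fun i => by have := hm.measurable (i + 1); fun_prop)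
  rw [h2, ENNReal.ofReal_prod_of_nonneg fun i _ => one_div_nonneg.2 (by linarith [ht i])]
  exact Finset.prod_congr rfl fun i _ => lintegral_exp_mul_of_hasLaw_exp (hm.law i) (ht i)

/-- Puts the exponential transform of a gain into the form that the Poisson bound accepts. The price
is the factor 1/(1 − b), which tends to 1 with b → 0. -/
lemma one_div_one_sub_le_exp {x b : ℝ} (hx : 0 ≤ x) (hxb : x ≤ b) (hb : b < 1) :
    1 / (1 - x) ≤ Real.exp (x / (1 - b)) := by
  have h1 : 0 < 1 - x := by linarith
  have h2 : 1 / (1 - x) = x / (1 - x) + 1 := by field_simp; ring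
  rw [h2]
  refine (Real.add_one_le_exp _).trans (Real.exp_le_exp.2 ?_)
  exact div_le_div_of_nonneg_left hx (by linarith) (by linarith)

lemma one_div_one_add_le_exp {x b : ℝ} (hx : 0 ≤ x) (hxb : x ≤ b) :
    1 / (1 + x) ≤ Real.exp (-(x / (1 + b))) := by
  have h1 : 0 < 1 + x := by linarith
  have h2 : 1 / (1 + x) = -(x / (1 + x)) + 1 := by field_simp; ring
  rw [h2]
  refine (Real.add_one_le_exp _).trans (Real.exp_le_exp.2 (neg_le_neg ?_))
  exact div_le_div_of_nonneg_left hx h1 (by linarith)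

lemma PhysicallyFeasible.lintegral_intensity (hL : PhysicallyFeasible L) (hlam : 0 < lam) {s : ℝ}
    (hs : 0 ≤ s) :
    ∫⁻ x, (Real.toNNReal (s * L ‖x‖) : ℝ≥0∞) ∂(ENNReal.ofReal lam • (volume : Measure Plane)) =
      ENNReal.ofReal (lam * (s * (2 * Real.pi * pathGamma L))) := by
  have h1 : ∀ x : Plane, (Real.toNNReal (s * L ‖x‖) : ℝ≥0∞) =
      ENNReal.ofReal s * ENNReal.ofReal (L ‖x‖) := fun x => by
    rw [← ENNReal.ofReal_mul hs]; rfl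
  simp_rw [h1]
  rw [lintegral_smul_measure, lintegral_const_mul' _ _ ENNReal.ofReal_ne_top, hL.lintegral_norm,
    smul_eq_mul, ENNReal.ofReal_mul hlam.le, ENNReal.ofReal_mul hs]

theorem IsGainModel.lintegral_exp_partial_le (hm : IsGainModel P lam X G) (hlam : 0 < lam)
    (hL : PhysicallyFeasible L) {s : ℝ} (hs : 0 ≤ s) (hsL : s * L 0 < 1) (n : ℕ) :
    ∫⁻ ω, ENNReal.ofReal (Real.exp (s * ∑ i ∈ Finset.range n, L ‖X (i + 1) ω‖ * G (i + 1) ω)) ∂P ≤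
      ENNReal.ofReal (Real.exp (Real.exp (s / (1 - s * L 0) * L 0) *
        (lam * (s / (1 - s * L 0) * (2 * Real.pi * pathGamma L))))) := by
  have hLm := hL.measurable
  set s' := s / (1 - s * L 0) with hs'
  have hs'0 : 0 ≤ s' := div_nonneg hs (by linarith)
  have h1 := lintegral_indepFun_eq hm.measurable_gains hm.measurable_locations hm.indep_locations
    (F := fun g x => ENNReal.ofReal (Real.exp (s * ∑ i ∈ Finset.range n, L ‖x (i + 1)‖ * g (i + 1))))
    (by unfold Function.uncurry; fun_prop)
  rw [h1]
  have h2 : ∀ ω', ∫⁻ ω, ENNReal.ofReal (Real.exp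
      (s * ∑ i ∈ Finset.range n, L ‖X (i + 1) ω'‖ * G (i + 1) ω)) ∂P ≤
      ENNReal.ofReal (Real.exp (∑ i ∈ Finset.range (n + 1),
        (Real.toNNReal (s' * L ‖X i ω'‖) : ℝ))) := by
    intro ω'
    have hb : ∀ i, s * L ‖X i ω'‖ ≤ s * L 0 := fun i =>
      mul_le_mul_of_nonneg_left (hL.le_zero _ (norm_nonneg _)) hs
    have h0 : ∀ i, 0 ≤ s * L ‖X i ω'‖ := fun i => mul_nonneg hs (hL.nonneg _ (norm_nonneg _))
    have h3 := hm.lintegral_exp_sum_gain n (fun i => s * L ‖X (i + 1) ω'‖)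
      (fun i => (hb _).trans_lt hsL)
    simp_rw [mul_assoc, ← Finset.mul_sum] at h3
    rw [h3]
    refine ENNReal.ofReal_le_ofReal ?_
    calc ∏ i ∈ Finset.range n, 1 / (1 - s * L ‖X (i + 1) ω'‖)
        ≤ ∏ i ∈ Finset.range n, Real.exp (s' * L ‖X (i + 1) ω'‖) := by
          refine Finset.prod_le_prod (fun i _ => one_div_nonneg.2 ?_) fun i _ => ?_
          · linarith [hb (i + 1)]
          · refine (one_div_one_sub_le_exp (h0 _) (hb _) hsL).trans_eq ?_
            rw [hs']; congr 1; ring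
      _ = Real.exp (∑ i ∈ Finset.range n, s' * L ‖X (i + 1) ω'‖) := (Real.exp_sum _ _).symm
      _ ≤ _ := by
          refine Real.exp_le_exp.2 ?_
          -- The Poisson bound runs over all points, the serving one included; adding its
          -- nonnegative term only enlarges the sum.
          rw [Finset.sum_range_succ']
          have h4 : ∀ i, (Real.toNNReal (s' * L ‖X i ω'‖) : ℝ) = s' * L ‖X i ω'‖ := fun i =>
            Real.coe_toNNReal _ (mul_nonneg hs'0 (hL.nonneg _ (norm_nonneg _)))
          simp_rw [h4]
          exact le_add_of_nonneg_right (mul_nonneg hs'0 (hL.nonneg _ (norm_nonneg _)))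
  refine (lintegral_mono h2).trans ?_
  refine hm.locations.poisson.lintegral_exp_sum_le (ψ := fun x => Real.toNNReal (s' * L ‖x‖))
    (by fun_prop) (fun x => ?_) ?_ (hL.lintegral_intensity hlam hs'0).le (n + 1)
  · rw [Real.coe_toNNReal _ (mul_nonneg hs'0 (hL.nonneg _ (norm_nonneg _)))]
    exact mul_le_mul_of_nonneg_left (hL.le_zero _ (norm_nonneg _)) hs'0
  · have := hL.gamma_pos
    positivity

/-- The interference as an extended nonnegative number. -/
def eInterference (L : ℝ → ℝ) (x : ℕ → Plane) (g : ℕ → ℝ) : ℝ≥0∞ :=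
  ∑' i, ENNReal.ofReal (L ‖x (i + 1)‖ * g (i + 1))

lemma toReal_eInterference (hL : PhysicallyFeasible L) (x : ℕ → Plane) {g : ℕ → ℝ}
    (hg : ∀ i, 0 ≤ g i) :
    (eInterference L x g).toReal = ∑' i, L ‖x (i + 1)‖ * g (i + 1) := by
  rw [eInterference, ENNReal.tsum_toReal_eq fun _ => ENNReal.ofReal_ne_top]
  exact tsum_congr fun i => ENNReal.toReal_ofReal
    (mul_nonneg (hL.nonneg _ (norm_nonneg _)) (hg _))

lemma measurable_eInterference (hL : PhysicallyFeasible L) :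
    Measurable fun p : (ℕ → ℝ) × (ℕ → Plane) => eInterference L p.2 p.1 := by
  have := hL.measurable
  exact Measurable.tsum fun i => by fun_prop

theorem IsGainModel.ae_eInterference_ne_top (hm : IsGainModel P lam X G) (hlam : 0 < lam)
    (hL : PhysicallyFeasible L) :
    ∀ᵐ ω ∂P, eInterference L (fun i => X i ω) (fun i => G i ω) ≠ ⊤ := by
  have hL0 := hL.zero_pos
  -- Any s with 0 < s · L 0 < 1 would do: y ≤ e^y turns the uniform exponential bound on partial
  -- sums into a finite mean.
  set s := 1 / (2 * L 0) with hs
  have hs0 : 0 < s := by positivity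
  have hsL : s * L 0 < 1 := by
    rw [hs]; field_simp; norm_num
  have hLm := hL.measurable
  have hG := hm.measurable
  have hX := hm.locations.poisson.measurable
  have h1 : ∫⁻ ω, ENNReal.ofReal s * eInterference L (fun i => X i ω) (fun i => G i ω) ∂P ≤
      ENNReal.ofReal (Real.exp (Real.exp (s / (1 - s * L 0) * L 0) *
        (lam * (s / (1 - s * L 0) * (2 * Real.pi * pathGamma L))))) := by
    simp_rw [eInterference, ← ENNReal.tsum_mul_left]
    rw [lintegral_tsum fun i => Measurable.aemeasurable (by fun_prop)]
    refine ENNReal.tsum_le_of_sum_range_le fun n => ?_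
    rw [← lintegral_finsetSum _ fun i _ => (by fun_prop)]
    refine (lintegral_mono fun ω => ?_).trans (hm.lintegral_exp_partial_le hlam hL hs0.le hsL n)
    have h0 : ∀ i, 0 ≤ L ‖X (i + 1) ω‖ * G (i + 1) ω := fun i =>
      mul_nonneg (hL.nonneg _ (norm_nonneg _)) (hm.nonneg _ _)
    rw [← Finset.mul_sum, ← ENNReal.ofReal_sum_of_nonneg fun i _ => h0 i, ← ENNReal.ofReal_mul hs0.le]
    exact ENNReal.ofReal_le_ofReal ((lt_add_one _).le.trans (Real.add_one_le_exp _))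
  have hmI : Measurable fun ω => eInterference L (fun i => X i ω) (fun i => G i ω) :=
    Measurable.tsum fun i => by fun_prop
  have h2 := ae_lt_top (hmI.const_mul (ENNReal.ofReal s)) (h1.trans_lt ENNReal.ofReal_lt_top).ne
  filter_upwards [h2] with ω hω htop
  rw [htop, ENNReal.mul_top (by simpa using hs0)] at hω
  exact lt_irrefl _ hω

lemma summable_of_eInterference_ne_top (hL : PhysicallyFeasible L) {x : ℕ → Plane} {g : ℕ → ℝ}
    (hg : ∀ i, 0 ≤ g i) (h : eInterference L x g ≠ ⊤) :
    Summable fun i => L ‖x (i + 1)‖ * g (i + 1) := by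
  have h1 := ENNReal.summable_toReal h
  refine h1.congr fun i => ?_
  rw [ENNReal.toReal_ofReal (mul_nonneg (hL.nonneg _ (norm_nonneg _)) (hg _))]

end

section

variable {Ω : Type*} [MeasurableSpace Ω] {P : Measure Ω} [IsProbabilityMeasure P]
  {lam : ℝ} {X : ℕ → Ω → Plane} {G : ℕ → Ω → ℝ} {L : ℝ → ℝ}

lemma IsGainModel.measurable_eInterference (hm : IsGainModel P lam X G)
    (hL : PhysicallyFeasible L) :
    Measurable fun ω => eInterference L (fun i => X i ω) (fun i => G i ω) := by
  have hLm := hL.measurable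
  have hG := hm.measurable
  have hX := hm.locations.poisson.measurable
  exact Measurable.tsum fun i => by fun_prop

lemma IsGainModel.measurable_interference (hm : IsGainModel P lam X G)
    (hL : PhysicallyFeasible L) :
    Measurable fun ω => ∑' i, L ‖X (i + 1) ω‖ * G (i + 1) ω := by
  have h1 := (hm.measurable_eInterference hL).ennreal_toReal
  simp_rw [fun ω => toReal_eInterference hL (fun i => X i ω) (g := fun i => G i ω)
    (fun i => hm.nonneg i ω)] at h1
  exact h1

lemma IsGainModel.ae_summable (hm : IsGainModel P lam X G) (hlam : 0 < lam)
    (hL : PhysicallyFeasible L) :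
    ∀ᵐ ω ∂P, Summable fun i => L ‖X (i + 1) ω‖ * G (i + 1) ω := by
  filter_upwards [hm.ae_eInterference_ne_top hlam hL] with ω hω
  have h1 := summable_of_eInterference_ne_top hL (x := fun i => X i ω) (g := fun i => G i ω)
    (fun i => hm.nonneg i ω) hω
  exact h1

theorem IsGainModel.lintegral_exp_interference_le (hm : IsGainModel P lam X G) (hlam : 0 < lam)
    (hL : PhysicallyFeasible L) {s : ℝ} (hs : 0 ≤ s) (hsL : s * L 0 < 1) :
    ∫⁻ ω, ENNReal.ofReal (Real.exp (s * ∑' i, L ‖X (i + 1) ω‖ * G (i + 1) ω)) ∂P ≤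
      ENNReal.ofReal (Real.exp (Real.exp (s / (1 - s * L 0) * L 0) *
        (lam * (s / (1 - s * L 0) * (2 * Real.pi * pathGamma L))))) := by
  have hLm := hL.measurable
  have hG := hm.measurable
  have hX := hm.locations.poisson.measurable
  refine le_of_tendsto' (lintegral_tendsto_of_tendsto_of_monotone
    (fun n => Measurable.aemeasurable (by fun_prop)) ?_ ?_)
    (fun n => hm.lintegral_exp_partial_le hlam hL hs hsL n)
  · refine ae_of_all _ fun ω n m hnm => ?_
    refine ENNReal.ofReal_le_ofReal (Real.exp_le_exp.2 (mul_le_mul_of_nonneg_left ?_ hs))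
    exact Finset.sum_le_sum_of_subset_of_nonneg (Finset.range_mono hnm) fun i _ _ =>
      mul_nonneg (hL.nonneg _ (norm_nonneg _)) (hm.nonneg _ _)
  · filter_upwards [hm.ae_summable hlam hL] with ω hω
    exact ENNReal.tendsto_ofReal ((Real.continuous_exp.tendsto _).comp
      (hω.hasSum.tendsto_sum_nat.const_mul s))

/-- The path losses themselves are summable over a Poisson point process. -/
lemma IsOrderedHPPP.ae_summable (hX : IsOrderedHPPP X lam P) (hlam : 0 < lam)
    (hL : PhysicallyFeasible L) : ∀ᵐ ω ∂P, Summable fun i => L ‖X i ω‖ := by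
  have hLm := hL.measurable
  have hXm := hX.poisson.measurable
  have hL0 : ∀ x : Plane, 0 ≤ L ‖x‖ := fun x => hL.nonneg _ (norm_nonneg _)
  have hg := hL.gamma_pos
  have hbd : ∫⁻ ω, ∑' i, ENNReal.ofReal (L ‖X i ω‖) ∂P ≤
      ENNReal.ofReal (Real.exp (Real.exp (1 * L 0) *
        (lam * (1 * (2 * Real.pi * pathGamma L))))) := by
    rw [lintegral_tsum fun i => Measurable.aemeasurable (by fun_prop)]
    refine ENNReal.tsum_le_of_sum_range_le fun n => ?_
    rw [← lintegral_finsetSum _ fun i _ => (by fun_prop)]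
    refine le_trans (lintegral_mono fun ω => ?_) (hX.poisson.lintegral_exp_sum_le
      (ψ := fun x => Real.toNNReal (1 * L ‖x‖)) (B := 1 * L 0) (by fun_prop) (fun x => ?_)
      (by positivity) (hL.lintegral_intensity hlam zero_le_one).le n)
    · have : ∀ i, (Real.toNNReal (1 * L ‖X i ω‖) : ℝ) = L ‖X i ω‖ := fun i => by
        rw [one_mul, Real.coe_toNNReal _ (hL0 _)]
      simp_rw [this]
      rw [← ENNReal.ofReal_sum_of_nonneg fun i _ => hL0 _]
      exact ENNReal.ofReal_le_ofReal ((lt_add_one _).le.trans (Real.add_one_le_exp _))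
    · rw [one_mul, Real.coe_toNNReal _ (hL0 _), one_mul]
      exact hL.le_zero _ (norm_nonneg _)
  have h2 := ae_lt_top (Measurable.tsum fun i => by fun_prop) (hbd.trans_lt ENNReal.ofReal_lt_top).ne
  filter_upwards [h2] with ω hω
  exact (ENNReal.summable_toReal hω.ne).congr fun i => ENNReal.toReal_ofReal (hL0 _)

/-- As in the upper bound, the gains are averaged before the locations. Now the serving point has
the wrong sign: completing the sum to all points costs its term, at most s' L 0 with s' = s/(1 + s L
0), which is the additive part of the exponent and does not grow with the density. -/
theorem IsGainModel.lintegral_exp_neg_interference_le (hm : IsGainModel P lam X G) (hlam : 0 < lam)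
    (hL : PhysicallyFeasible L) {s : ℝ} (hs : 0 ≤ s) :
    ∫⁻ ω, ENNReal.ofReal (Real.exp (-(s * ∑' i, L ‖X (i + 1) ω‖ * G (i + 1) ω))) ∂P ≤
      ENNReal.ofReal (Real.exp (s / (1 + s * L 0) * L 0 - Real.exp (-(s / (1 + s * L 0) * L 0)) *
        (lam * (s / (1 + s * L 0) * (2 * Real.pi * pathGamma L))))) := by
  have hLm := hL.measurable
  have hG := hm.measurable
  have hX := hm.locations.poisson.measurable
  have hpg := hL.gamma_pos
  have hL0 : ∀ x : Plane, 0 ≤ L ‖x‖ := fun x => hL.nonneg _ (norm_nonneg _)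
  set s' := s / (1 + s * L 0) with hs'
  have hsL0 : 0 ≤ s * L 0 := mul_nonneg hs hL.zero_pos.le
  have hs'0 : 0 ≤ s' := div_nonneg hs (by linarith)
  have h1 : ∀ n, ∫⁻ ω, ENNReal.ofReal (Real.exp (-(s * ∑' i, L ‖X (i + 1) ω‖ * G (i + 1) ω))) ∂P ≤
      ∫⁻ ω, ENNReal.ofReal (Real.exp (-(∑ i ∈ Finset.range n, s' * L ‖X (i + 1) ω‖))) ∂P := by
    intro n
    have h2 : ∫⁻ ω, ENNReal.ofReal (Real.exp (-(s * ∑' i, L ‖X (i + 1) ω‖ * G (i + 1) ω))) ∂P ≤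
        ∫⁻ ω, ENNReal.ofReal (Real.exp (-(s * ∑ i ∈ Finset.range n,
          L ‖X (i + 1) ω‖ * G (i + 1) ω))) ∂P := by
      refine lintegral_mono_ae ?_
      filter_upwards [hm.ae_summable hlam hL] with ω hω
      refine ENNReal.ofReal_le_ofReal (Real.exp_le_exp.2 (neg_le_neg
        (mul_le_mul_of_nonneg_left ?_ hs)))
      exact hω.sum_le_tsum _ fun i _ => mul_nonneg (hL0 _) (hm.nonneg _ _)
    refine h2.trans ?_
    rw [lintegral_indepFun_eq hm.measurable_gains hm.measurable_locations hm.indep_locations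
      (F := fun g x => ENNReal.ofReal (Real.exp
        (-(s * ∑ i ∈ Finset.range n, L ‖x (i + 1)‖ * g (i + 1)))))
      (by unfold Function.uncurry; fun_prop)]
    refine lintegral_mono fun ω' => ?_
    have h0 : ∀ i, 0 ≤ s * L ‖X i ω'‖ := fun i => mul_nonneg hs (hL0 _)
    have hb : ∀ i, s * L ‖X i ω'‖ ≤ s * L 0 := fun i =>
      mul_le_mul_of_nonneg_left (hL.le_zero _ (norm_nonneg _)) hs
    have h3 := hm.lintegral_exp_sum_gain n (fun i => -(s * L ‖X (i + 1) ω'‖))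
      (fun i => by linarith [h0 (i + 1)])
    simp_rw [neg_mul, mul_assoc, Finset.sum_neg_distrib, ← Finset.mul_sum, sub_neg_eq_add] at h3
    rw [h3]
    refine ENNReal.ofReal_le_ofReal ?_
    rw [← Finset.sum_neg_distrib, Real.exp_sum]
    refine Finset.prod_le_prod (fun i _ => one_div_nonneg.2 (by linarith [h0 (i + 1)])) fun i _ => ?_
    refine (one_div_one_add_le_exp (h0 _) (hb _)).trans_eq ?_
    rw [hs']; congr 1; ring
  have h4 : Tendsto (fun n => ∫⁻ ω, ENNReal.ofReal (Real.exp
      (-(∑ i ∈ Finset.range n, s' * L ‖X (i + 1) ω‖))) ∂P) atTop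
      (𝓝 (∫⁻ ω, ENNReal.ofReal (Real.exp (-(∑' i, s' * L ‖X (i + 1) ω‖))) ∂P)) := by
    refine tendsto_lintegral_of_dominated_convergence (fun _ => 1) (fun n => by fun_prop)
      (fun n => ae_of_all _ fun ω => ?_) (by simp) ?_
    · rw [← ENNReal.ofReal_one]
      refine ENNReal.ofReal_le_ofReal (Real.exp_le_one_iff.2 (neg_nonpos.2 ?_))
      exact Finset.sum_nonneg fun i _ => mul_nonneg hs'0 (hL0 _)
    · filter_upwards [hm.locations.ae_summable hlam hL] with ω hω
      have h5 : Summable fun i => s' * L ‖X (i + 1) ω‖ :=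
        ((summable_nat_add_iff 1).2 hω).mul_left s'
      exact ENNReal.tendsto_ofReal ((Real.continuous_exp.tendsto _).comp
        (h5.hasSum.tendsto_sum_nat.neg))
  refine (ge_of_tendsto' h4 h1).trans ?_
  have hψ : ∀ x : Plane, (Real.toNNReal (s' * L ‖x‖) : ℝ) = s' * L ‖x‖ := fun x =>
    Real.coe_toNNReal _ (mul_nonneg hs'0 (hL0 _))
  have h6 := hm.locations.poisson.lintegral_exp_neg_tsum_le
    (ψ := fun x => Real.toNNReal (s' * L ‖x‖)) (B := s' * L 0)
    (m := lam * (s' * (2 * Real.pi * pathGamma L))) (by fun_prop)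
    (fun x => by
      rw [hψ]
      exact mul_le_mul_of_nonneg_left (hL.le_zero _ (norm_nonneg _)) hs'0)
    (by positivity) (hL.lintegral_intensity hlam hs'0)
    (by
      filter_upwards [hm.locations.ae_summable hlam hL] with ω hω
      simp_rw [hψ]
      exact hω.mul_left s')
  simp_rw [hψ] at h6
  rw [sub_eq_add_neg, Real.exp_add, ENNReal.ofReal_mul (Real.exp_pos _).le]
  refine le_trans ?_ (mul_le_mul_right h6 _)
  rw [← lintegral_const_mul' _ _ ENNReal.ofReal_ne_top]
  refine lintegral_mono_ae ?_
  filter_upwards [hm.locations.ae_summable hlam hL] with ω hω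
  rw [← ENNReal.ofReal_mul (Real.exp_pos _).le, ← Real.exp_add]
  refine ENNReal.ofReal_le_ofReal (Real.exp_le_exp.2 ?_)
  rw [(hω.mul_left s').tsum_eq_zero_add]
  have := mul_le_mul_of_nonneg_left (hL.le_zero ‖X 0 ω‖ (norm_nonneg _)) hs'0
  linarith

lemma measure_ge_le_of_lintegral_exp {Y : Ω → ℝ} (hY : Measurable Y) {y K : ℝ}
    (h : ∫⁻ ω, ENNReal.ofReal (Real.exp (Y ω)) ∂P ≤ ENNReal.ofReal (Real.exp K)) :
    P {ω | y ≤ Y ω} ≤ ENNReal.ofReal (Real.exp (K - y)) := by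
  have h1 := meas_ge_le_lintegral_div (μ := P) (f := fun ω => ENNReal.ofReal (Real.exp (Y ω)))
    (by fun_prop) (ε := ENNReal.ofReal (Real.exp y)) (by simp [Real.exp_pos])
    ENNReal.ofReal_ne_top
  rw [Real.exp_sub, ENNReal.ofReal_div_of_pos (Real.exp_pos _)]
  refine le_trans (measure_mono fun ω hω => ?_) (h1.trans (ENNReal.div_le_div_right h _))
  exact ENNReal.ofReal_le_ofReal (Real.exp_le_exp.2 hω)

end

/-- The interference divided by the density concentrates exponentially fast at `2πγ`. -/
theorem exists_interference_concentration {L : ℝ → ℝ} (hL : PhysicallyFeasible L) {ε : ℝ}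
    (hε : 0 < ε) :
    ∃ C c : ℝ, 0 < C ∧ 0 < c ∧ ∀ {Ω : Type*} [MeasurableSpace Ω] {P : Measure Ω}
      [IsProbabilityMeasure P] {lam : ℝ} {X : ℕ → Ω → Plane} {G : ℕ → Ω → ℝ},
      0 < lam → IsGainModel P lam X G →
      P {ω | ε * lam ≤ |(∑' i, L ‖X (i + 1) ω‖ * G (i + 1) ω) - 2 * Real.pi * pathGamma L * lam|} ≤
        ENNReal.ofReal (C * Real.exp (-c * lam)) := by
  set κ := 2 * Real.pi * pathGamma L with hκ
  have hκ0 : 0 < κ := by have := hL.gamma_pos; positivity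
  have hL0 := hL.zero_pos
  -- The expression is the exponent of the upper Laplace bound divided by sλ, and it tends to κ as s
  -- → 0. Staying below κ + ε/2 leaves sλε/2 in the Chernoff bound at level κ + ε; `hlow` is the
  -- mirror image.
  have hup : ∃ s, 0 < s ∧ s * L 0 < 1 ∧
      Real.exp (s / (1 - s * L 0) * L 0) * (1 / (1 - s * L 0) * κ) < κ + ε / 2 := by
    have h1 : ContinuousAt (fun s => Real.exp (s / (1 - s * L 0) * L 0) *
        (1 / (1 - s * L 0) * κ)) 0 := by
      have : (1 : ℝ) - 0 * L 0 ≠ 0 := by simp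
      fun_prop (disch := assumption)
    have h2 : ∀ᶠ s in 𝓝 (0 : ℝ), Real.exp (s / (1 - s * L 0) * L 0) *
        (1 / (1 - s * L 0) * κ) < κ + ε / 2 :=
      h1.eventually_lt_const (by simp; linarith)
    have h3 : ∀ᶠ s in 𝓝 (0 : ℝ), s * L 0 < 1 :=
      (show ContinuousAt (fun s : ℝ => s * L 0) 0 by fun_prop).eventually_lt_const (by simp)
    obtain ⟨s, ⟨hs2, hs3⟩, hs1⟩ := (((h2.and h3).filter_mono nhdsWithin_le_nhds).and
      (self_mem_nhdsWithin (a := (0 : ℝ)) (s := Set.Ioi 0))).exists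
    exact ⟨s, hs1, hs3, hs2⟩
  have hlow : ∃ s, 0 < s ∧
      κ - ε / 2 < Real.exp (-(s / (1 + s * L 0) * L 0)) * (1 / (1 + s * L 0) * κ) := by
    have h1 : ContinuousAt (fun s => Real.exp (-(s / (1 + s * L 0) * L 0)) *
        (1 / (1 + s * L 0) * κ)) 0 := by
      have : (1 : ℝ) + 0 * L 0 ≠ 0 := by simp
      fun_prop (disch := assumption)
    have h2 : ∀ᶠ s in 𝓝 (0 : ℝ), κ - ε / 2 < Real.exp (-(s / (1 + s * L 0) * L 0)) *
        (1 / (1 + s * L 0) * κ) :=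
      h1.eventually_const_lt (by simp; linarith)
    obtain ⟨s, hs2, hs1⟩ := ((h2.filter_mono nhdsWithin_le_nhds).and
      (self_mem_nhdsWithin (a := (0 : ℝ)) (s := Set.Ioi 0))).exists
    exact ⟨s, hs1, hs2⟩
  obtain ⟨s, hs0, hsL, hs⟩ := hup
  obtain ⟨t, ht0, ht⟩ := hlow
  have htL : 0 < t * L 0 := by positivity
  -- One for the upper tail, plus the price of the serving point for the lower tail.
  refine ⟨1 + Real.exp (t / (1 + t * L 0) * L 0), min (s * (ε / 2)) (t * (ε / 2)), by positivity,
    by positivity, ?_⟩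
  intro Ω _ P _ lam X G hlam hm
  have hI := hm.measurable_interference hL
  have hU : P {ω | s * ((κ + ε) * lam) ≤ s * ∑' i, L ‖X (i + 1) ω‖ * G (i + 1) ω} ≤
      ENNReal.ofReal (Real.exp (-min (s * (ε / 2)) (t * (ε / 2)) * lam)) := by
    refine (measure_ge_le_of_lintegral_exp (hI.const_mul s)
      (hm.lintegral_exp_interference_le hlam hL hs0.le hsL)).trans
      (ENNReal.ofReal_le_ofReal (Real.exp_le_exp.2 ?_))
    rw [← hκ]
    have e : Real.exp (s / (1 - s * L 0) * L 0) * (lam * (s / (1 - s * L 0) * κ)) =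
        (Real.exp (s / (1 - s * L 0) * L 0) * (1 / (1 - s * L 0) * κ)) * (s * lam) := by ring
    have h1 := mul_lt_mul_of_pos_right hs (show 0 < s * lam by positivity)
    have h2 := mul_le_mul_of_nonneg_right (min_le_left (s * (ε / 2)) (t * (ε / 2))) hlam.le
    rw [e]
    linarith
  have hD : P {ω | -(t * ((κ - ε) * lam)) ≤ -(t * ∑' i, L ‖X (i + 1) ω‖ * G (i + 1) ω)} ≤
      ENNReal.ofReal (Real.exp (t / (1 + t * L 0) * L 0) *
        Real.exp (-min (s * (ε / 2)) (t * (ε / 2)) * lam)) := by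
    rw [← Real.exp_add]
    refine (measure_ge_le_of_lintegral_exp (hI.const_mul t).neg
      (hm.lintegral_exp_neg_interference_le hlam hL ht0.le)).trans
      (ENNReal.ofReal_le_ofReal (Real.exp_le_exp.2 ?_))
    rw [← hκ]
    have e : Real.exp (-(t / (1 + t * L 0) * L 0)) * (lam * (t / (1 + t * L 0) * κ)) =
        (Real.exp (-(t / (1 + t * L 0) * L 0)) * (1 / (1 + t * L 0) * κ)) * (t * lam) := by ring
    have h1 := mul_lt_mul_of_pos_right ht (show 0 < t * lam by positivity)
    have h2 := mul_le_mul_of_nonneg_right (min_le_right (s * (ε / 2)) (t * (ε / 2))) hlam.le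
    rw [e]
    linarith
  rw [add_mul, one_mul, ENNReal.ofReal_add (Real.exp_pos _).le (by positivity)]
  refine le_trans (measure_mono fun ω hω => ?_) ((measure_union_le _ _).trans (add_le_add hU hD))
  simp only [Set.mem_ofPred_eq, Set.mem_union] at hω ⊢
  rcases le_abs.1 hω with h | h
  · exact Or.inl (mul_le_mul_of_nonneg_left (by linarith) hs0.le)
  · exact Or.inr (neg_le_neg (mul_le_mul_of_nonneg_left (by linarith) ht0.le))

/-! ### Moments of the gamma law -/

/-- Negative exponents are allowed: n = 3 with p = −2 is the inverse second moment needed for the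
interference. -/
lemma integral_rpow_gammaMeasure {n : ℕ} (hn : 0 < n) {p : ℝ} (hp : 0 < n + p) :
    ∫ x, x ^ p ∂(gammaMeasure n 1) = Real.Gamma (n + p) / Real.Gamma n := by
  have hn' : (0 : ℝ) < n := by exact_mod_cast hn
  rw [gammaMeasure, integral_withDensity_eq_integral_toReal_smul]
  · have h1 : ∀ x : ℝ, x ≠ 0 → (gammaPDF n 1 x).toReal • x ^ p =
        (Set.Ioi (0 : ℝ)).indicator (fun x => (Real.Gamma n)⁻¹ *
          (x ^ ((n + p : ℝ) - 1) * Real.exp (-(1 * x)))) x := by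
      intro x hx0
      rw [gammaPDF, ENNReal.toReal_ofReal (gammaPDFReal_nonneg hn' one_pos x), gammaPDFReal,
        Set.indicator_apply]
      simp only [Set.mem_Ioi]
      rcases lt_or_gt_of_ne hx0 with hx | hx
      · rw [if_neg (not_le.2 hx), if_neg (not_lt.2 hx.le), zero_smul]
      · rw [if_pos hx.le, if_pos hx, show (n + p : ℝ) - 1 = (n - 1) + p by ring, Real.rpow_add hx]
        simp only [Real.one_rpow, smul_eq_mul]
        ring
    have h2 : (fun x : ℝ => (gammaPDF n 1 x).toReal • x ^ p) =ᵐ[volume]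
        (Set.Ioi (0 : ℝ)).indicator (fun x => (Real.Gamma n)⁻¹ *
          (x ^ ((n + p : ℝ) - 1) * Real.exp (-(1 * x)))) := by
      have : ∀ᵐ x : ℝ, x ≠ 0 := compl_mem_ae_iff.2 (measure_singleton 0)
      filter_upwards [this] with x hx using h1 x hx
    rw [integral_congr_ae h2, integral_indicator measurableSet_Ioi, integral_const_mul,
      Real.integral_rpow_mul_exp_neg_mul_Ioi hp one_pos]
    simp only [div_one, Real.one_rpow, one_mul]
    rw [inv_mul_eq_div]
  · exact (measurable_gammaPDFReal n 1).ennreal_ofReal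
  · exact ae_of_all _ fun x => ENNReal.ofReal_lt_top

lemma integrable_rpow_gammaMeasure {n : ℕ} (hn : 0 < n) {p : ℝ} (hp : 0 < n + p) :
    Integrable (fun x : ℝ => x ^ p) (gammaMeasure n 1) := by
  have hn' : (0 : ℝ) < n := by exact_mod_cast hn
  by_contra hc
  have h1 := integral_rpow_gammaMeasure hn hp
  rw [integral_undef hc] at h1
  have h2 := div_pos (Real.Gamma_pos_of_pos hp) (Real.Gamma_pos_of_pos hn')
  exact h2.ne h1

lemma integral_id_gammaMeasure {n : ℕ} (hn : 0 < n) : ∫ x, x ∂(gammaMeasure n 1) = n := by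
  have hn' : (0 : ℝ) < n := by exact_mod_cast hn
  have h := integral_rpow_gammaMeasure hn (p := 1) (by positivity)
  simp_rw [Real.rpow_one] at h
  rw [h, Real.Gamma_add_one hn'.ne', mul_div_cancel_right₀ _ (Real.Gamma_pos_of_pos hn').ne']

lemma integrable_id_gammaMeasure {n : ℕ} (hn : 0 < n) :
    Integrable (fun x : ℝ => x) (gammaMeasure n 1) := by
  have hn' : (0 : ℝ) < n := by exact_mod_cast hn
  simpa using integrable_rpow_gammaMeasure hn (p := 1) (by positivity)

lemma integral_sq_gammaMeasure {n : ℕ} (hn : 0 < n) :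
    ∫ x, x ^ 2 ∂(gammaMeasure n 1) = (n + 1) * n := by
  have hn' : (0 : ℝ) < n := by exact_mod_cast hn
  have h := integral_rpow_gammaMeasure hn (p := 2) (by positivity)
  simp_rw [Real.rpow_two] at h
  rw [h, show (n + 2 : ℝ) = (n + 1) + 1 by ring, Real.Gamma_add_one (by positivity),
    Real.Gamma_add_one hn'.ne', ← mul_assoc, mul_div_cancel_right₀ _ (Real.Gamma_pos_of_pos hn').ne']

lemma integrable_sq_gammaMeasure {n : ℕ} (hn : 0 < n) :
    Integrable (fun x : ℝ => x ^ 2) (gammaMeasure n 1) := by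
  have hn' : (0 : ℝ) < n := by exact_mod_cast hn
  simpa using integrable_rpow_gammaMeasure hn (p := 2) (by positivity)

/-! ### Borel–Cantelli and the strong law -/

section

variable {Ω : Type*} [MeasurableSpace Ω] {P : Measure Ω}

lemma ae_tendsto_of_measure_le_exp {Y : ℕ → Ω → ℝ} {y : ℝ}
    (h : ∀ ε > 0, ∃ C c : ℝ, 0 < c ∧
      ∀ k, P {ω | ε ≤ |Y k ω - y|} ≤ ENNReal.ofReal (C * Real.exp (-c * k))) :
    ∀ᵐ ω ∂P, Tendsto (fun k => Y k ω) atTop (𝓝 y) := by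
  have h1 : ∀ m : ℕ, ∀ᵐ ω ∂P, ∀ᶠ k in atTop, |Y k ω - y| < 1 / ((m : ℝ) + 1) := by
    intro m
    obtain ⟨C, c, hc, hP⟩ := h (1 / ((m : ℝ) + 1)) (by positivity)
    have hs : Summable fun k : ℕ => C * Real.exp (-c * k) := by
      refine Summable.mul_left C ?_
      have := Real.summable_exp_nat_mul_of_ge (c := -c) (by linarith) (f := fun i : ℕ => (i : ℝ))
        fun i => le_rfl
      exact this
    have h2 : ∑' k, P {ω | 1 / ((m : ℝ) + 1) ≤ |Y k ω - y|} ≠ ⊤ :=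
      ((ENNReal.tsum_le_tsum hP).trans_lt hs.tsum_ofReal_lt_top).ne
    have h3 := ae_eventually_notMem h2
    filter_upwards [h3] with ω hω
    exact hω.mono fun k hk => not_le.1 hk
  filter_upwards [ae_all_iff.2 h1] with ω hω
  rw [Metric.tendsto_atTop']
  intro ε hε
  obtain ⟨m, hm⟩ := exists_nat_one_div_lt hε
  obtain ⟨K, hK⟩ := eventually_atTop.1 (hω m)
  exact ⟨K, fun k hk => (hK k hk.le).trans hm⟩

/-- The sequence `a` is known only through the networks. For any two indices, a density with enough
antennas identifies both terms with channel coefficients, so the terms are identically distributed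
and pairwise independent, which is all that the strong law requires. -/
theorem ae_tendsto_average_normSq [IsProbabilityMeasure P] {N : ℝ → ℕ}
    (hNlim : Tendsto N atTop atTop)
    {X : ℝ → ℕ → Ω → Plane} {h : (lam : ℝ) → ℕ → Ω → Fin (N lam) → ℂ}
    (hnet : ∀ lam, 0 < lam → IsSIMONetwork P lam (X lam) (h lam)) {a : ℕ → Ω → ℂ}
    (ha : ∀ᵐ ω ∂P, ∀ lam, 0 < lam → ∀ k : Fin (N lam), h lam 0 ω k = a k ω) :
    ∀ᵐ ω ∂P, Tendsto (fun n : ℕ => (∑ k ∈ Finset.range n, ‖a k ω‖ ^ 2) / n) atTop (𝓝 1) := by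
  have hex : ∀ k : ℕ, ∃ lam, 0 < lam ∧ k < N lam := fun k =>
    ((eventually_gt_atTop 0).and (hNlim.eventually_gt_atTop k)).exists
  have hae : ∀ lam, 0 < lam → ∀ k (hk : k < N lam),
      (fun ω => h lam 0 ω ⟨k, hk⟩) =ᵐ[P] a k := fun lam hlam k hk => by
    filter_upwards [ha] with ω hω using hω lam hlam ⟨k, hk⟩
  have hlaw : ∀ k, HasLaw (fun ω => ‖a k ω‖ ^ 2) (expMeasure 1) P := by
    intro k
    obtain ⟨lam, hlam, hk⟩ := hex k
    exact hasLaw_normSq_exp (((hnet lam hlam).fading_law 0 ⟨k, hk⟩).congr (hae lam hlam k hk).symm)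
  have hexp : expMeasure 1 = gammaMeasure (1 : ℕ) 1 := by rw [Nat.cast_one]; rfl
  have hint : Integrable (fun ω => ‖a 0 ω‖ ^ 2) P := by
    have := integrable_id_gammaMeasure one_pos
    rw [← hexp, ← (hlaw 0).map_eq] at this
    exact this.comp_aemeasurable (hlaw 0).aemeasurable
  have hmean : ∫ ω, ‖a 0 ω‖ ^ 2 ∂P = 1 := by
    rw [(hlaw 0).integral_eq, hexp, integral_id_gammaMeasure one_pos, Nat.cast_one]
  have h1 := strong_law_ae_real (fun k ω => ‖a k ω‖ ^ 2) hint (fun j k hjk => by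
      obtain ⟨lam, hlam, hk⟩ := hex (max j k)
      have hj' : j < N lam := (le_max_left _ _).trans_lt hk
      have hk' : k < N lam := (le_max_right _ _).trans_lt hk
      have h2 := (hnet lam hlam).fading_indep.indepFun
        (i := (0, ⟨j, hj'⟩)) (j := (0, ⟨k, hk'⟩)) (by simpa using hjk)
      exact (h2.congr (hae lam hlam j hj') (hae lam hlam k hk')).comp
        (φ := fun z : ℂ => ‖z‖ ^ 2) (ψ := fun z : ℂ => ‖z‖ ^ 2) (by fun_prop) (by fun_prop))
    (fun k => ⟨(hlaw k).aemeasurable, (hlaw 0).aemeasurable,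
      (hlaw k).map_eq.trans (hlaw 0).map_eq.symm⟩)
  simpa only [hmean] using h1

end

/-! ### The pathwise limit -/

lemma tendsto_ratio_of_components {ι : Type*} {l : Filter ι} {lam n ell gt I : ι → ℝ}
    {L₀ κ σ2 : ℝ} (hκ : κ ≠ 0) (hlam : Tendsto lam l atTop) (hn : Tendsto n l atTop)
    (hell : Tendsto ell l (𝓝 L₀)) (hgt : Tendsto (fun i => gt i / n i) l (𝓝 1))
    (hI : Tendsto (fun i => I i / lam i) l (𝓝 κ)) :
    Tendsto (fun i => lam i / n i * (ell i * gt i / (I i + σ2))) l (𝓝 (L₀ / κ)) := by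
  have h1 : Tendsto (fun i => σ2 / lam i) l (𝓝 0) := tendsto_const_nhds.div_atTop hlam
  have h2 := (hell.mul hgt).div (hI.add h1) (by simpa using hκ)
  rw [mul_one, add_zero] at h2
  refine h2.congr' ?_
  filter_upwards [hlam.eventually_gt_atTop 0, hn.eventually_gt_atTop 0] with i h3 h4
  simp only [Pi.div_apply]
  rw [← add_div]
  by_cases h0 : I i + σ2 = 0
  · simp [h0]
  · field_simp

/-- Monotonicity traps f(x) between f(⌊x⌋) and f(⌊x⌋ + 1), and ⌊x⌋/x and (⌊x⌋ + 1)/x tend to 1. -/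
lemma tendsto_div_of_monotoneOn_of_tendsto_nat {f : ℝ → ℝ} (hf : MonotoneOn f (Set.Ioi 0)) {κ : ℝ}
    (h : Tendsto (fun k : ℕ => f ((k : ℝ) + 1) / ((k : ℝ) + 1)) atTop (𝓝 κ)) :
    Tendsto (fun x => f x / x) atTop (𝓝 κ) := by
  have h1 : Tendsto (fun x : ℝ => ((⌊x⌋₊ : ℝ)) / x) atTop (𝓝 1) := tendsto_nat_floor_div_atTop
  have h2 : Tendsto (fun x : ℝ => ((⌊x⌋₊ : ℝ) + 1) / x) atTop (𝓝 1) := by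
    have := h1.add (tendsto_const_nhds.div_atTop (f := fun _ : ℝ => (1 : ℝ)) tendsto_id)
    rw [add_zero] at this
    refine this.congr fun x => ?_
    simp [add_div]
  have hfl : Tendsto (fun x : ℝ => ⌊x⌋₊) atTop atTop := tendsto_nat_floor_atTop
  have hup := (h.comp hfl).mul h2
  have h' : Tendsto (fun k : ℕ => f (k : ℝ) / (k : ℝ)) atTop (𝓝 κ) := by
    rw [← tendsto_add_atTop_iff_nat 1]
    simpa using h
  have hlo := (h'.comp hfl).mul h1
  rw [mul_one] at hup hlo
  refine tendsto_of_tendsto_of_tendsto_of_le_of_le' hlo hup ?_ ?_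
  · filter_upwards [eventually_ge_atTop 1] with x hx
    have hk : 0 < (⌊x⌋₊ : ℝ) := by exact_mod_cast Nat.floor_pos.2 hx
    have hx0 : 0 < x := by linarith
    have h3 : f ⌊x⌋₊ ≤ f x := hf hk hx0 (Nat.floor_le hx0.le)
    simp only [Function.comp]
    rw [div_mul_div_cancel₀ hk.ne']
    gcongr
  · filter_upwards [eventually_ge_atTop 1] with x hx
    have hx0 : 0 < x := by linarith
    have hk : 0 < (⌊x⌋₊ : ℝ) + 1 := by positivity
    have h3 : f x ≤ f (⌊x⌋₊ + 1) := hf hx0 hk (Nat.lt_floor_add_one x).le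
    simp only [Function.comp]
    rw [div_mul_div_cancel₀ hk.ne']
    gcongr

section

variable {Ω : Type*} [MeasurableSpace Ω] {P : Measure Ω} [IsProbabilityMeasure P] {L : ℝ → ℝ}

theorem ae_tendsto_interference_div (hL : PhysicallyFeasible L) {d : ℕ → ℝ} {δ : ℝ} (hδ : 0 < δ)
    (hd : ∀ k : ℕ, δ * (k + 1) ≤ d k) {X : ℕ → ℕ → Ω → Plane} {G : ℕ → ℕ → Ω → ℝ}
    (hm : ∀ k, IsGainModel P (d k) (X k) (G k)) :
    ∀ᵐ ω ∂P, Tendsto (fun k => (∑' i, L ‖X k (i + 1) ω‖ * G k (i + 1) ω) / d k) atTop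
      (𝓝 (2 * Real.pi * pathGamma L)) := by
  refine ae_tendsto_of_measure_le_exp fun ε hε => ?_
  obtain ⟨C, c, hC, hc, H⟩ := exists_interference_concentration hL hε
  refine ⟨C, c * δ, by positivity, fun k => ?_⟩
  have hd0 : 0 < d k := lt_of_lt_of_le (by positivity) (hd k)
  refine le_trans (measure_mono fun ω hω => ?_) ((H hd0 (hm k)).trans
    (ENNReal.ofReal_le_ofReal ?_))
  · simp only [Set.mem_ofPred_eq] at hω ⊢
    rw [div_sub' hd0.ne', abs_div, abs_of_pos hd0, le_div_iff₀ hd0] at hω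
    rwa [mul_comm (2 * Real.pi * pathGamma L)]
  · have h1 : c * (δ * (k + 1)) ≤ c * d k := mul_le_mul_of_nonneg_left (hd k) hc.le
    have h2 : 0 < c * δ := by positivity
    refine mul_le_mul_of_nonneg_left (Real.exp_le_exp.2 ?_) hC.le
    linarith

theorem ae_tendsto_nearest {d : ℕ → ℝ} (hδ : ∃ δ > 0, ∀ k : ℕ, δ * (k + 1) ≤ d k) {X : ℕ → ℕ → Ω → Plane}
    (hX : ∀ k, IsOrderedHPPP (X k) (d k) P) :
    ∀ᵐ ω ∂P, Tendsto (fun k => ‖X k 0 ω‖) atTop (𝓝 0) := by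
  obtain ⟨δ, hδ, hd⟩ := hδ
  refine ae_tendsto_of_measure_le_exp fun ε hε => ?_
  have hπ := Real.pi_pos
  -- The radius ε/2 absorbs the difference between the event ε ≤ ‖X‖ here and the strict inequality
  -- in `measure_norm_gt`.
  refine ⟨Real.exp 3, δ * (Real.pi * (ε / 2) ^ 2) / 2, by positivity, fun k => ?_⟩
  have hd0 : 0 < d k := lt_of_lt_of_le (by positivity) (hd k)
  refine le_trans (measure_mono fun ω hω => ?_) (((hX k).measure_norm_gt hd0
    (ε := ε / 2) (by positivity)).trans (ENNReal.ofReal_le_ofReal ?_))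
  · simp only [Set.mem_ofPred_eq, sub_zero, abs_norm] at hω ⊢
    linarith
  · rw [← Real.exp_add]
    refine Real.exp_le_exp.2 ?_
    have h1 : δ * k ≤ d k := by linarith [hd k]
    have h2 := mul_le_mul_of_nonneg_right h1 (show 0 ≤ Real.pi * (ε / 2) ^ 2 by positivity)
    linarith

end

/-! ### From convergence of the components to almost sure scaling laws -/

lemma tendsto_pathLoss {ι : Type*} {l : Filter ι} {L : ℝ → ℝ}
    (hL0 : ContinuousWithinAt L (Set.Ici 0) 0) {r : ι → ℝ} (hr0 : ∀ i, 0 ≤ r i)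
    (hr : Tendsto r l (𝓝 0)) : Tendsto (fun i => L (r i)) l (𝓝 (L 0)) :=
  hL0.tendsto.comp (tendsto_nhdsWithin_iff.2 ⟨hr, Eventually.of_forall hr0⟩)

lemma simoSINR_nonneg {n : ℕ} {L : ℝ → ℝ} (hL : PhysicallyFeasible L) {σ2 : ℝ} (hσ2 : 0 ≤ σ2)
    (x : ℕ → Plane) (h : ℕ → Fin n → ℂ) : 0 ≤ simoSINR L σ2 x h := by
  rw [simoSINR_eq]
  refine div_nonneg (mul_nonneg (hL.nonneg _ (norm_nonneg _)) (mrcGain_nonneg _ _))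
    (add_nonneg (tsum_nonneg fun i => ?_) hσ2)
  exact mul_nonneg (hL.nonneg _ (norm_nonneg _)) (mrcGain_nonneg _ _)

lemma mrcGain_zero_eq_sum_range {n : ℕ} {h : ℕ → Fin n → ℂ} {a : ℕ → ℂ}
    (ha : ∀ k : Fin n, h 0 k = a k) : mrcGain h 0 = ∑ k ∈ Finset.range n, ‖a k‖ ^ 2 := by
  rw [mrcGain_zero, ← Fin.sum_univ_eq_sum_range (fun k => ‖a k‖ ^ 2) n]
  exact Finset.sum_congr rfl fun k _ => by rw [ha]

/-- Pathwise scaling laws from the convergence of path loss, diversity gain and interference. -/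
theorem scaling_of_components {ι : Type*} {l : Filter ι} {L : ℝ → ℝ} (hL : PhysicallyFeasible L)
    (hL0 : ContinuousWithinAt L (Set.Ici 0) 0) {σ2 : ℝ} (hσ2 : 0 ≤ σ2) {N : ι → ℕ} {lam : ι → ℝ}
    (hlam : Tendsto lam l atTop) (hN : Tendsto N l atTop) {x : ι → ℕ → Plane}
    {h : (i : ι) → ℕ → Fin (N i) → ℂ} {a : ℕ → ℂ} (hr : Tendsto (fun i => ‖x i 0‖) l (𝓝 0))
    (ha : ∀ᶠ i in l, ∀ k : Fin (N i), h i 0 k = a k)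
    (havg : Tendsto (fun n : ℕ => (∑ k ∈ Finset.range n, ‖a k‖ ^ 2) / n) atTop (𝓝 1))
    (hI : Tendsto (fun i => interference L (x i) (h i) / lam i) l
      (𝓝 (2 * Real.pi * pathGamma L))) :
    SINRScaling (L 0 / (2 * Real.pi * pathGamma L)) l lam (fun i => (N i : ℝ))
      (fun i => simoSINR L σ2 (x i) (h i)) ∧
    ASEScaling (L 0 / (2 * Real.pi * pathGamma L)) l lam (fun i => (N i : ℝ))
      (fun i => ase (lam i) (simoSINR L σ2 (x i) (h i))) := by
  have hκ : 0 < 2 * Real.pi * pathGamma L := by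
    have := hL.gamma_pos
    positivity
  have ha0 : 0 < L 0 / (2 * Real.pi * pathGamma L) := div_pos hL.zero_pos hκ
  have hN' : Tendsto (fun i => (N i : ℝ)) l atTop := tendsto_natCast_atTop_atTop.comp hN
  have hgt : Tendsto (fun i => mrcGain (h i) 0 / (N i : ℝ)) l (𝓝 1) := by
    refine (havg.comp hN).congr' ?_
    filter_upwards [ha] with i hi
    rw [mrcGain_zero_eq_sum_range hi]
    rfl
  have hratio := tendsto_ratio_of_components (σ2 := σ2) hκ.ne' hlam hN'
    (tendsto_pathLoss hL0 (fun i => norm_nonneg (x i 0)) hr) hgt hI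
  simp_rw [← simoSINR_eq] at hratio
  exact ⟨sinrScaling_of_ratio ha0 hlam hN' hratio,
    aseScaling_of_ratio ha0 (Eventually.of_forall fun i => simoSINR_nonneg hL hσ2 _ _) hlam hN'
      hratio⟩

/-- Since φ sends interferers to interferers, i ↦ φ(i + 1) − 1 is injective on the shifted indices
and the sparser series is a subfamily of the denser one. Summability of the latter is required, as a
divergent `tsum` would be 0. -/
lemma summable_and_interference_le_of_injective {n n' : ℕ} {L : ℝ → ℝ} (hL : PhysicallyFeasible L)
    {x x' : ℕ → Plane} {h : ℕ → Fin n → ℂ} {h' : ℕ → Fin n' → ℂ} {φ : ℕ → ℕ}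
    (hφ : Function.Injective φ) (hx : ∀ i, x' (φ i) = x i)
    (hg : ∀ i, i ≠ 0 → φ i ≠ 0 ∧ mrcGain h' (φ i) = mrcGain h i)
    (hs : Summable fun i => L ‖x' (i + 1)‖ * mrcGain h' (i + 1)) :
    (Summable fun i => L ‖x (i + 1)‖ * mrcGain h (i + 1)) ∧
      interference L x h ≤ interference L x' h' := by
  have hψ : Function.Injective fun i => φ (i + 1) - 1 := fun i j hij => by
    have h1 := (hg (i + 1) (Nat.succ_ne_zero i)).1
    have h2 := (hg (j + 1) (Nat.succ_ne_zero j)).1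
    have h3 : φ (i + 1) = φ (j + 1) := by
      simp only at hij
      omega
    exact Nat.succ_injective (hφ h3)
  have e : (fun i => L ‖x (i + 1)‖ * mrcGain h (i + 1)) =
      (fun i => L ‖x' (i + 1)‖ * mrcGain h' (i + 1)) ∘ fun i => φ (i + 1) - 1 := by
    ext i
    have h1 := hg (i + 1) (Nat.succ_ne_zero i)
    simp only [Function.comp]
    rw [Nat.sub_add_cancel (Nat.one_le_iff_ne_zero.2 h1.1), h1.2, hx]
  have hs2 : Summable fun i => L ‖x (i + 1)‖ * mrcGain h (i + 1) := by
    rw [e]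
    exact hs.comp_injective hψ
  refine ⟨hs2, ?_⟩
  rw [interference, e]
  exact tsum_comp_le_tsum_of_inj hs
    (fun i => mul_nonneg (hL.nonneg _ (norm_nonneg _)) (mrcGain_nonneg _ _)) hψ

section

variable {Ω : Type*} [MeasurableSpace Ω] {P : Measure Ω} [IsProbabilityMeasure P] {L : ℝ → ℝ}
  {σ2 : ℝ} {N : ℝ → ℕ} {X : ℝ → ℕ → Ω → Plane} {h : (lam : ℝ) → ℕ → Ω → Fin (N lam) → ℂ}

theorem sinr_form (hL : PhysicallyFeasible L) {lam : ℝ} (hlam : 0 < lam) {n : ℕ} (hn : 1 ≤ n)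
    {X : ℕ → Ω → Plane} {h : ℕ → Ω → Fin n → ℂ} (hnet : IsSIMONetwork P lam X h) (σ2 : ℝ) :
    (∀ ω, mrcGain (fun i => h i ω) 0 = ∑ k, ‖h 0 ω k‖ ^ 2) ∧
    (∀ ω, simoSINR L σ2 (fun i => X i ω) (fun i => h i ω) =
      L ‖X 0 ω‖ * mrcGain (fun i => h i ω) 0 /
        ((∑' i, L ‖X (i + 1) ω‖ * mrcGain (fun j => h j ω) (i + 1)) + σ2)) ∧
    (∀ᵐ ω ∂P, Summable fun i => L ‖X (i + 1) ω‖ * mrcGain (fun j => h j ω) (i + 1)) ∧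
    HasLaw (fun ω => mrcGain (fun i => h i ω) 0) (gammaMeasure n 1) P ∧
    (∀ i, HasLaw (fun ω => mrcGain (fun j => h j ω) (i + 1)) (expMeasure 1) P) ∧
    iIndepFun (fun i ω => mrcGain (fun j => h j ω) i) P ∧
    IndepFun (fun ω i => mrcGain (fun j => h j ω) i) (fun ω i => X i ω) P := by
  have hm := hnet.isGainModel hn
  refine ⟨fun ω => mrcGain_zero _, fun ω => ?_, hm.ae_summable hlam hL, hnet.hasLaw_gain_zero hn,
    hm.law, hm.indep, hm.indep_locations⟩
  rw [simoSINR_eq, interference]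

theorem ae_scaling_of_sequence (hL : PhysicallyFeasible L)
    (hL0 : ContinuousWithinAt L (Set.Ici 0) 0) (hσ2 : 0 ≤ σ2)
    (hN1 : ∀ lam, 0 < lam → 1 ≤ N lam) (hNlim : Tendsto N atTop atTop)
    (hnet : ∀ lam, 0 < lam → IsSIMONetwork P lam (X lam) (h lam)) {a : ℕ → Ω → ℂ}
    (ha : ∀ᵐ ω ∂P, ∀ lam, 0 < lam → ∀ k : Fin (N lam), h lam 0 ω k = a k ω)
    {d : ℕ → ℝ} (hd : ∃ δ : ℝ, 0 < δ ∧ ∀ k : ℕ, δ * (k + 1) ≤ d k) :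
    ∀ᵐ ω ∂P,
      SINRScaling (L 0 / (2 * Real.pi * pathGamma L)) atTop d (fun k => (N (d k) : ℝ))
        (fun k => simoSINR L σ2 (fun i => X (d k) i ω) (fun i => h (d k) i ω)) ∧
      ASEScaling (L 0 / (2 * Real.pi * pathGamma L)) atTop d (fun k => (N (d k) : ℝ))
        (fun k => ase (d k) (simoSINR L σ2 (fun i => X (d k) i ω) (fun i => h (d k) i ω))) := by
  obtain ⟨δ, hδ, hdk⟩ := hd
  have hd0 : ∀ k, 0 < d k := fun k => lt_of_lt_of_le (by positivity) (hdk k)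
  have hdlim : Tendsto d atTop atTop := tendsto_atTop_mono hdk
    ((tendsto_atTop_add_const_right _ _ tendsto_natCast_atTop_atTop).const_mul_atTop hδ)
  filter_upwards [ae_tendsto_average_normSq hNlim hnet ha, ha,
    ae_tendsto_nearest ⟨δ, hδ, hdk⟩ (fun k => (hnet (d k) (hd0 k)).locations),
    ae_tendsto_interference_div hL hδ hdk
      (fun k => (hnet (d k) (hd0 k)).isGainModel (hN1 _ (hd0 k)))] with ω havg haω hr hI
  exact scaling_of_components hL hL0 hσ2 hdlim (hNlim.comp hdlim)
    (x := fun k i => X (d k) i ω) (h := fun k i => h (d k) i ω) (a := fun k => a k ω) hr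
    (Eventually.of_forall fun k => haω (d k) (hd0 k)) havg hI

/-- The distance to the nearest point decreases with the density and the interference increases, so
almost sure convergence along the integers, which involves countably many null sets, extends to all
real densities. -/
theorem ae_scaling_of_densification (hL : PhysicallyFeasible L)
    (hL0 : ContinuousWithinAt L (Set.Ici 0) 0) (hσ2 : 0 ≤ σ2)
    (hN1 : ∀ lam, 0 < lam → 1 ≤ N lam) (hNlim : Tendsto N atTop atTop)
    (hnet : ∀ lam, 0 < lam → IsSIMONetwork P lam (X lam) (h lam)) {a : ℕ → Ω → ℂ}
    (ha : ∀ᵐ ω ∂P, ∀ lam, 0 < lam → ∀ k : Fin (N lam), h lam 0 ω k = a k ω)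
    (hdens : Densification P X h) :
    ∀ᵐ ω ∂P,
      SINRScaling (L 0 / (2 * Real.pi * pathGamma L)) atTop (fun lam : ℝ => lam)
        (fun lam => (N lam : ℝ))
        (fun lam => simoSINR L σ2 (fun i => X lam i ω) (fun i => h lam i ω)) ∧
      ASEScaling (L 0 / (2 * Real.pi * pathGamma L)) atTop (fun lam : ℝ => lam)
        (fun lam => (N lam : ℝ))
        (fun lam => ase lam (simoSINR L σ2 (fun i => X lam i ω) (fun i => h lam i ω))) := by
  have hd0 : ∀ k : ℕ, (0 : ℝ) < (k : ℝ) + 1 := fun k => by positivity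
  have hdk : ∀ k : ℕ, (1 : ℝ) * (k + 1) ≤ (k : ℝ) + 1 := fun k => by rw [one_mul]
  have hm : ∀ k : ℕ, IsGainModel P ((k : ℝ) + 1) (X (k + 1))
      (fun i ω => mrcGain (fun j => h (k + 1) j ω) i) := fun k =>
    (hnet _ (hd0 k)).isGainModel (hN1 _ (hd0 k))
  filter_upwards [ae_tendsto_average_normSq hNlim hnet ha, ha,
    ae_tendsto_nearest (d := fun k : ℕ => (k : ℝ) + 1) ⟨1, one_pos, hdk⟩
      (fun k => (hnet _ (hd0 k)).locations),
    ae_tendsto_interference_div hL one_pos hdk hm, hdens,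
    ae_all_iff.2 fun k : ℕ => (hm k).ae_summable (hd0 k) hL] with ω havg haω hr hI ⟨hord, hφ⟩ hs
  -- Summability at all real densities off a single null set, inherited from the integer ⌊λ⌋ + 1.
  have hsum : ∀ lam, 0 < lam → Summable fun i =>
      L ‖X lam (i + 1) ω‖ * mrcGain (fun j => h lam j ω) (i + 1) := by
    intro lam hlam
    obtain ⟨φ, hφi, hφX, hφg⟩ := hφ lam (⌊lam⌋₊ + 1) hlam (Nat.lt_floor_add_one lam).le
    exact (summable_and_interference_le_of_injective hL (x := fun i => X lam i ω)
      (x' := fun i => X (⌊lam⌋₊ + 1) i ω) (h := fun j => h lam j ω)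
      (h' := fun j => h (⌊lam⌋₊ + 1) j ω) hφi hφX hφg (hs ⌊lam⌋₊)).1
  have hmono : MonotoneOn (fun lam => interference L (fun i => X lam i ω) (fun i => h lam i ω))
      (Set.Ioi 0) := by
    intro lam hlam lam' hlam' hle
    obtain ⟨φ, hφi, hφX, hφg⟩ := hφ lam lam' hlam hle
    exact (summable_and_interference_le_of_injective hL (x := fun i => X lam i ω)
      (x' := fun i => X lam' i ω) (h := fun j => h lam j ω)
      (h' := fun j => h lam' j ω) hφi hφX hφg (hsum lam' hlam')).2
  have hanti : ∀ lam lam', 0 < lam → lam ≤ lam' → ‖X lam' 0 ω‖ ≤ ‖X lam 0 ω‖ := by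
    intro lam lam' hlam hle
    obtain ⟨φ, -, hφX, -⟩ := hφ lam lam' hlam hle
    rw [← hφX 0]
    exact hord lam' (hlam.trans_le hle) (Nat.zero_le _)
  have hr' : Tendsto (fun lam : ℝ => ‖X lam 0 ω‖) atTop (𝓝 0) := by
    have h1 : Tendsto (fun k : ℕ => ‖X (k : ℝ) 0 ω‖) atTop (𝓝 0) := by
      rw [← tendsto_add_atTop_iff_nat 1]
      simpa using hr
    refine squeeze_zero' (Eventually.of_forall fun _ => norm_nonneg _) ?_
      (h1.comp (tendsto_nat_floor_atTop (α := ℝ)))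
    filter_upwards [eventually_ge_atTop 1] with lam hlam
    exact hanti _ _ (by exact_mod_cast Nat.floor_pos.2 hlam) (Nat.floor_le (by linarith))
  exact scaling_of_components hL hL0 hσ2 tendsto_id hNlim
    (x := fun lam i => X lam i ω) (h := fun lam i => h lam i ω) (a := fun k => a k ω) hr'
    ((eventually_gt_atTop 0).mono fun lam hlam => haω lam hlam) havg
    (tendsto_div_of_monotoneOn_of_tendsto_nat hmono hI)

end

/-! ### Second moment of the inverse interference -/

section

variable {Ω : Type*} [MeasurableSpace Ω] {P : Measure Ω} [IsProbabilityMeasure P]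
  {lam : ℝ} {X : ℕ → Ω → Plane} {G : ℕ → Ω → ℝ} {L : ℝ → ℝ}

lemma IsGainModel.hasLaw_sum (hm : IsGainModel P lam X G) {F : Finset ℕ} (hF : 0 < F.card) :
    HasLaw (fun ω => ∑ i ∈ F, G (i + 1) ω) (gammaMeasure F.card 1) P := by
  have hM : AEMeasurable (fun ω => ∑ i ∈ F, G (i + 1) ω) P :=
    Finset.aemeasurable_fun_sum _ fun i _ => (hm.measurable (i + 1)).aemeasurable
  refine ⟨hM, ?_⟩
  have : IsProbabilityMeasure (P.map fun ω => ∑ i ∈ F, G (i + 1) ω) :=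
    Measure.isProbabilityMeasure_map hM
  have : IsProbabilityMeasure (gammaMeasure F.card 1) :=
    isProbabilityMeasure_gammaMeasure (by exact_mod_cast hF) one_pos
  symm
  refine measure_ext_of_mgf_eq one_pos (fun t ht => ?_) fun t ht => ?_
  · rw [mgf_gammaMeasure hF ht]
    have : 0 < 1 - t := by linarith
    positivity
  · rw [mgf_gammaMeasure hF ht, mgf_id_map hM]
    have hind : iIndepFun (fun i => G (i + 1)) P := hm.indep.precomp (Nat.succ_injective)
    have h1 := hind.mgf_sum (t := t) (fun i => hm.measurable (i + 1)) F
    have e : (∑ i ∈ F, G (i + 1)) = fun ω => ∑ i ∈ F, G (i + 1) ω := by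
      ext ω
      simp
    rw [e] at h1
    rw [h1]
    have h2 : ∀ i, mgf (G (i + 1)) P t = 1 / (1 - t) := fun i => by
      have h3 := mgf_gammaMeasure one_pos ht
      rw [pow_one, Nat.cast_one] at h3
      rw [← mgf_id_map (hm.law i).aemeasurable, (hm.law i).map_eq, expMeasure]
      exact h3
    simp [h2]

/-- For the Γ(3, 1) law the moment of order −2 is Γ(1)/Γ(3) = 1/2. Three is the least number of
exponentials for which it is finite. -/
lemma IsGainModel.lintegral_inv_sq_sum (hm : IsGainModel P lam X G) {F : Finset ℕ}
    (hF : F.card = 3) :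
    ∫⁻ ω, ((ENNReal.ofReal (∑ i ∈ F, G (i + 1) ω)) ^ 2)⁻¹ ∂P = ENNReal.ofReal (1 / 2) := by
  have hlaw := hm.hasLaw_sum (F := F) (by omega)
  rw [hF] at hlaw
  rw [hlaw.lintegral_comp (f := fun x => ((ENNReal.ofReal x) ^ 2)⁻¹) (by fun_prop)]
  have h3 : (0 : ℝ) < ((3 : ℕ) : ℝ) + (-2) := by norm_num
  have h1 := integral_rpow_gammaMeasure (n := 3) (by norm_num) h3
  have h2 := integrable_rpow_gammaMeasure (n := 3) (by norm_num) h3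
  have e : Real.Gamma (((3 : ℕ) : ℝ) + (-2)) / Real.Gamma ((3 : ℕ) : ℝ) = 1 / 2 := by
    rw [show ((3 : ℕ) : ℝ) + (-2) = 1 by norm_num, Real.Gamma_one,
      show ((3 : ℕ) : ℝ) = ((2 : ℕ) : ℝ) + 1 by norm_num, Real.Gamma_nat_eq_factorial]
    norm_num
  have hpos : ∀ᵐ x ∂(gammaMeasure ((3 : ℕ) : ℝ) 1), 0 < x := by
    have hac : gammaMeasure ((3 : ℕ) : ℝ) 1 ≪ volume := withDensity_absolutelyContinuous _ _
    have h4 : ∀ᵐ x ∂(gammaMeasure ((3 : ℕ) : ℝ) 1), 0 ≤ x := by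
      have h5 : ∀ᵐ ω ∂P, 0 ≤ ∑ i ∈ F, G (i + 1) ω :=
        ae_of_all _ fun ω => Finset.sum_nonneg fun i _ => hm.nonneg _ _
      rwa [hlaw.ae_iff (p := fun x => 0 ≤ x) measurableSet_Ici.mem] at h5
    have h6 : ∀ᵐ x ∂(gammaMeasure ((3 : ℕ) : ℝ) 1), x ≠ 0 :=
      hac.ae_le (compl_mem_ae_iff.2 (measure_singleton 0))
    filter_upwards [h4, h6] with x hx hx0 using lt_of_le_of_ne hx (Ne.symm hx0)
  rw [← e, ← h1, ofReal_integral_eq_lintegral_ofReal h2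
    (hpos.mono fun x hx => Real.rpow_nonneg hx.le _)]
  refine lintegral_congr_ae (hpos.mono fun x hx => ?_)
  simp only
  rw [← ENNReal.ofReal_pow hx.le, ← ENNReal.ofReal_inv_of_pos (by positivity), Real.rpow_neg hx.le,
    Real.rpow_two]

/-- Given at least four points in an annulus where `L ≥ b`, three of them interfere. -/
lemma IsGainModel.lintegral_inv_sq_eInterference_le (hm : IsGainModel P lam X G) {x : ℕ → Plane}
    {A : Set Plane} {b : ℝ} (hb : 0 < b) (hA : ∀ y ∈ A, b ≤ L ‖y‖)
    (hx : ¬ {i | x i ∈ A}.encard ≤ 3) :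
    ∫⁻ ω, ((eInterference L x (fun i => G i ω)) ^ 2)⁻¹ ∂P ≤ ENNReal.ofReal ((b ^ 2)⁻¹) := by
  -- Index 0 is the serving point; discarding it from at least four points leaves at least three.
  have h1 : 3 ≤ {i | x (i + 1) ∈ A}.encard := by
    by_contra hlt
    have hsub : {i | x i ∈ A} ⊆ insert 0 (Nat.succ '' {i | x (i + 1) ∈ A}) := by
      intro i hi
      cases i with
      | zero => exact Set.mem_insert _ _
      | succ j => exact Set.mem_insert_of_mem _ ⟨j, hi, rfl⟩
    have h2 := (Set.encard_le_encard hsub).trans (Set.encard_insert_le _ _)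
    rw [Nat.succ_injective.encard_image] at h2
    have h3 : {i | x (i + 1) ∈ A}.encard + 1 ≤ 3 := Order.add_one_le_of_lt (not_le.1 hlt)
    exact hx (h2.trans h3)
  obtain ⟨t, ht, ht3⟩ := Set.exists_subset_encard_eq h1
  have htfin : t.Finite := Set.finite_of_encard_eq_coe (k := 3) ht3
  have hcard : htfin.toFinset.card = 3 := by
    rw [htfin.encard_eq_coe_toFinset_card] at ht3
    exact_mod_cast ht3
  have h4 : ∀ ω, ENNReal.ofReal b * ENNReal.ofReal (∑ i ∈ htfin.toFinset, G (i + 1) ω) ≤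
      eInterference L x (fun i => G i ω) := by
    intro ω
    rw [← ENNReal.ofReal_mul hb.le, Finset.mul_sum, ENNReal.ofReal_sum_of_nonneg
      fun i _ => mul_nonneg hb.le (hm.nonneg _ _)]
    refine le_trans (Finset.sum_le_sum fun i hi => ?_) (ENNReal.sum_le_tsum htfin.toFinset)
    refine ENNReal.ofReal_le_ofReal (mul_le_mul_of_nonneg_right ?_ (hm.nonneg _ _))
    exact hA _ (ht (htfin.mem_toFinset.1 hi))
  calc ∫⁻ ω, ((eInterference L x (fun i => G i ω)) ^ 2)⁻¹ ∂P
      ≤ ∫⁻ ω, ENNReal.ofReal ((b ^ 2)⁻¹) *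
          ((ENNReal.ofReal (∑ i ∈ htfin.toFinset, G (i + 1) ω)) ^ 2)⁻¹ ∂P := by
        refine lintegral_mono fun ω => ?_
        rw [ENNReal.ofReal_inv_of_pos (by positivity), ENNReal.ofReal_pow hb.le,
          ← ENNReal.mul_inv (Or.inl (by simp [hb])) (Or.inl (by simp)), ← mul_pow]
        exact ENNReal.inv_le_inv.2 (pow_le_pow_left₀ zero_le (h4 ω) 2)
    _ = ENNReal.ofReal ((b ^ 2)⁻¹) * ENNReal.ofReal (1 / 2) := by
        rw [lintegral_const_mul' _ _ ENNReal.ofReal_ne_top, hm.lintegral_inv_sq_sum hcard]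
    _ ≤ ENNReal.ofReal ((b ^ 2)⁻¹) * 1 := by
        gcongr
        rw [← ENNReal.ofReal_one]
        exact ENNReal.ofReal_le_ofReal (by norm_num)
    _ = _ := mul_one _

end

/-- Radii whose squares are equally spaced, starting from `ρ`. -/
def shellRadius (ρ : ℝ) (m : ℕ) : ℝ := Real.sqrt (ρ ^ 2 + m)

lemma shellRadius_sq (ρ : ℝ) (m : ℕ) : shellRadius ρ m ^ 2 = ρ ^ 2 + m :=
  Real.sq_sqrt (by positivity)

lemma shellRadius_mono (ρ : ℝ) : Monotone (shellRadius ρ) := fun m n hmn =>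
  Real.sqrt_le_sqrt (by have : (m : ℝ) ≤ n := by exact_mod_cast hmn
                        linarith)

lemma le_shellRadius {ρ : ℝ} (m : ℕ) : ρ ≤ shellRadius ρ m :=
  Real.le_sqrt_of_sq_le (by have : (0 : ℝ) ≤ m := by positivity
                            linarith)

lemma shellRadius_succ_pos (ρ : ℝ) (m : ℕ) : 0 < shellRadius ρ (m + 1) :=
  Real.sqrt_pos.2 (by positivity)

/-- The exponentially weighted sum of `1 / M²` over the shells is controlled by the tail integral. -/
lemma tsum_shell_lt_top {M : ℝ → ℝ} {ρ μ : ℝ} (hμ : 0 ≤ μ)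
    (hM : AntitoneOn M (Set.Ici ρ)) (hpos : ∀ r, ρ ≤ r → 0 < M r)
    (hint : IntegrableOn (fun r => r / M r ^ 2 * Real.exp (-Real.pi * μ * r ^ 2)) (Set.Ici ρ)) :
    ∑' m : ℕ, ENNReal.ofReal ((M (shellRadius ρ (m + 1)) ^ 2)⁻¹ *
      Real.exp (-(Real.pi * μ * m))) < ⊤ := by
  set t := shellRadius ρ with ht
  set f : ℝ → ℝ := fun r => r / M r ^ 2 * Real.exp (-Real.pi * μ * r ^ 2) with hf
  have hπ := Real.pi_pos
  -- The value of 1/M² at t(m+1) is compared with the integral over the next shell outward, where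
  -- 1/M² is at least as large. The exponential at the outer radius of that shell differs from
  -- e^{−πμm} by the factor e^{πμ(ρ²+2)}.
  have hstep : ∀ m : ℕ, ENNReal.ofReal ((M (t (m + 1)) ^ 2)⁻¹ * Real.exp (-(Real.pi * μ * m))) ≤
      ENNReal.ofReal (3 * Real.exp (Real.pi * μ * (ρ ^ 2 + 2))) *
        ∫⁻ r in Set.Ioc (t (m + 1)) (t (m + 2)), ENNReal.ofReal (f r) := by
    intro m
    have h0 := shellRadius_succ_pos ρ m
    have h1 := shellRadius_sq ρ (m + 1)
    have h2 := shellRadius_sq ρ (m + 2)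
    have h3 : t (m + 1) ≤ t (m + 2) := shellRadius_mono ρ (Nat.le_succ _)
    rw [← ht] at h0 h1 h2
    push_cast at h1 h2
    have hm0 : (0 : ℝ) ≤ m := Nat.cast_nonneg m
    -- From t(m+2)² = ρ² + m + 2 ≤ 4(ρ² + m + 1). Consequently 1 = t(m+2)² − t(m+1)² ≤ 3
    -- t(m+1)(t(m+2) − t(m+1)), which is the source of the factor 3.
    have h4 : t (m + 2) ≤ 2 * t (m + 1) := by nlinarith [sq_nonneg ρ]
    have h5 : 1 / 3 ≤ t (m + 1) * (t (m + 2) - t (m + 1)) := by nlinarith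
    have hM1 := hpos _ (le_shellRadius (ρ := ρ) (m + 1))
    rw [← ht] at hM1
    set c := t (m + 1) * ((M (t (m + 1)) ^ 2)⁻¹ * Real.exp (-(Real.pi * μ * (ρ ^ 2 + m + 2)))) with hc
    have h6 : ENNReal.ofReal c * ENNReal.ofReal (t (m + 2) - t (m + 1)) ≤
        ∫⁻ r in Set.Ioc (t (m + 1)) (t (m + 2)), ENNReal.ofReal (f r) := by
      rw [← Real.volume_Ioc, ← setLIntegral_const]
      refine setLIntegral_mono' measurableSet_Ioc fun r hr => ENNReal.ofReal_le_ofReal ?_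
      have hρr : ρ ≤ r := (le_shellRadius (m + 1)).trans hr.1.le
      have hMr := hpos r hρr
      have hMle : M r ≤ M (t (m + 1)) :=
        hM (Set.mem_Ici.2 (le_shellRadius _)) (Set.mem_Ici.2 hρr) hr.1.le
      have hr2 : r ^ 2 ≤ ρ ^ 2 + m + 2 := by
        have := pow_le_pow_left₀ (h0.le.trans hr.1.le) hr.2 2
        linarith
      have e : f r = r * ((M r ^ 2)⁻¹ * Real.exp (-Real.pi * (μ * r ^ 2))) := by
        simp only [hf]
        ring_nf
      rw [e, hc]
      refine mul_le_mul hr.1.le (mul_le_mul ?_ (Real.exp_le_exp.2 ?_) (Real.exp_pos _).le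
        (by positivity)) (by positivity) (h0.le.trans hr.1.le)
      · exact inv_anti₀ (by positivity) (pow_le_pow_left₀ hMr.le hMle 2)
      · have := mul_le_mul_of_nonneg_left hr2 (show 0 ≤ Real.pi * μ by positivity)
        linarith
    refine le_trans ?_ (mul_le_mul_right h6 _)
    rw [← ENNReal.ofReal_mul (by positivity), ← ENNReal.ofReal_mul (by positivity)]
    refine ENNReal.ofReal_le_ofReal ?_
    have e : Real.exp (-(Real.pi * μ * m)) = Real.exp (Real.pi * μ * (ρ ^ 2 + 2)) *
        Real.exp (-(Real.pi * μ * (ρ ^ 2 + m + 2))) := by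
      rw [← Real.exp_add]; ring_nf
    rw [hc, e]
    set E := Real.exp (Real.pi * μ * (ρ ^ 2 + 2)) * Real.exp (-(Real.pi * μ * (ρ ^ 2 + m + 2))) with hE
    have hE0 : 0 < (M (t (m + 1)) ^ 2)⁻¹ * E := by positivity
    calc (M (t (m + 1)) ^ 2)⁻¹ * E ≤ (M (t (m + 1)) ^ 2)⁻¹ * E *
          (3 * (t (m + 1) * (t (m + 2) - t (m + 1)))) := le_mul_of_one_le_right hE0.le (by linarith)
      _ = _ := by rw [hE]; ring
  have hdis : Pairwise (Function.onFun Disjoint fun m : ℕ => Set.Ioc (t (m + 1)) (t (m + 2))) := by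
    have hmon : Monotone fun m : ℕ => t (m + 1) := fun m n hmn =>
      shellRadius_mono ρ (Nat.succ_le_succ hmn)
    exact hmon.pairwise_disjoint_on_Ioc_succ
  have hfin : ∫⁻ r in Set.Ici ρ, ENNReal.ofReal (f r) < ⊤ :=
    (lintegral_ofReal_le_lintegral_enorm _).trans_lt hint.2
  refine (ENNReal.tsum_le_tsum hstep).trans_lt ?_
  rw [ENNReal.tsum_mul_left, ← lintegral_iUnion (fun m => measurableSet_Ioc) hdis]
  refine ENNReal.mul_lt_top ENNReal.ofReal_lt_top (lt_of_le_of_lt (lintegral_mono_set ?_) hfin)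
  refine Set.iUnion_subset fun m r hr => ?_
  exact (le_shellRadius (m + 1)).trans hr.1.le

/-- Given the locations, let m be the first index whose annulus from ρ to the m-th shell radius
holds four points; the conditional inverse second moment is then at most `Q m` = 1/M². For m ≥ 1
this is charged to the event that annulus m − 1 holds at most three points, of probability at most
e³ e^{−λπ(m−1)/2}, and for large λ the resulting series is dominated by the shell sum. -/
theorem exists_bound_lintegral_inv_sq {L : ℝ → ℝ} (hL : PhysicallyFeasible L)
    (hT : TailCondition L) :
    ∃ C lam₀ : ℝ, 0 < lam₀ ∧ ∀ {Ω : Type*} [MeasurableSpace Ω] {P : Measure Ω}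
      [IsProbabilityMeasure P] {lam : ℝ} {X : ℕ → Ω → Plane} {G : ℕ → Ω → ℝ},
      lam₀ ≤ lam → IsGainModel P lam X G →
      ∫⁻ ω, ((eInterference L (fun i => X i ω) (fun i => G i ω)) ^ 2)⁻¹ ∂P ≤ ENNReal.ofReal C := by
  obtain ⟨ρ, ζ, μc, M, hρ, -, hμc, -, hM, hpos, hle, -, hint⟩ := hT
  have hμ : 0 ≤ μc + 1 := by linarith
  have hfin := tsum_shell_lt_top hμ hM hpos (hint (μc + 1) (lt_add_one _))
  set T := ∑' m : ℕ, ENNReal.ofReal ((M (shellRadius ρ (m + 1)) ^ 2)⁻¹ *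
      Real.exp (-(Real.pi * (μc + 1) * m))) with hTdef
  set Q : ℕ → ℝ≥0∞ := fun m => ENNReal.ofReal ((M (shellRadius ρ m) ^ 2)⁻¹) with hQ
  have hQmono : Monotone Q := fun m n hmn => by
    refine ENNReal.ofReal_le_ofReal (inv_anti₀ (pow_pos (hpos _ (le_shellRadius _)) 2)
      (pow_le_pow_left₀ (hpos _ (le_shellRadius _)).le ?_ 2))
    exact hM (Set.mem_Ici.2 (le_shellRadius _)) (Set.mem_Ici.2 (le_shellRadius _))
      (shellRadius_mono ρ hmn)
  have hQ0 : Q 0 ≠ 0 := by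
    simp only [hQ, ne_eq, ENNReal.ofReal_eq_zero, not_le]
    exact inv_pos.2 (pow_pos (hpos _ (le_shellRadius _)) 2)
  have hbound : Q 0 + ENNReal.ofReal (Real.exp 3) * T < ⊤ :=
    ENNReal.add_lt_top.2 ⟨ENNReal.ofReal_lt_top, ENNReal.mul_lt_top ENNReal.ofReal_lt_top hfin⟩
  -- For λ ≥ 2(μc + 1) the Poisson exponent λπm/2 is at least π(μc + 1)m, the weight in `T`.
  refine ⟨(Q 0 + ENNReal.ofReal (Real.exp 3) * T).toReal, 2 * (μc + 1), by linarith, ?_⟩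
  intro Ω _ P _ lam X G hlam hm
  rw [ENNReal.ofReal_toReal hbound.ne]
  have hlam0 : 0 < lam := by linarith
  set A : ℕ → Set Plane := fun m => annulus ρ (shellRadius ρ m) with hAdef
  have hAm : ∀ m, MeasurableSet {ω | pointCount X (A m) ω ≤ 3} := fun m =>
    measurable_pointCount hm.locations.poisson.measurable (measurableSet_annulus _ _)
      (MeasurableSet.of_discrete (s := Set.Iic 3))
  have hcond : ∀ ω', ∫⁻ ω, ((eInterference L (fun i => X i ω') (fun i => G i ω)) ^ 2)⁻¹ ∂P ≤
      Q 0 + ∑' m, {ω | pointCount X (A m) ω ≤ 3}.indicator (fun _ => Q (m + 1)) ω' := by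
    intro ω'
    have hgood : ∀ m, ¬ pointCount X (A m) ω' ≤ 3 →
        ∫⁻ ω, ((eInterference L (fun i => X i ω') (fun i => G i ω)) ^ 2)⁻¹ ∂P ≤ Q m := by
      intro m hmm
      refine hm.lintegral_inv_sq_eInterference_le (hpos _ (le_shellRadius m)) (fun y hy => ?_) hmm
      exact (hM (Set.mem_Ici.2 hy.1) (Set.mem_Ici.2 (le_shellRadius m)) hy.2).trans (hle _ hy.1)
    by_cases hex : ∃ m, ¬ pointCount X (A m) ω' ≤ 3
    · classical
      rcases hm0 : Nat.find hex with _ | m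
      · have h1 := Nat.find_spec hex
        rw [hm0] at h1
        exact (hgood 0 h1).trans le_self_add
      · have h1 := Nat.find_spec hex
        rw [hm0] at h1
        have h2 : pointCount X (A m) ω' ≤ 3 := not_not.1 (Nat.find_min hex (by omega : m < _))
        refine (hgood _ h1).trans (le_trans ?_ le_add_self)
        refine le_trans ?_ (ENNReal.le_tsum m)
        rw [Set.indicator_of_mem (by exact h2)]
    -- If no annulus ever holds four points, all indicators are 1 and the terms are at least `Q 0` >
    -- 0, so the right side is infinite; this event need not be shown to be null.
    · push Not at hex
      have h1 : ∑' m, {ω | pointCount X (A m) ω ≤ 3}.indicator (fun _ => Q (m + 1)) ω' = ⊤ := by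
        refine top_unique (le_trans ?_ (ENNReal.tsum_le_tsum (f := fun _ => Q 0) fun m => ?_))
        · rw [ENNReal.tsum_const_eq_top_of_ne_zero hQ0]
        · rw [Set.indicator_of_mem (by exact hex m)]
          exact hQmono (Nat.zero_le _)
      rw [h1, add_top]
      exact le_top
  rw [lintegral_indepFun_eq hm.measurable_gains hm.measurable_locations hm.indep_locations
    (F := fun g x => ((eInterference L x g) ^ 2)⁻¹)
    ((Downlink.measurable_eInterference hL).pow_const 2).inv]
  refine (lintegral_mono hcond).trans ?_
  rw [lintegral_add_left measurable_const, lintegral_const, measure_univ, mul_one,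
    lintegral_tsum fun m => (measurable_const.indicator (hAm m)).aemeasurable]
  gcongr
  rw [hTdef, ← ENNReal.tsum_mul_left]
  refine ENNReal.tsum_le_tsum fun m => ?_
  rw [lintegral_indicator_const (hAm m)]
  refine (mul_le_mul_right (hm.locations.measure_annulus_le_three hlam0 hρ (le_shellRadius m)) _).trans ?_
  rw [hQ, shellRadius_sq, ← ENNReal.ofReal_mul (inv_nonneg.2 (sq_nonneg _)),
    ← ENNReal.ofReal_mul (Real.exp_pos _).le, sub_eq_add_neg, Real.exp_add]
  refine ENNReal.ofReal_le_ofReal ?_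
  have h1 : Real.exp (-(lam * (Real.pi * (ρ ^ 2 + m - ρ ^ 2)) / 2)) ≤
      Real.exp (-(Real.pi * (μc + 1) * m)) := by
    refine Real.exp_le_exp.2 (neg_le_neg ?_)
    have hπ := Real.pi_pos
    have := mul_le_mul_of_nonneg_right hlam (show 0 ≤ Real.pi * m by positivity)
    linarith
  calc _ = Real.exp 3 * ((M (shellRadius ρ (m + 1)) ^ 2)⁻¹ *
        Real.exp (-(lam * (Real.pi * (ρ ^ 2 + m - ρ ^ 2)) / 2))) := by ring
    _ ≤ _ := by gcongr

/-! ### Convergence in mean -/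

section

variable {Ω : Type*} [MeasurableSpace Ω] {P : Measure Ω} [IsProbabilityMeasure P] {L : ℝ → ℝ}

lemma indepFun_zero_succ {G : ℕ → Ω → ℝ} (hG : ∀ i, Measurable (G i)) (h : iIndepFun G P) :
    IndepFun (G 0) (fun ω i => G (i + 1) ω) P := by
  rw [IndepFun_iff_Indep]
  have h1 := indep_iSup_of_disjoint (S := {0}) (T := {0}ᶜ) (fun i => (hG i).comap_le)
    h.iIndep disjoint_compl_right
  refine indep_of_indep_of_le_left (indep_of_indep_of_le_right h1 ?_) ?_
  · rw [MeasurableSpace.pi, MeasurableSpace.comap_iSup]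
    refine iSup_le fun i => ?_
    rw [MeasurableSpace.comap_comp]
    exact le_iSup₂_of_le (f := fun j (_ : j ∈ ({0}ᶜ : Set ℕ)) =>
      MeasurableSpace.comap (G j) (inferInstance)) (i + 1) (by simp) le_rfl
  · exact le_iSup₂_of_le (f := fun j (_ : j ∈ ({0} : Set ℕ)) =>
      MeasurableSpace.comap (G j) (inferInstance)) 0 rfl le_rfl

/-- The ratio of path loss and interference plus noise, the latter divided by the density. -/
def linkQuality (L : ℝ → ℝ) (σ2 lam : ℝ) (x : ℕ → Plane) (g : ℕ → ℝ) : ℝ :=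
  L ‖x 0‖ * lam / ((eInterference L x g).toReal + σ2)

lemma linkQuality_nonneg (hL : PhysicallyFeasible L) {σ2 lam : ℝ} (hσ2 : 0 ≤ σ2) (hlam : 0 < lam)
    (x : ℕ → Plane) (g : ℕ → ℝ) : 0 ≤ linkQuality L σ2 lam x g :=
  div_nonneg (mul_nonneg (hL.nonneg _ (norm_nonneg _)) hlam.le)
    (add_nonneg ENNReal.toReal_nonneg hσ2)

lemma measurable_linkQuality (hL : PhysicallyFeasible L) (σ2 lam : ℝ) :
    Measurable fun p : (ℕ → ℝ) × (ℕ → Plane) => linkQuality L σ2 lam p.2 p.1 := by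
  have h1 := hL.measurable
  have h2 := Downlink.measurable_eInterference hL
  unfold linkQuality
  fun_prop

/-- The gain of index 0 does not enter the interference. Truncated subtraction replaces it by g 1
and leaves the others alone, which exhibits `linkQuality` as a function of the interfering gains
only. -/
lemma linkQuality_eq_shift (L : ℝ → ℝ) (σ2 lam : ℝ) (x : ℕ → Plane) (g : ℕ → ℝ) :
    linkQuality L σ2 lam x g = linkQuality L σ2 lam x fun i => g (i - 1 + 1) := by
  simp only [linkQuality, eInterference, Nat.add_sub_cancel]

attribute [irreducible] linkQuality

section

variable {lam σ2 : ℝ} {X : ℕ → Ω → Plane} {G : ℕ → Ω → ℝ}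

lemma IsGainModel.measurable_linkQuality (hm : IsGainModel P lam X G) (hL : PhysicallyFeasible L) :
    Measurable fun ω => linkQuality L σ2 lam (fun i => X i ω) (fun i => G i ω) :=
  (Downlink.measurable_linkQuality hL σ2 lam).comp
    (hm.measurable_gains.prodMk hm.measurable_locations)

/-- With the locations frozen, the link quality is a function of the gains of index at least 1,
hence independent of `G 0`; the factor from `G 0` does not depend on the locations and comes out of
the outer integral. -/
theorem IsGainModel.lintegral_mul_linkQuality (hm : IsGainModel P lam X G)
    (hL : PhysicallyFeasible L) {φ : ℝ → ℝ≥0∞} (hφ : Measurable φ) :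
    ∫⁻ ω, φ (G 0 ω) * ENNReal.ofReal (linkQuality L σ2 lam (fun i => X i ω) (fun i => G i ω)) ∂P =
      (∫⁻ ω, φ (G 0 ω) ∂P) *
        ∫⁻ ω, ENNReal.ofReal (linkQuality L σ2 lam (fun i => X i ω) (fun i => G i ω)) ∂P := by
  have hW := (Downlink.measurable_linkQuality hL σ2 lam).ennreal_ofReal
  have hφG : Measurable fun p : (ℕ → ℝ) × (ℕ → Plane) => φ (p.1 0) := by fun_prop
  rw [lintegral_indepFun_eq hm.measurable_gains hm.measurable_locations hm.indep_locations
      (F := fun g x => φ (g 0) * ENNReal.ofReal (linkQuality L σ2 lam x g))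
      (hφG.mul hW),
    lintegral_indepFun_eq hm.measurable_gains hm.measurable_locations hm.indep_locations
      (F := fun g x => ENNReal.ofReal (linkQuality L σ2 lam x g)) hW,
    ← lintegral_const_mul]
  · refine lintegral_congr fun ω' => ?_
    set f : (ℕ → ℝ) → ℝ≥0∞ := fun g => ENNReal.ofReal
      (linkQuality L σ2 lam (fun i => X i ω') (fun i => g (i - 1))) with hf
    have hg : Measurable fun g : ℕ → ℝ => ((fun i => g (i - 1), fun i => X i ω') :
        (ℕ → ℝ) × (ℕ → Plane)) :=
      (measurable_pi_lambda _ fun i => measurable_pi_apply (i - 1)).prodMk measurable_const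
    have hfm : Measurable f := hW.comp hg
    have hind := (indepFun_zero_succ hm.measurable hm.indep).comp hφ hfm
    have h1 := lintegral_mul_eq_lintegral_mul_lintegral_of_indepFun
      (hφ.comp (hm.measurable 0)) (hfm.comp (measurable_pi_lambda _ fun i => hm.measurable (i + 1)))
      hind
    have e : ∀ ω, f (fun i => G (i + 1) ω) =
        ENNReal.ofReal (linkQuality L σ2 lam (fun i => X i ω') (fun i => G i ω)) := fun ω => by
      rw [linkQuality_eq_shift L σ2 lam _ (fun i => G i ω)]
    simp only [Pi.mul_apply, Function.comp_apply, e] at h1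
    exact h1
  · have h2 : Measurable (Function.uncurry fun ω' ω =>
        ENNReal.ofReal (linkQuality L σ2 lam (fun i => X i ω') (fun i => G i ω))) :=
      hW.comp ((hm.measurable_gains.comp measurable_snd).prodMk
        (hm.measurable_locations.comp measurable_fst))
    exact h2.lintegral_prod_right

lemma IsGainModel.lintegral_linkQuality_sq_le (hm : IsGainModel P lam X G) (hlam : 0 < lam)
    (hL : PhysicallyFeasible L) (hσ2 : 0 ≤ σ2) :
    ∫⁻ ω, ENNReal.ofReal (linkQuality L σ2 lam (fun i => X i ω) (fun i => G i ω) ^ 2) ∂P ≤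
      ENNReal.ofReal ((L 0 * lam) ^ 2) *
        ∫⁻ ω, ((eInterference L (fun i => X i ω) (fun i => G i ω)) ^ 2)⁻¹ ∂P := by
  have hL0 := hL.zero_pos
  rw [← lintegral_const_mul' _ _ ENNReal.ofReal_ne_top]
  refine lintegral_mono_ae ?_
  filter_upwards [hm.ae_eInterference_ne_top hlam hL] with ω hω
  simp only [linkQuality]
  set J := eInterference L (fun i => X i ω) (fun i => G i ω) with hJ
  -- Here the right side is infinite, because the inverse is taken in `ℝ≥0∞`.
  by_cases h0 : J = 0
  · rw [h0]
    simp only [ne_eq, OfNat.ofNat_ne_zero, not_false_eq_true, zero_pow, ENNReal.inv_zero]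
    rw [ENNReal.mul_top (by simp only [ne_eq, ENNReal.ofReal_eq_zero, not_le]; positivity)]
    exact le_top
  · have hJ0 : 0 < J.toReal := ENNReal.toReal_pos h0 hω
    rw [← ENNReal.ofReal_toReal hω, ENNReal.toReal_ofReal hJ0.le, ← ENNReal.ofReal_pow hJ0.le,
      ← ENNReal.ofReal_inv_of_pos (by positivity), ← ENNReal.ofReal_mul (by positivity)]
    refine ENNReal.ofReal_le_ofReal ?_
    rw [div_pow, ← div_eq_mul_inv]
    have h1 := hL.nonneg ‖X 0 ω‖ (norm_nonneg _)
    have h2 := hL.le_zero ‖X 0 ω‖ (norm_nonneg _)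
    gcongr
    linarith

end

/-- The pointwise bound u ≤ 1/s + s u² with s = √n stands in for Cauchy–Schwarz: E|Y/n − 1|² = 1/n,
so the two terms contribute 1/√n each. -/
lemma lintegral_abs_div_sub_one_le {n : ℕ} (hn : 0 < n) {Y : Ω → ℝ}
    (hY : HasLaw Y (gammaMeasure n 1) P) :
    ∫⁻ ω, ENNReal.ofReal |Y ω / n - 1| ∂P ≤ ENNReal.ofReal (2 / Real.sqrt n) := by
  have hn' : (0 : ℝ) < n := by exact_mod_cast hn
  obtain ⟨s, hs, hss, hsn⟩ : ∃ s : ℝ, 0 < s ∧ s * s = n ∧ s = Real.sqrt n :=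
    ⟨_, Real.sqrt_pos.2 hn', Real.mul_self_sqrt hn'.le, rfl⟩
  have hg : IsProbabilityMeasure (gammaMeasure n 1) :=
    isProbabilityMeasure_gammaMeasure hn' one_pos
  rw [hY.lintegral_comp (f := fun x => ENNReal.ofReal |x / n - 1|) (by fun_prop), ← hsn]
  have h1 := integrable_id_gammaMeasure hn
  have h2 := integrable_sq_gammaMeasure hn
  have h3 := integral_id_gammaMeasure hn
  have h4 := integral_sq_gammaMeasure hn
  generalize gammaMeasure (n : ℝ) 1 = μ at *
  generalize (n : ℝ) = m at *
  have hb : ∀ x : ℝ, |x / m - 1| ≤ (1 / s + s) + (s / m ^ 2) * x ^ 2 - (2 * s / m) * x := by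
    intro x
    have e : (1 / s + s) + (s / m ^ 2) * x ^ 2 - (2 * s / m) * x = 1 / s + s * |x / m - 1| ^ 2 := by
      rw [sq_abs]
      field_simp
      ring
    rw [e]
    have h4 : 1 / s + s * |x / m - 1| ^ 2 - |x / m - 1| =
        ((s * |x / m - 1| - 1) ^ 2 + s * |x / m - 1|) / s := by
      field_simp
      ring
    have h5 : 0 ≤ ((s * |x / m - 1| - 1) ^ 2 + s * |x / m - 1|) / s := by positivity
    linarith
  have hc : Integrable (fun _ : ℝ => 1 / s + s) μ := integrable_const _
  have h5 : Integrable (fun x => (1 / s + s) + (s / m ^ 2) * x ^ 2) μ := hc.add (h2.const_mul _)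
  have h6 : Integrable (fun x => (2 * s / m) * x) μ := h1.const_mul _
  refine (lintegral_mono fun x => ENNReal.ofReal_le_ofReal (hb x)).trans ?_
  have h7 : Integrable (fun x => (1 / s + s) + (s / m ^ 2) * x ^ 2 - (2 * s / m) * x) μ := h5.sub h6
  rw [← ofReal_integral_eq_lintegral_ofReal h7
    (ae_of_all _ fun x => (abs_nonneg _).trans (hb x))]
  refine ENNReal.ofReal_le_ofReal (le_of_eq ?_)
  rw [integral_sub h5 h6, integral_add hc (h2.const_mul _), integral_const_mul, integral_const_mul,
    h3, h4]
  simp only [integral_const, probReal_univ, smul_eq_mul, one_mul]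
  rw [← hss]
  field_simp
  ring

lemma exists_abs_div_sub_le {ell κ η : ℝ} (hκ : κ ≠ 0) (hη : 0 < η) :
    ∃ ε > 0, ∀ x y z : ℝ, |x - ell| < ε → |y - κ| < ε → |z| < ε →
      |x / (y + z) - ell / κ| ≤ η := by
  have hc : ContinuousAt (fun p : ℝ × ℝ × ℝ => p.1 / (p.2.1 + p.2.2)) (ell, κ, 0) := by
    have : (ell, κ, (0 : ℝ)).2.1 + (ell, κ, (0 : ℝ)).2.2 ≠ 0 := by simpa using hκ
    fun_prop (disch := assumption)
  obtain ⟨ε, hε, H⟩ := Metric.continuousAt_iff.1 hc η hη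
  refine ⟨ε, hε, fun x y z hx hy hz => ?_⟩
  have h1 := @H (x, y, z) (by
    simp only [Prod.dist_eq, Real.dist_eq, sub_zero, max_lt_iff]
    exact ⟨hx, hy, hz⟩)
  simp only [Real.dist_eq, add_zero] at h1
  exact h1.le

/-- On the event that r₀ is small and I/λ is near κ, continuity keeps W within r/2 of a. The
complement `B` has exponentially small probability, and there W is split at the level λ³: the
bounded part contributes λ³ P(B), the rest λ⁻³ E[W²] = O(1/λ). -/
theorem tendsto_lintegral_abs_linkQuality_sub (hL : PhysicallyFeasible L)
    (hL0 : ContinuousWithinAt L (Set.Ici 0) 0) (hT : TailCondition L) {σ2 : ℝ} (hσ2 : 0 ≤ σ2)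
    {X : ℝ → ℕ → Ω → Plane} {G : ℝ → ℕ → Ω → ℝ}
    (hm : ∀ lam, 0 < lam → IsGainModel P lam (X lam) (G lam)) :
    Tendsto (fun lam => ∫⁻ ω, ENNReal.ofReal |linkQuality L σ2 lam (fun i => X lam i ω)
      (fun i => G lam i ω) - L 0 / (2 * Real.pi * pathGamma L)| ∂P) atTop (𝓝 0) := by
  have hκ : 0 < 2 * Real.pi * pathGamma L := by
    have := hL.gamma_pos
    positivity
  have hL0p := hL.zero_pos
  set κ := 2 * Real.pi * pathGamma L with hκdef
  set a := L 0 / κ with ha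
  have ha0 : 0 < a := div_pos hL0p hκ
  obtain ⟨K, lam₀, hlam₀, HK⟩ := exists_bound_lintegral_inv_sq hL hT
  rw [ENNReal.tendsto_nhds_zero]
  intro δ hδ
  obtain ⟨r, hr0, hrδ⟩ := ENNReal.lt_iff_exists_nnreal_btwn.1 hδ
  have hr : (0 : ℝ) < r := by exact_mod_cast hr0
  obtain ⟨ε, hε, Hε⟩ := exists_abs_div_sub_le (ell := L 0) hκ.ne' (half_pos hr)
  obtain ⟨ρ, hρ, Hρ⟩ := Metric.continuousWithinAt_iff.1 hL0 ε hε
  obtain ⟨C, c, hC, hc, HC⟩ := exists_interference_concentration hL hε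
  set b := Real.pi * (ρ / 2) ^ 2 / 2 with hb
  have hπ := Real.pi_pos
  have hb0 : 0 < b := by positivity
  have hK : ∀ k : ℝ, 0 < k → Tendsto (fun lam : ℝ => lam ^ 3 * Real.exp (-k * lam)) atTop (𝓝 0) := by
    intro k hk
    refine (tendsto_rpow_mul_exp_neg_mul_atTop_nhds_zero 3 k hk).congr fun lam => ?_
    norm_cast
  have hlim : Tendsto (fun lam : ℝ => (r : ℝ) / 2 + (a + 1) * (C * (lam ^ 3 * Real.exp (-c * lam)) +
      Real.exp 3 * (lam ^ 3 * Real.exp (-b * lam))) + L 0 ^ 2 * |K| / lam) atTop (𝓝 ((r : ℝ) / 2)) := by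
    have h1 := (tendsto_const_nhds (x := (r : ℝ) / 2)).add
      ((((hK c hc).const_mul C).add ((hK b hb0).const_mul (Real.exp 3))).const_mul (a + 1))
    have h2 := h1.add ((tendsto_const_nhds (x := L 0 ^ 2 * |K|)).div_atTop tendsto_id)
    simpa using h2
  have hsig : Tendsto (fun lam : ℝ => σ2 / lam) atTop (𝓝 0) := tendsto_const_nhds.div_atTop tendsto_id
  filter_upwards [hlim.eventually_lt_const (half_lt_self hr), eventually_ge_atTop 1,
    eventually_ge_atTop lam₀, hsig.eventually_lt_const hε] with lam hlt hlam1 hlamK hσ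
  have hlam : 0 < lam := by linarith
  have hm' := hm lam hlam
  set W : Ω → ℝ := fun ω => linkQuality L σ2 lam (fun i => X lam i ω) (fun i => G lam i ω) with hW
  set I : Ω → ℝ := fun ω => ∑' i, L ‖X lam (i + 1) ω‖ * G lam (i + 1) ω with hI
  set B : Set Ω := {ω | ε * lam ≤ |I ω - κ * lam|} ∪ {ω | ρ / 2 < ‖X lam 0 ω‖} with hB
  have hWm : Measurable W := hm'.measurable_linkQuality hL
  have hBm : MeasurableSet B := by
    have h1 := hm'.measurable_interference hL
    have h2 := hm'.locations.poisson.measurable 0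
    exact (measurableSet_le measurable_const (h1.sub_const _).abs).union
      (measurableSet_lt measurable_const h2.norm)
  have hPB : P B ≤ ENNReal.ofReal (C * Real.exp (-c * lam) + Real.exp 3 * Real.exp (-b * lam)) := by
    rw [ENNReal.ofReal_add (by positivity) (by positivity), ← Real.exp_add]
    refine (measure_union_le _ _).trans (add_le_add (HC hlam hm') ?_)
    refine (hm'.locations.measure_norm_gt hlam (by positivity)).trans_eq ?_
    rw [hb]
    ring_nf
  have hpt : ∀ ω, ENNReal.ofReal |W ω - a| ≤ ENNReal.ofReal (r / 2) +
      B.indicator (fun _ => ENNReal.ofReal (a + lam ^ 3)) ω +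
      ENNReal.ofReal (lam ^ 3)⁻¹ * ENNReal.ofReal (W ω ^ 2) := by
    intro ω
    have hW0 : 0 ≤ W ω := linkQuality_nonneg hL hσ2 hlam _ _
    by_cases hω : ω ∈ B
    · rw [Set.indicator_of_mem hω, ← ENNReal.ofReal_mul (by positivity),
        ← ENNReal.ofReal_add (by positivity) (by positivity),
        ← ENNReal.ofReal_add (by positivity) (by positivity)]
      refine ENNReal.ofReal_le_ofReal ?_
      have h1 : |W ω - a| ≤ W ω + a := by
        rw [abs_le]
        constructor <;> linarith
      -- The exponent 3 exceeds the order λ² of the second moment, and the exponentially small P(B)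
      -- beats any power.
      have h2 : W ω ≤ lam ^ 3 + (lam ^ 3)⁻¹ * W ω ^ 2 := by
        have h3 : lam ^ 3 + (lam ^ 3)⁻¹ * W ω ^ 2 - W ω =
            ((lam ^ 3 - W ω) ^ 2 + lam ^ 3 * W ω) / lam ^ 3 := by
          field_simp
          ring
        have h4 : 0 ≤ ((lam ^ 3 - W ω) ^ 2 + lam ^ 3 * W ω) / lam ^ 3 := by positivity
        linarith
      linarith
    · refine le_trans (ENNReal.ofReal_le_ofReal ?_) (le_self_add.trans le_self_add)
      simp only [hB, Set.mem_union, Set.mem_ofPred_eq, not_or, not_le, not_lt] at hω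
      have h1 : |I ω / lam - κ| < ε := by
        rw [div_sub' hlam.ne', abs_div, abs_of_pos hlam, div_lt_iff₀ hlam, mul_comm lam]
        exact hω.1
      have h2 := Hρ (x := ‖X lam 0 ω‖) (Set.mem_Ici.2 (norm_nonneg _)) (by
        rw [Real.dist_eq, sub_zero, abs_norm]
        linarith [hω.2])
      rw [Real.dist_eq] at h2
      have h3 := Hε _ _ (σ2 / lam) h2 h1 (by rwa [abs_of_nonneg (by positivity)])
      have e : W ω = L ‖X lam 0 ω‖ / (I ω / lam + σ2 / lam) := by
        simp only [hW, linkQuality, hI]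
        rw [toReal_eInterference hL _ fun i => hm'.nonneg i ω, ← add_div, div_div_eq_mul_div]
      rwa [e]
  refine (lintegral_mono hpt).trans ?_
  rw [lintegral_add_right _ (by fun_prop), lintegral_add_left measurable_const, lintegral_const,
    measure_univ, mul_one, lintegral_indicator_const hBm,
    lintegral_const_mul' _ _ ENNReal.ofReal_ne_top]
  have hsq := (hm'.lintegral_linkQuality_sq_le hlam hL hσ2).trans
    (mul_le_mul_right ((HK hlamK hm').trans (ENNReal.ofReal_le_ofReal (le_abs_self K))) _)
  rw [← ENNReal.ofReal_mul (by positivity)] at hsq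
  refine (add_le_add (add_le_add le_rfl (mul_le_mul_right hPB _)) (mul_le_mul_right hsq _)).trans ?_
  rw [← ENNReal.ofReal_mul (by positivity), ← ENNReal.ofReal_mul (by positivity),
    ← ENNReal.ofReal_add (by positivity) (by positivity),
    ← ENNReal.ofReal_add (by positivity) (by positivity)]
  refine le_trans ?_ hrδ.le
  rw [← ENNReal.ofReal_coe_nnreal]
  refine ENNReal.ofReal_le_ofReal (le_trans ?_ hlt.le)
  have h1 : (1 : ℝ) ≤ lam ^ 3 := one_le_pow₀ hlam1
  have h2 : a + lam ^ 3 ≤ (a + 1) * lam ^ 3 := by nlinarith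
  have h3 : (a + lam ^ 3) * (C * Real.exp (-c * lam) + Real.exp 3 * Real.exp (-b * lam)) ≤
      (a + 1) * lam ^ 3 * (C * Real.exp (-c * lam) + Real.exp 3 * Real.exp (-b * lam)) :=
    mul_le_mul_of_nonneg_right h2 (by positivity)
  have h4 : (lam ^ 3)⁻¹ * ((L 0 * lam) ^ 2 * |K|) = L 0 ^ 2 * |K| / lam := by
    field_simp
  rw [h4]
  linarith

/-- Scaling laws of the means from convergence in mean of the normalized SINR. -/
theorem mean_scaling_of_tendsto_lintegral {a : ℝ} (ha : 0 < a) {n : ℝ → ℝ}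
    (hn : Tendsto n atTop atTop) {S : ℝ → Ω → ℝ} (hS0 : ∀ lam ω, 0 ≤ S lam ω)
    (hSm : ∀ lam, 0 < lam → Measurable (S lam))
    (h : Tendsto (fun lam => ∫⁻ ω, ENNReal.ofReal |lam / n lam * S lam ω - a| ∂P) atTop (𝓝 0)) :
    (∀ᶠ lam in atTop, Integrable (S lam) P ∧ Integrable (fun ω => ase lam (S lam ω)) P) ∧
      SINRScaling a atTop (fun lam : ℝ => lam) n (fun lam => ∫ ω, S lam ω ∂P) ∧
      ASEScaling a atTop (fun lam : ℝ => lam) n (fun lam => ∫ ω, ase lam (S lam ω) ∂P) := by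
  set D : ℝ → ℝ := fun lam =>
    (∫⁻ ω, ENNReal.ofReal |lam / n lam * S lam ω - a| ∂P).toReal with hD
  have hDlim : Tendsto D atTop (𝓝 0) := by
    have := (ENNReal.tendsto_toReal ENNReal.zero_ne_top).comp h
    rwa [ENNReal.toReal_zero] at this
  have key : ∀ᶠ lam in atTop, 0 < lam ∧ 0 < n lam ∧ Integrable (S lam) P ∧
      Integrable (fun ω => |lam / n lam * S lam ω - a|) P ∧
      ∫ ω, |lam / n lam * S lam ω - a| ∂P = D lam ∧
      Integrable (fun ω => Real.log (1 + S lam ω)) P := by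
    filter_upwards [eventually_gt_atTop 0, hn.eventually_gt_atTop 0,
      h.eventually_lt_const ENNReal.zero_lt_top] with lam hlam hnl hlt
    have hSl := hSm lam hlam
    have hVm : Measurable fun ω => lam / n lam * S lam ω - a := by fun_prop
    have hVi : Integrable (fun ω => lam / n lam * S lam ω - a) P := by
      refine ⟨hVm.aestronglyMeasurable, ?_⟩
      rw [hasFiniteIntegral_iff_norm]
      exact hlt
    have hSi : Integrable (S lam) P := by
      refine ((hVi.add (integrable_const a)).const_mul (n lam / lam)).congr (ae_of_all _ fun ω => ?_)
      simp only [Pi.add_apply, sub_add_cancel]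
      field_simp
    refine ⟨hlam, hnl, hSi, hVi.abs, ?_, ?_⟩
    · exact integral_eq_lintegral_of_nonneg_ae (ae_of_all _ fun ω => abs_nonneg _)
        hVm.abs.aestronglyMeasurable
    · refine hSi.mono' (Real.measurable_log.comp (hSl.const_add 1)).aestronglyMeasurable (ae_of_all _ fun ω => ?_)
      have h1 := hS0 lam ω
      rw [Real.norm_eq_abs, abs_of_nonneg (Real.log_nonneg (by linarith))]
      exact (Real.log_le_sub_one_of_pos (by linarith)).trans (by linarith)
  refine ⟨?_, ?_, ?_⟩
  · filter_upwards [key] with lam ⟨_, _, hS, _, _, hlog⟩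
    exact ⟨hS, (hlog.div_const _).const_mul _⟩
  · refine sinrScaling_of_ratio ha tendsto_id hn ?_
    rw [tendsto_iff_norm_sub_tendsto_zero]
    refine squeeze_zero' (Eventually.of_forall fun _ => norm_nonneg _) ?_ hDlim
    filter_upwards [key] with lam ⟨_, _, hS, _, hDeq, _⟩
    rw [← hDeq]
    have e : lam / n lam * ∫ ω, S lam ω ∂P - a = ∫ ω, (lam / n lam * S lam ω - a) ∂P := by
      rw [integral_sub (hS.const_mul _) (integrable_const _), integral_const_mul]
      simp
    rw [e]
    exact norm_integral_le_integral_norm _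
  · refine aseScaling_of_tendsto ha tendsto_id hn ?_
    -- The relative bound on the logarithm holds for each outcome and is linear in the error, so its
    -- integral is at most `D lam / a`.
    have h1 : Tendsto (fun lam => (∫ ω, Real.log (1 + S lam ω) ∂P) /
        Real.log (1 + a * (n lam / lam))) atTop (𝓝 1) := by
      rw [tendsto_iff_norm_sub_tendsto_zero]
      have h2 : Tendsto (fun lam => D lam / a) atTop (𝓝 0) := by
        simpa using hDlim.div_const a
      refine squeeze_zero' (Eventually.of_forall fun _ => norm_nonneg _) ?_ h2
      filter_upwards [key] with lam ⟨hlam, hnl, hS, hVi, hDeq, hlog⟩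
      have hx : 0 < n lam / lam := div_pos hnl hlam
      have hℓ : 0 < Real.log (1 + a * (n lam / lam)) :=
        Real.log_pos (by linarith [mul_pos ha hx])
      rw [div_sub_one hℓ.ne', norm_div, Real.norm_eq_abs, Real.norm_of_nonneg hℓ.le,
        div_le_iff₀ hℓ, ← hDeq]
      have e : ∫ ω, Real.log (1 + S lam ω) ∂P - Real.log (1 + a * (n lam / lam)) =
          ∫ ω, (Real.log (1 + S lam ω) - Real.log (1 + a * (n lam / lam))) ∂P := by
        rw [integral_sub hlog (integrable_const _)]
        simp
      rw [e, ← integral_div, ← integral_mul_const]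
      have hbd : Integrable (fun ω => |lam / n lam * S lam ω - a| / a *
          Real.log (1 + a * (n lam / lam))) P := (hVi.div_const _).mul_const _
      rw [← Real.norm_eq_abs]
      refine norm_integral_le_of_norm_le hbd (ae_of_all _ fun ω => ?_)
      have h3 := abs_log_one_add_mul_sub_le ha
        (show 0 ≤ lam / n lam * S lam ω from mul_nonneg (div_nonneg hlam.le hnl.le) (hS0 _ _)) hx.le
      have e2 : lam / n lam * S lam ω * (n lam / lam) = S lam ω := by field_simp
      rwa [e2] at h3
    refine (h1.div_const (Real.log 2)).congr' ?_
    filter_upwards [key] with lam ⟨hlam, _⟩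
    have e : ∫ ω, ase lam (S lam ω) ∂P =
        lam * ((∫ ω, Real.log (1 + S lam ω) ∂P) / Real.log 2) := by
      simp only [ase, Real.logb]
      rw [integral_const_mul, integral_div]
    rw [e, mul_div_mul_left _ _ hlam.ne', div_right_comm]

variable {σ2 : ℝ} {N : ℝ → ℕ} {X : ℝ → ℕ → Ω → Plane} {h : (lam : ℝ) → ℕ → Ω → Fin (N lam) → ℂ}

/-- With λ/N · SINR = (G₀/N) W, the error is (G₀/N − 1) W + (W − a). By independence the mean of
|G₀/N − 1| W factors, and it is at most (2/√N)(a + E|W − a|). -/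
theorem mean_scaling (hL : PhysicallyFeasible L) (hL0 : ContinuousWithinAt L (Set.Ici 0) 0)
    (hT : TailCondition L) (hσ2 : 0 ≤ σ2) (hN1 : ∀ lam, 0 < lam → 1 ≤ N lam)
    (hNlim : Tendsto N atTop atTop)
    (hnet : ∀ lam, 0 < lam → IsSIMONetwork P lam (X lam) (h lam)) :
    (∀ᶠ lam in atTop,
      Integrable (fun ω => simoSINR L σ2 (fun i => X lam i ω) (fun i => h lam i ω)) P ∧
      Integrable (fun ω =>
        ase lam (simoSINR L σ2 (fun i => X lam i ω) (fun i => h lam i ω))) P) ∧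
    SINRScaling (L 0 / (2 * Real.pi * pathGamma L)) atTop (fun lam : ℝ => lam)
      (fun lam => (N lam : ℝ))
      (fun lam => ∫ ω, simoSINR L σ2 (fun i => X lam i ω) (fun i => h lam i ω) ∂P) ∧
    ASEScaling (L 0 / (2 * Real.pi * pathGamma L)) atTop (fun lam : ℝ => lam)
      (fun lam => (N lam : ℝ))
      (fun lam => ∫ ω,
        ase lam (simoSINR L σ2 (fun i => X lam i ω) (fun i => h lam i ω)) ∂P) := by
  have ha0 : 0 < L 0 / (2 * Real.pi * pathGamma L) := by
    have := hL.gamma_pos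
    have := hL.zero_pos
    positivity
  have hN : Tendsto (fun lam => (N lam : ℝ)) atTop atTop := tendsto_natCast_atTop_atTop.comp hNlim
  set a := L 0 / (2 * Real.pi * pathGamma L) with ha
  set G : ℝ → ℕ → Ω → ℝ := fun lam i ω => mrcGain (fun j => h lam j ω) i with hG
  set W : ℝ → Ω → ℝ := fun lam ω =>
    linkQuality L σ2 lam (fun i => X lam i ω) (fun i => G lam i ω) with hW
  have hm : ∀ lam, 0 < lam → IsGainModel P lam (X lam) (G lam) := fun lam hlam =>
    (hnet lam hlam).isGainModel (hN1 lam hlam)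
  have hS : ∀ lam ω, simoSINR L σ2 (fun i => X lam i ω) (fun i => h lam i ω) =
      L ‖X lam 0 ω‖ * G lam 0 ω /
        ((eInterference L (fun i => X lam i ω) (fun i => G lam i ω)).toReal + σ2) := by
    intro lam ω
    rw [simoSINR_eq, toReal_eInterference hL _ fun i =>
      mrcGain_nonneg (fun j => h lam j ω) i, interference]
  have hWlim := tendsto_lintegral_abs_linkQuality_sub hL hL0 hT hσ2 hm
  refine mean_scaling_of_tendsto_lintegral ha0 hN
    (fun lam ω => simoSINR_nonneg hL hσ2 (fun i => X lam i ω) (fun i => h lam i ω))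
    (fun lam hlam => ?_) ?_
  · simp_rw [hS]
    have h1 := (hm lam hlam).measurable_eInterference hL
    have h2 := (hm lam hlam).measurable 0
    have h3 := (hm lam hlam).locations.poisson.measurable 0
    have h4 := hL.measurable
    fun_prop
  · have hg : Tendsto (fun lam => ENNReal.ofReal (2 / Real.sqrt (N lam : ℝ))) atTop (𝓝 0) := by
      have h1 : Tendsto (fun lam => 2 / Real.sqrt (N lam : ℝ)) atTop (𝓝 0) :=
        tendsto_const_nhds.div_atTop (Real.tendsto_sqrt_atTop.comp hN)
      simpa using ENNReal.tendsto_ofReal h1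
    have hlim := (ENNReal.Tendsto.mul hg (Or.inr (by simp))
      ((tendsto_const_nhds (x := ENNReal.ofReal a)).add hWlim) (Or.inr (by simp))).add hWlim
    rw [zero_mul, add_zero] at hlim
    refine tendsto_of_tendsto_of_tendsto_of_le_of_le' tendsto_const_nhds hlim
      (Eventually.of_forall fun _ => zero_le) ?_
    filter_upwards [eventually_gt_atTop 0] with lam hlam
    have hm' := hm lam hlam
    have hWm : Measurable (W lam) := hm'.measurable_linkQuality hL
    have hW0 : ∀ ω, 0 ≤ W lam ω := fun ω => linkQuality_nonneg hL hσ2 hlam _ _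
    have hpt : ∀ ω, ENNReal.ofReal |lam / (N lam : ℝ) *
        simoSINR L σ2 (fun i => X lam i ω) (fun i => h lam i ω) - a| ≤
        ENNReal.ofReal |G lam 0 ω / (N lam : ℝ) - 1| * ENNReal.ofReal (W lam ω) +
          ENNReal.ofReal |W lam ω - a| := by
      intro ω
      rw [← ENNReal.ofReal_mul (abs_nonneg _), ← ENNReal.ofReal_add
        (mul_nonneg (abs_nonneg _) (hW0 ω)) (abs_nonneg _)]
      refine ENNReal.ofReal_le_ofReal ?_
      have e : lam / (N lam : ℝ) * simoSINR L σ2 (fun i => X lam i ω) (fun i => h lam i ω) - a =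
          (G lam 0 ω / (N lam : ℝ) - 1) * W lam ω + (W lam ω - a) := by
        rw [hS]
        simp only [hW, linkQuality]
        ring
      rw [e]
      refine (abs_add_le _ _).trans ?_
      rw [abs_mul, abs_of_nonneg (hW0 ω)]
    refine (lintegral_mono hpt).trans ?_
    rw [lintegral_add_right _ (by fun_prop)]
    refine add_le_add ?_ le_rfl
    have h1 := hm'.lintegral_mul_linkQuality (σ2 := σ2) hL
      (φ := fun y => ENNReal.ofReal |y / (N lam : ℝ) - 1|) (by fun_prop)
    refine h1.trans_le (mul_le_mul' ?_ ?_)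
    · exact lintegral_abs_div_sub_one_le (hN1 lam hlam)
        ((hnet lam hlam).hasLaw_gain_zero (hN1 lam hlam))
    · have h2 : ∀ ω, ENNReal.ofReal (W lam ω) ≤ ENNReal.ofReal a + ENNReal.ofReal |W lam ω - a| := by
        intro ω
        rw [← ENNReal.ofReal_add ha0.le (abs_nonneg _)]
        exact ENNReal.ofReal_le_ofReal (by linarith [le_abs_self (W lam ω - a)])
      refine (lintegral_mono h2).trans ?_
      rw [lintegral_add_left measurable_const, lintegral_const, measure_univ, mul_one]

end

end Downlink

end

/-! ### SINR form, almost sure laws and mean laws combined -/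

theorem corollary1 {Ω : Type*} [MeasurableSpace Ω] (P : Measure Ω) [IsProbabilityMeasure P]
    -- path loss and noise power
    (L : ℝ → ℝ) (hL : Downlink.PhysicallyFeasible L)
    (hL0 : ContinuousWithinAt L (Set.Ici 0) 0)
    (σ2 : ℝ) (hσ2 : 0 ≤ σ2)
    -- number of receive antennas as a function of the density
    (N : ℝ → ℕ) (hN1 : ∀ lam, 0 < lam → 1 ≤ N lam) (hNmono : MonotoneOn N (Set.Ioi 0))
    (hNlim : Tendsto N atTop atTop)
    -- the network at each density
    (X : ℝ → ℕ → Ω → Downlink.Plane) (h : (lam : ℝ) → ℕ → Ω → Fin (N lam) → ℂ)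
    (hnet : ∀ lam, 0 < lam → Downlink.IsSIMONetwork P lam (X lam) (h lam)) :
    -- form of the SINR at each density
    (∀ lam, 0 < lam →
      (∀ ω, Downlink.mrcGain (fun i => h lam i ω) 0 = ∑ k, ‖h lam 0 ω k‖ ^ 2) ∧
      (∀ ω, Downlink.simoSINR L σ2 (fun i => X lam i ω) (fun i => h lam i ω) =
        L ‖X lam 0 ω‖ * Downlink.mrcGain (fun i => h lam i ω) 0 /
          ((∑' i, L ‖X lam (i + 1) ω‖ * Downlink.mrcGain (fun j => h lam j ω) (i + 1)) + σ2)) ∧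
      (∀ᵐ ω ∂P, Summable fun i =>
        L ‖X lam (i + 1) ω‖ * Downlink.mrcGain (fun j => h lam j ω) (i + 1)) ∧
      HasLaw (fun ω => Downlink.mrcGain (fun i => h lam i ω) 0) (gammaMeasure (N lam) 1) P ∧
      (∀ i, HasLaw (fun ω => Downlink.mrcGain (fun j => h lam j ω) (i + 1)) (expMeasure 1) P) ∧
      iIndepFun (fun i ω => Downlink.mrcGain (fun j => h lam j ω) i) P ∧
      IndepFun (fun ω i => Downlink.mrcGain (fun j => h lam j ω) i) (fun ω i => X lam i ω) P) ∧
    -- conditional SINR and ASE, when the channel to the serving BS is, at each density, an initial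
    -- segment of one sequence (antennas are added as the density grows)
    (∀ a : ℕ → Ω → ℂ,
      (∀ᵐ ω ∂P, ∀ lam, 0 < lam → ∀ k : Fin (N lam), h lam 0 ω k = a k ω) →
      -- along any sequence of densities of at least linear growth
      (∀ d : ℕ → ℝ, (∃ δ : ℝ, 0 < δ ∧ ∀ k : ℕ, δ * (k + 1) ≤ d k) → ∀ᵐ ω ∂P,
        Downlink.SINRScaling (L 0 / (2 * Real.pi * Downlink.pathGamma L)) atTop
          d (fun k => (N (d k) : ℝ))
          (fun k => Downlink.simoSINR L σ2 (fun i => X (d k) i ω) (fun i => h (d k) i ω)) ∧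
        Downlink.ASEScaling (L 0 / (2 * Real.pi * Downlink.pathGamma L)) atTop
          d (fun k => (N (d k) : ℝ))
          (fun k => Downlink.ase (d k)
            (Downlink.simoSINR L σ2 (fun i => X (d k) i ω) (fun i => h (d k) i ω)))) ∧
      -- as the density tends to infinity through the reals
      (Downlink.Densification P X h → ∀ᵐ ω ∂P,
        Downlink.SINRScaling (L 0 / (2 * Real.pi * Downlink.pathGamma L)) atTop
          (fun lam : ℝ => lam) (fun lam => (N lam : ℝ))
          (fun lam => Downlink.simoSINR L σ2 (fun i => X lam i ω) (fun i => h lam i ω)) ∧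
        Downlink.ASEScaling (L 0 / (2 * Real.pi * Downlink.pathGamma L)) atTop
          (fun lam : ℝ => lam) (fun lam => (N lam : ℝ))
          (fun lam => Downlink.ase lam
            (Downlink.simoSINR L σ2 (fun i => X lam i ω) (fun i => h lam i ω))))) ∧
    -- mean SINR and ASE
    (Downlink.TailCondition L →
      (∀ᶠ lam in atTop,
        Integrable (fun ω =>
          Downlink.simoSINR L σ2 (fun i => X lam i ω) (fun i => h lam i ω)) P ∧
        Integrable (fun ω => Downlink.ase lam
          (Downlink.simoSINR L σ2 (fun i => X lam i ω) (fun i => h lam i ω))) P) ∧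
      Downlink.SINRScaling (L 0 / (2 * Real.pi * Downlink.pathGamma L)) atTop
        (fun lam : ℝ => lam) (fun lam => (N lam : ℝ))
        (fun lam => ∫ ω,
          Downlink.simoSINR L σ2 (fun i => X lam i ω) (fun i => h lam i ω) ∂P) ∧
      Downlink.ASEScaling (L 0 / (2 * Real.pi * Downlink.pathGamma L)) atTop
        (fun lam : ℝ => lam) (fun lam => (N lam : ℝ))
        (fun lam => ∫ ω, Downlink.ase lam
          (Downlink.simoSINR L σ2 (fun i => X lam i ω) (fun i => h lam i ω)) ∂P)) := by
  refine ⟨fun lam hlam => Downlink.sinr_form hL hlam (hN1 lam hlam) (hnet lam hlam) σ2,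
    fun a ha => ⟨fun d hd => Downlink.ae_scaling_of_sequence hL hL0 hσ2 hN1 hNlim hnet ha hd,
      fun hdens => Downlink.ae_scaling_of_densification hL hL0 hσ2 hN1 hNlim hnet ha hdens⟩,
    fun hT => Downlink.mean_scaling hL hL0 hT hσ2 hN1 hNlim hnet⟩
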